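/- **Theorem (Normal Form Theorem).** *Setting.* Let $X$ be a finite dimensional real inner product space and $s\in GL(X)$. Put $\phi_s(A)=s^{-1}As$ (an automorphism of $\mathfrak{gl}(X)$) and $\psi_s(A)=s^{-1}A^*s$ (an anti-automorphism). Let $\gamma_s$ be $\phi_s$ or $\psi_s$, with $\gamma_s^2=\mathrm{id}$, and let $s$ be normalised: $s^2=\varepsilon I$ if $\gamma_s=\phi_s$, and $s^*=\varepsilon s$ if $\gamma_s=\psi_s$, with $\varepsilon=\pm1$. For $\mu=\pm1$ let $\mathfrak{gl}_\mu(X)=\{A:\gamma_s(A)=\mu A\}$. The eight types $(\gamma_s,\varepsilon,\mu)$ are 1: $(\phi,+,+)$; 2: $(\phi,+,-)$; 3: $(\phi,-,+)$; 4: $(\phi,-,-)$; 5: $(\psi,+,+)$; 6: $(\psi,+,-)$; 7: $(\psi,-,+)$; 8: $(\psi,-,-)$ (equivariant of type $\mathbb R$, reversible of type $\mathbb R$, equivariant of type $\mathbb C$, reversible of type $\mathbb C$, symmetric, anti-symmetric, anti-symplectic, symplectic). For anti-automorphisms put $\omega(x,y)=\langle x,sy\rangle$; then $L\in\mathfrak{gl}_\mu(X)$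 means $\omega(Lx,y)=\mu\,\omega(x,Ly)$. Pairs $(L,s)$ on $X$ and $(L',s')$ on $X'$ are *equivalent* if there is a linear isomorphism $g:X\to X'$ with $gL=L'g$ and, for automorphisms, $gs=s'g$, or, for anti-automorphisms, $\langle gx,s'gy\rangle=\langle x,sy\rangle$ for all $x,y$. The space $X$ is an *indecomposable* $(L,s)$-invariant space if $X\ne0$ and $X$ is not the direct sum of two nonzero $L$-invariant subspaces which are $s$-invariant (automorphisms) or $\omega$-orthogonal to each other (anti-automorphisms). Let $L\in\mathfrak{gl}_\mu(X)$, let $X$ be an indecomposable $(L,s)$-invariant space, let $L=S+N$ be the Jordan–Chevalley decomposition ($S$ semisimple, $N$ nilpotent, $SN=NS$), and let $n$ be the height of $N$ (the least $n$ with $N^n=0$). A *reduced space* is an $S$-invariant complement $Y$ of $NX$ in $X$ which, for automorphisms, is also $s$-invariant. The *reduced structure map* $t$ on $Y$ is $s|_Y$ for automorphisms; for anti-automorphisms it is defined by $\langle x,ty\rangle=\omega(x,N^{n-1}y)$ for $x,y\in Y$. *Claim.* (a) Reduced spaces exist. For every reduced space $Y$ one has $X=Y\oplus NY\oplus\dots\oplus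 N^{n-1}Y$ with $\dim N^jY=\dim Y$ for $0\le j<n$; the reduced structure map $t$ exists and is invertible; and $Y$ is an indecomposable $(S|_Y,t)$-invariant space with $S|_Y$ semisimple, of the same type as $(L,s)$ for automorphisms, and of type $(\psi,\varepsilon\mu^{n-1},\mu)$ for anti-automorphisms. (b) The normal form of $L$ on $X$ is determined by the normal form of $S$ on $Y$ (and the height): if $(L',s')$ on an indecomposable $X'$ has the same type, with data $S',N',n',Y',t'$, then $(L,s)$ and $(L',s')$ are equivalent if and only if $n=n'$ and $(S|_Y,t)$ and $(S'|_{Y'},t')$ are equivalent. (c) $(S|_Y,t)$ is equivalent to exactly one pair $(S,s)$ of matrices in the following list for its type, in which each choice of the sign $\pm$ and of the parameters counts as a separate pair. Every pair in the list is a semisimple indecomposable pair of its type, and different pairs of the same type, in particular those that differ only in the sign, are inequivalent. Here $R=\begin{pmatrix}1&0\\0&-1\end{pmatrix}$, $T=\begin{pmatrix}0&1\\1&0\end{pmatrix}$, $J=\begin{pmatrix}0&-1\\1&0\end{pmatrix}$, $I=I_2$, $C=\alpha I+\beta J=\begin{pmatrix}\alpha&-\beta\\\beta&\alpha\end{pmatrix}$,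 $T_4=\begin{pmatrix}0&I\\I&0\end{pmatrix}$, $J_4=\begin{pmatrix}0&-I\\I&0\end{pmatrix}$, and $\alpha,\beta\in\mathbb R$. - Type 1: $s=\pm1$, $S=\alpha$; $\ s=\pm I$, $S=C$, $\beta>0$. - Type 2: $s=\pm1$, $S=0$; $\ s=T$, $S=\alpha R$, $\alpha>0$; $\ s=R$, $S=\beta J$, $\beta>0$; $\ s=T_4$, $S=\mathrm{diag}(C,-C)$, $\alpha,\beta>0$. - Type 3: $s=\pm J$, $S=C$, $\beta>0$; $\ s=J$, $S=\alpha I$ (for $\beta=0$ there is no sign). - Type 4: $s=J$, $S=\alpha R$, $\alpha\ge0$; $\ s=J_4$, $S=\mathrm{diag}(C,-C)$, $\alpha\ge0$, $\beta>0$. - Type 5: $s=\pm1$, $S=\alpha$; $\ s=R$, $S=C$, $\beta>0$. - Type 6: $s=\pm1$, $S=0$; $\ s=T$, $S=\alpha R$, $\alpha>0$; $\ s=\pm I$, $S=\beta J$, $\beta>0$; $\ s=T_4$, $S=\mathrm{diag}(C,-C^{\mathsf T})$, $\alpha,\beta>0$. - Type 7: $s=J$, $S=\alpha I$; $\ s=J_4$,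 $S=\mathrm{diag}(C,C^{\mathsf T})$, $\beta>0$. - Type 8: $s=J$, $S=\alpha R$, $\alpha\ge0$; $\ s=\pm J$, $S=\beta J$, $\beta>0$; $\ s=J_4$, $S=\mathrm{diag}(C,-C^{\mathsf T})$, $\alpha,\beta>0$. -/

import Mathlib

open scoped InnerProductSpace

noncomputable section

namespace AntiAut

/-- The two kinds of structure on `gl(X)`: automorphisms and anti-automorphisms. -/
inductive Kind where
  | auto
  | anti

/-- The eight types of maps `L` with `γ_s(L) = μ L`. -/
inductive MapType where
  | equivariantR
  | reversibleR
  | equivariantC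
  | reversibleC
  | symmetric
  | antiSymmetric
  | antiSymplectic
  | symplectic

namespace MapType

/-- Is `γ_s` an automorphism or an anti-automorphism? -/
def kind : MapType → Kind
  | equivariantR | reversibleR | equivariantC | reversibleC => Kind.auto
  | symmetric | antiSymmetric | antiSymplectic | symplectic => Kind.anti

/-- The sign `ε` of the structure map (`s² = ε` for automorphisms,
`s* = ε s` for anti-automorphisms). -/
def eps : MapType → ℝ
  | equivariantR | reversibleR | symmetric | antiSymmetric => 1
  | equivariantC | reversibleC | antiSymplectic | symplectic => -1

/-- The eigenvalue `μ` of `γ_s`. -/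
def mu : MapType → ℝ
  | equivariantR | equivariantC | symmetric | antiSymplectic => 1
  | reversibleR | reversibleC | antiSymmetric | symplectic => -1

/-- The type of the reduced map when the nilpotent part has height `n`.  For anti-automorphisms
the sign `ε` of the reduced structure map is `ε μ ^ (n - 1)`; for automorphisms the type does not
change. -/
def reduced : MapType → ℕ → MapType
  | antiSymmetric, n => if Odd n then antiSymmetric else symplectic
  | symplectic, n => if Odd n then symplectic else antiSymmetric
  | T, _ => T

end MapType

section Systems

variable {X : Type*} [NormedAddCommGroup X] [InnerProductSpace ℝ X] [FiniteDimensional ℝ X]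
variable {X' : Type*} [NormedAddCommGroup X'] [InnerProductSpace ℝ X'] [FiniteDimensional ℝ X']

/-- The automorphism `φ_s(A) = s⁻¹ A s` or the anti-automorphism `ψ_s(A) = s⁻¹ A* s`. -/
def gamma (k : Kind) (s : X ≃ₗ[ℝ] X) (A : Module.End ℝ X) : Module.End ℝ X :=
  match k with
  | Kind.auto => s.symm.toLinearMap ∘ₗ A ∘ₗ s.toLinearMap
  | Kind.anti => s.symm.toLinearMap ∘ₗ LinearMap.adjoint A ∘ₗ s.toLinearMap

/-- `s` is a (normalised) structure map, of the sign prescribed by `T`, of the involutive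
(anti)-automorphism `γ_s`. -/
structure IsStructureMap (T : MapType) (s : X ≃ₗ[ℝ] X) : Prop where
  involutive : ∀ A : Module.End ℝ X, gamma T.kind s (gamma T.kind s A) = A
  sign : match T.kind with
    | Kind.auto => ∀ x, s (s x) = T.eps • x
    | Kind.anti => LinearMap.adjoint s.toLinearMap = T.eps • s.toLinearMap

/-- `X` is not the direct sum of two nonzero `L`-invariant subspaces that are compatible with the
structure: invariant under `s` for automorphisms, orthogonal to each other for the form
`ω(x, y) = ⟪x, s y⟫` for anti-automorphisms. -/
def Indecomposable (k : Kind) (s : X ≃ₗ[ℝ] X) (L : Module.End ℝ X) : Prop :=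
  Nontrivial X ∧ ∀ U W : Submodule ℝ X, IsCompl U W →
    (∀ u ∈ U, L u ∈ U) → (∀ w ∈ W, L w ∈ W) →
    (match k with
      | Kind.auto => (∀ u ∈ U, s u ∈ U) ∧ (∀ w ∈ W, s w ∈ W)
      | Kind.anti => ∀ u ∈ U, ∀ w ∈ W, ⟪u, s w⟫_ℝ = 0) →
    U = ⊥ ∨ W = ⊥

/-- `L ∈ gl_μ(X)` for the structure map `s` of type `T`, and `X` is an indecomposable
`(L, s)`-invariant space. -/
structure IsIndecomposablePair (T : MapType) (L : Module.End ℝ X) (s : X ≃ₗ[ℝ] X) : Prop where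
  structureMap : IsStructureMap T s
  eigen : gamma T.kind s L = T.mu • L
  indecomposable : Indecomposable T.kind s L

/-- `L = S + N` is the Jordan-Chevalley decomposition of `L`. -/
structure IsJordanChevalley (L S N : Module.End ℝ X) : Prop where
  sum : L = S + N
  comm : Commute S N
  semisimple : S.IsSemisimple
  nilpotent : IsNilpotent N

/-- Equivalence of pairs `(L, s)` on `X` and `(L', s')` on `X'` under a linear isomorphism `g`:
`L' = g L g⁻¹`, and `s' = g s g⁻¹` for automorphisms, while for anti-automorphisms `g` carries the
form `⟪x, s y⟫` to the form `⟪x', s' y'⟫`. -/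
def PairEquiv (k : Kind) (L s : Module.End ℝ X) (L' s' : Module.End ℝ X') : Prop :=
  ∃ g : X ≃ₗ[ℝ] X', (∀ x, g (L x) = L' (g x)) ∧
    match k with
    | Kind.auto => ∀ x, g (s x) = s' (g x)
    | Kind.anti => ∀ x y, ⟪g x, s' (g y)⟫_ℝ = ⟪x, s y⟫_ℝ

/-- `Y` is a reduced space: an `S`-invariant complement of `N X` in `X`, which for automorphisms
is also `s`-invariant. -/
structure IsReducedSpace (k : Kind) (s : X ≃ₗ[ℝ] X) (S N : Module.End ℝ X)
    (Y : Submodule ℝ X) : Prop where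
  invariant : ∀ y ∈ Y, S y ∈ Y
  compl : IsCompl Y (LinearMap.range N)
  structure_invariant : match k with
    | Kind.auto => ∀ y ∈ Y, s y ∈ Y
    | Kind.anti => True

/-- `t` is the reduced structure map on `Y`: the restriction of `s` for automorphisms; for
anti-automorphisms the map representing the reduced form `τ(x, y) = ω(x, N ^ (n - 1) y)`, where
`n` is the height of `N`. -/
def IsReducedStructureMap (k : Kind) (s : X ≃ₗ[ℝ] X) (N : Module.End ℝ X) (Y : Submodule ℝ X)
    (t : Y ≃ₗ[ℝ] Y) : Prop :=
  match k with
  | Kind.auto => ∀ y : Y, (t y : X) = s y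
  | Kind.anti => ∀ x y : Y, ⟪x, t y⟫_ℝ = ⟪(x : X), s ((N ^ (nilpotencyClass N - 1)) (y : X))⟫_ℝ

end Systems

/-- A pair of real square matrices: a semisimple matrix `S` and a structure matrix `s`. -/
structure MatrixPair where
  dim : ℕ
  s : Matrix (Fin dim) (Fin dim) ℝ
  S : Matrix (Fin dim) (Fin dim) ℝ

/-- The structure matrix as a linear map on Euclidean space. -/
def MatrixPair.sMap (F : MatrixPair) : Module.End ℝ (EuclideanSpace ℝ (Fin F.dim)) :=
  Matrix.toEuclideanLin F.s

/-- The semisimple matrix as a linear map on Euclidean space. -/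
def MatrixPair.SMap (F : MatrixPair) : Module.End ℝ (EuclideanSpace ℝ (Fin F.dim)) :=
  Matrix.toEuclideanLin F.S

def matR : Matrix (Fin 2) (Fin 2) ℝ := !![1, 0; 0, -1]

def matT : Matrix (Fin 2) (Fin 2) ℝ := !![0, 1; 1, 0]

def matJ : Matrix (Fin 2) (Fin 2) ℝ := !![0, -1; 1, 0]

/-- The block matrix with rows `(0, I₂)` and `(I₂, 0)`. -/
def matT4 : Matrix (Fin 4) (Fin 4) ℝ :=
  !![0, 0, 1, 0;
     0, 0, 0, 1;
     1, 0, 0, 0;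
     0, 1, 0, 0]

/-- The block matrix with rows `(0, -I₂)` and `(I₂, 0)`. -/
def matJ4 : Matrix (Fin 4) (Fin 4) ℝ :=
  !![0, 0, -1, 0;
     0, 0, 0, -1;
     1, 0, 0, 0;
     0, 1, 0, 0]

/-- The tables of semisimple normal forms: `Listed T ⟨m, s, S⟩` says that the `m × m` matrices
`s` and `S` form a row, with admissible values of the parameters, for type `T`. -/
inductive Listed : MapType → MatrixPair → Prop
  | equivariantR_real (σ α : ℝ) (hσ : σ = 1 ∨ σ = -1) :
      Listed .equivariantR ⟨1, !![σ], !![α]⟩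
  | equivariantR_complex (σ α β : ℝ) (hσ : σ = 1 ∨ σ = -1) (hβ : 0 < β) :
      Listed .equivariantR ⟨2, !![σ, 0; 0, σ], !![α, -β; β, α]⟩
  | reversibleR_zero (σ : ℝ) (hσ : σ = 1 ∨ σ = -1) :
      Listed .reversibleR ⟨1, !![σ], !![0]⟩
  | reversibleR_real (α : ℝ) (hα : 0 < α) :
      Listed .reversibleR ⟨2, matT, !![α, 0; 0, -α]⟩
  | reversibleR_imaginary (β : ℝ) (hβ : 0 < β) :
      Listed .reversibleR ⟨2, matR, !![0, -β; β, 0]⟩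
  | reversibleR_complex (α β : ℝ) (hα : 0 < α) (hβ : 0 < β) :
      Listed .reversibleR ⟨4, matT4,
        !![α, -β, 0, 0;
           β, α, 0, 0;
           0, 0, -α, β;
           0, 0, -β, -α]⟩
  | equivariantC_real (α : ℝ) :
      Listed .equivariantC ⟨2, matJ, !![α, 0; 0, α]⟩
  | equivariantC_complex (σ α β : ℝ) (hσ : σ = 1 ∨ σ = -1) (hβ : 0 < β) :
      Listed .equivariantC ⟨2, σ • matJ, !![α, -β; β, α]⟩
  | reversibleC_real (α : ℝ) (hα : 0 ≤ α) :
      Listed .reversibleC ⟨2, matJ, !![α, 0; 0, -α]⟩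
  | reversibleC_complex (α β : ℝ) (hα : 0 ≤ α) (hβ : 0 < β) :
      Listed .reversibleC ⟨4, matJ4,
        !![α, -β, 0, 0;
           β, α, 0, 0;
           0, 0, -α, β;
           0, 0, -β, -α]⟩
  | symmetric_real (σ α : ℝ) (hσ : σ = 1 ∨ σ = -1) :
      Listed .symmetric ⟨1, !![σ], !![α]⟩
  | symmetric_complex (α β : ℝ) (hβ : 0 < β) :
      Listed .symmetric ⟨2, matR, !![α, -β; β, α]⟩
  | antiSymmetric_zero (σ : ℝ) (hσ : σ = 1 ∨ σ = -1) :
      Listed .antiSymmetric ⟨1, !![σ], !![0]⟩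
  | antiSymmetric_real (α : ℝ) (hα : 0 < α) :
      Listed .antiSymmetric ⟨2, matT, !![α, 0; 0, -α]⟩
  | antiSymmetric_imaginary (σ β : ℝ) (hσ : σ = 1 ∨ σ = -1) (hβ : 0 < β) :
      Listed .antiSymmetric ⟨2, !![σ, 0; 0, σ], !![0, -β; β, 0]⟩
  | antiSymmetric_complex (α β : ℝ) (hα : 0 < α) (hβ : 0 < β) :
      Listed .antiSymmetric ⟨4, matT4,
        !![α, -β, 0, 0;
           β, α, 0, 0;
           0, 0, -α, -β;
           0, 0, β, -α]⟩
  | antiSymplectic_real (α : ℝ) :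
      Listed .antiSymplectic ⟨2, matJ, !![α, 0; 0, α]⟩
  | antiSymplectic_complex (α β : ℝ) (hβ : 0 < β) :
      Listed .antiSymplectic ⟨4, matJ4,
        !![α, -β, 0, 0;
           β, α, 0, 0;
           0, 0, α, β;
           0, 0, -β, α]⟩
  | symplectic_real (α : ℝ) (hα : 0 ≤ α) :
      Listed .symplectic ⟨2, matJ, !![α, 0; 0, -α]⟩
  | symplectic_imaginary (σ β : ℝ) (hσ : σ = 1 ∨ σ = -1) (hβ : 0 < β) :
      Listed .symplectic ⟨2, σ • matJ, !![0, -β; β, 0]⟩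
  | symplectic_complex (α β : ℝ) (hα : 0 < α) (hβ : 0 < β) :
      Listed .symplectic ⟨4, matJ4,
        !![α, -β, 0, 0;
           β, α, 0, 0;
           0, 0, -α, -β;
           0, 0, β, -α]⟩

end AntiAut

end

set_option linter.unusedSectionVars false

namespace AntiAut

open Polynomial

/-! The map `γ` is a linear automorphism or anti-automorphism, so it carries the Jordan-Chevalley
decomposition of L to that of μL. Uniqueness then puts S and N in gl_μ separately
(`IsJordanChevalley.twisted`).

Take an S-invariant complement Z of ker N^(n-1), also s-invariant for automorphisms. The sum of the
spaces N^j Z is L-invariant and has an L-invariant complement compatible with the structure, so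
indecomposability makes it all of X (`IsJCSystem.exists_tower_eq_top`). Hence all Jordan chains of N
have the same length n, and NX = ker N^(n-1). Consequently S and the structure descend to X/NX: for
automorphisms s itself, for anti-automorphisms the form ω(x, N^(n-1) y). Reduced spaces are only
S-compatible sections of X → X/NX, so the reduced pair does not depend on the choice of Y and is an
invariant of the system (`IsJCSystem.pairEquiv_reduced`).

Conversely, X is free over ℝ[N]/(N^n) on Y, so an isomorphism of reduced pairs extends to X by N^j y
↦ N'^j e(y). For anti-automorphisms the lower forms ω(x, N^j y), j < n-1, on Y stand in the way.
They are removed from the top down by moving Y inside its class modulo NX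
(`IsJCSystem.exists_normalized`); after that the reduced form determines ω. A splitting of a
normalised Y lifts to X in the same way, so Y is indecomposable.

For semisimple S, a real or complex eigenvector, together with its image under s or a dual
eigenvector for ω, yields an intertwining map from a listed pair. Complete reducibility
(automorphisms) or nondegeneracy of ω (anti-automorphisms) makes its image a direct summand, hence
everything (`Listed.pairEquiv_of_auto`, `Listed.pairEquiv_of_anti`). Listed pairs are indecomposable
because their compatible idempotents are idempotents of ℝ, ℂ or ℍ (`Listed.isSimple`). They are told
apart by dimension, by traces of S, S², S⁴, s and sS, and by the signs of the definite forms ω(x, x)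
and ω(x, Sx) (`Listed.eq_of_pairEquiv`). -/

theorem MapType.mu_mul_mu (T : MapType) : T.mu * T.mu = 1 := by
  cases T <;> norm_num [MapType.mu]

theorem MapType.eps_mul_eps (T : MapType) : T.eps * T.eps = 1 := by
  cases T <;> norm_num [MapType.eps]

theorem MapType.reduced_kind (T : MapType) (n : ℕ) : (T.reduced n).kind = T.kind := by
  cases T <;> simp only [MapType.reduced] <;> first | rfl | (split_ifs <;> rfl)

theorem MapType.reduced_mu (T : MapType) (n : ℕ) : (T.reduced n).mu = T.mu := by
  cases T <;> simp only [MapType.reduced] <;> first | rfl | (split_ifs <;> rfl)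

theorem MapType.reduced_of_auto {T : MapType} (h : T.kind = Kind.auto) (n : ℕ) :
    T.reduced n = T := by
  cases T <;> first | rfl | cases h

/-- Only μ = -1 can change the sign, and it does so exactly for even n. The case n = 0 has to be
excluded: the truncated n - 1 would be even although 0 is not odd. -/
theorem MapType.reduced_eps_of_anti {T : MapType} (h : T.kind = Kind.anti) {n : ℕ} (hn : n ≠ 0) :
    (T.reduced n).eps = T.eps * T.mu ^ (n - 1) := by
  obtain ⟨m, rfl⟩ := Nat.exists_eq_succ_of_ne_zero hn
  rcases Nat.even_or_odd m with hm | hm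
  · have h1 : Odd (m + 1) := hm.add_one
    cases T <;> first | (simp [MapType.kind] at h; done) |
      simp [MapType.reduced, MapType.eps, MapType.mu, h1, hm]
  · have h1 : ¬ Odd (m + 1) := by simpa using hm.add_one
    cases T <;> first | (simp [MapType.kind] at h; done) |
      simp [MapType.reduced, MapType.eps, MapType.mu, h1, hm]

/-! ### The (anti-)automorphism `γ` and its eigenspaces. -/

section Gamma

variable {X : Type*} [NormedAddCommGroup X] [InnerProductSpace ℝ X] [FiniteDimensional ℝ X]

/-- `s A = μ A s` for automorphisms and `⟪A x, s y⟫ = μ ⟪x, s A y⟫` for anti-automorphisms. -/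
def Twisted (k : Kind) (μ : ℝ) (s : X ≃ₗ[ℝ] X) (A : Module.End ℝ X) : Prop :=
  match k with
  | Kind.auto => ∀ x, s (A x) = μ • A (s x)
  | Kind.anti => ∀ x y, ⟪A x, s y⟫_ℝ = μ * ⟪x, s (A y)⟫_ℝ

/-- `s ^ 2 = ε` for automorphisms and `⟪y, s x⟫ = ε ⟪x, s y⟫` for anti-automorphisms. -/
def HasSign (k : Kind) (ε : ℝ) (s : X ≃ₗ[ℝ] X) : Prop :=
  match k with
  | Kind.auto => ∀ x, s (s x) = ε • x
  | Kind.anti => ∀ x y, ⟪y, s x⟫_ℝ = ε * ⟪x, s y⟫_ℝ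

theorem gamma_eq_smul_iff {k : Kind} {μ : ℝ} (hμ : μ * μ = 1) (s : X ≃ₗ[ℝ] X)
    (A : Module.End ℝ X) : gamma k s A = μ • A ↔ Twisted k μ s A := by
  cases k
  · simp only [gamma, Twisted, LinearMap.ext_iff, LinearMap.comp_apply, LinearEquiv.coe_coe,
      LinearMap.smul_apply]
    refine forall_congr' fun x => ?_
    rw [LinearEquiv.symm_apply_eq, map_smul]
    constructor
    · intro h; rw [h, smul_smul, hμ, one_smul]
    · intro h; rw [h, smul_smul, hμ, one_smul]
  · simp only [gamma, Twisted, LinearMap.ext_iff, LinearMap.comp_apply, LinearEquiv.coe_coe,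
      LinearMap.smul_apply]
    constructor
    · intro h x y
      have := h y
      rw [LinearEquiv.symm_apply_eq, map_smul] at this
      rw [← LinearMap.adjoint_inner_right, this, inner_smul_right]
    · intro h x
      rw [LinearEquiv.symm_apply_eq, map_smul]
      refine ext_inner_left ℝ fun v => ?_
      rw [LinearMap.adjoint_inner_right, h, inner_smul_right]

theorem gamma_mul_auto (s : X ≃ₗ[ℝ] X) (A B : Module.End ℝ X) :
    gamma Kind.auto s (A * B) = gamma Kind.auto s A * gamma Kind.auto s B := by
  ext x; simp [gamma]

theorem gamma_mul_anti (s : X ≃ₗ[ℝ] X) (A B : Module.End ℝ X) :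
    gamma Kind.anti s (A * B) = gamma Kind.anti s B * gamma Kind.anti s A := by
  ext x
  simp [gamma, Module.End.mul_eq_comp, LinearMap.adjoint_comp]

theorem gamma_add (k : Kind) (s : X ≃ₗ[ℝ] X) (A B : Module.End ℝ X) :
    gamma k s (A + B) = gamma k s A + gamma k s B := by
  cases k <;> ext x <;> simp [gamma]

theorem gamma_smul (k : Kind) (s : X ≃ₗ[ℝ] X) (c : ℝ) (A : Module.End ℝ X) :
    gamma k s (c • A) = c • gamma k s A := by
  cases k <;> ext x <;> simp [gamma]

theorem gamma_one (k : Kind) (s : X ≃ₗ[ℝ] X) : gamma k s 1 = 1 := by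
  cases k
  · ext x; simp [gamma]
  · ext x; simp [gamma, Module.End.one_eq_id]

theorem gamma_zero (k : Kind) (s : X ≃ₗ[ℝ] X) : gamma k s 0 = 0 := by
  simpa using gamma_smul k s 0 0

theorem gamma_pow (k : Kind) (s : X ≃ₗ[ℝ] X) (A : Module.End ℝ X) (n : ℕ) :
    gamma k s (A ^ n) = gamma k s A ^ n := by
  induction n with
  | zero => simp [gamma_one]
  | succ n ih =>
    cases k
    · rw [pow_succ, gamma_mul_auto, ih, pow_succ]
    · rw [pow_succ, gamma_mul_anti, ih, pow_succ']

theorem gamma_aeval (k : Kind) (s : X ≃ₗ[ℝ] X) (A : Module.End ℝ X) (p : ℝ[X]) :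
    gamma k s (aeval A p) = aeval (gamma k s A) p := by
  induction p using Polynomial.induction_on' with
  | add p q hp hq => simp [gamma_add, hp, hq]
  | monomial n c =>
    simp [aeval_monomial, ← Algebra.smul_def, gamma_smul, gamma_pow]

theorem gamma_commute {k : Kind} (s : X ≃ₗ[ℝ] X) {A B : Module.End ℝ X} (h : Commute A B) :
    Commute (gamma k s A) (gamma k s B) := by
  cases k
  · rw [commute_iff_eq, ← gamma_mul_auto, h.eq, gamma_mul_auto]
  · rw [commute_iff_eq, ← gamma_mul_anti, ← h.eq, gamma_mul_anti]

/-- Polynomials in one operator involve only its powers, so even an anti-automorphism satisfies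
γ(p(A)) = p(γ(A)). The squarefree minimal polynomial of A therefore annihilates γ(A). -/
theorem isSemisimple_gamma {k : Kind} (s : X ≃ₗ[ℝ] X) {A : Module.End ℝ X}
    (h : A.IsSemisimple) : (gamma k s A).IsSemisimple :=
  Module.End.isSemisimple_of_squarefree_aeval_eq_zero h.minpoly_squarefree
    (by rw [← gamma_aeval, minpoly.aeval, gamma_zero])

theorem isNilpotent_gamma {k : Kind} (s : X ≃ₗ[ℝ] X) {A : Module.End ℝ X}
    (h : IsNilpotent A) : IsNilpotent (gamma k s A) := by
  obtain ⟨n, hn⟩ := h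
  exact ⟨n, by rw [← gamma_pow, hn, gamma_zero]⟩

theorem IsJordanChevalley.unique {L S N S' N' : Module.End ℝ X} (h : IsJordanChevalley L S N)
    (h' : IsJordanChevalley L S' N') : S = S' ∧ N = N' :=
  (Module.End.isNilpotent_isSemisimple_unique h.nilpotent h.semisimple h'.nilpotent h'.semisimple
    h.comm.symm h'.comm.symm (by rw [add_comm N, add_comm N', ← h.sum, ← h'.sum])).symm

/-- Both (γS, γN) and (μS, μN) are Jordan-Chevalley decompositions of γL = μL, hence equal. -/
theorem IsJordanChevalley.twisted {k : Kind} {μ : ℝ} (hμ : μ * μ = 1) {s : X ≃ₗ[ℝ] X}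
    {L S N : Module.End ℝ X} (h : IsJordanChevalley L S N) (hL : gamma k s L = μ • L) :
    Twisted k μ s S ∧ Twisted k μ s N := by
  have h1 : IsJordanChevalley (μ • L) (gamma k s S) (gamma k s N) :=
    ⟨by rw [← hL, h.sum, gamma_add], gamma_commute s h.comm, isSemisimple_gamma s h.semisimple,
      isNilpotent_gamma s h.nilpotent⟩
  have h2 : IsJordanChevalley (μ • L) (μ • S) (μ • N) :=
    ⟨by rw [h.sum, smul_add], (h.comm.smul_left μ).smul_right μ,
      Module.End.IsSemisimple_smul μ h.semisimple, h.nilpotent.smul μ⟩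
  obtain ⟨h3, h4⟩ := h1.unique h2
  exact ⟨(gamma_eq_smul_iff hμ s S).1 h3, (gamma_eq_smul_iff hμ s N).1 h4⟩

theorem IsStructureMap.hasSign {T : MapType} {s : X ≃ₗ[ℝ] X} (h : IsStructureMap T s) :
    HasSign T.kind T.eps s := by
  have := h.sign
  unfold HasSign
  cases hk : T.kind <;> simp only [hk] at this ⊢
  · exact this
  · intro x y
    have h1 := LinearMap.adjoint_inner_right s.toLinearMap x y
    rw [this] at h1
    simp only [LinearMap.smul_apply, inner_smul_right, LinearEquiv.coe_coe] at h1
    rw [h1, real_inner_comm]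

/-- Involutivity is automatic: γ² is conjugation by s² or by s⁻¹s*, and the sign condition makes
these scalars. -/
theorem HasSign.isStructureMap {T : MapType} {s : X ≃ₗ[ℝ] X} (h : HasSign T.kind T.eps s) :
    IsStructureMap T s := by
  unfold HasSign at h
  cases hk : T.kind <;> simp only [hk] at h
  · refine ⟨fun A => ?_, by simpa only [hk] using h⟩
    ext x
    simp only [gamma, hk, LinearMap.comp_apply, LinearEquiv.coe_coe, h, map_smul]
    rw [← map_smul, ← map_smul, LinearEquiv.symm_apply_eq, LinearEquiv.symm_apply_eq, h]
  · have hadj : LinearMap.adjoint s.toLinearMap = T.eps • s.toLinearMap := by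
      ext x
      refine ext_inner_left ℝ fun v => ?_
      rw [LinearMap.adjoint_inner_right, LinearMap.smul_apply, inner_smul_right,
        LinearEquiv.coe_coe, real_inner_comm, h]
    refine ⟨fun A => ?_, by simpa only [hk] using hadj⟩
    ext x
    simp only [gamma, hk, LinearMap.comp_apply, LinearEquiv.coe_coe]
    rw [LinearEquiv.symm_apply_eq]
    refine ext_inner_left ℝ fun v => ?_
    rw [LinearMap.adjoint_inner_right]
    simp only [LinearMap.comp_apply, LinearEquiv.coe_coe]
    rw [h, LinearEquiv.apply_symm_apply, LinearMap.adjoint_inner_right, h (A x) v]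

/-- The spaces with a structure map and an element of `gl_μ`, in terms of the relations. -/
theorem isIndecomposablePair_iff {T : MapType} {L : Module.End ℝ X} {s : X ≃ₗ[ℝ] X} :
    IsIndecomposablePair T L s ↔
      HasSign T.kind T.eps s ∧ Twisted T.kind T.mu s L ∧ Indecomposable T.kind s L :=
  ⟨fun h => ⟨h.structureMap.hasSign, (gamma_eq_smul_iff T.mu_mul_mu s L).1 h.eigen,
    h.indecomposable⟩, fun h => ⟨h.1.isStructureMap, (gamma_eq_smul_iff T.mu_mul_mu s L).2 h.2.1,
    h.2.2⟩⟩

end Gamma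

/-! ### Towers of images under a nilpotent map. -/

section Tower

variable {X : Type*} [AddCommGroup X] [Module ℝ X]

/-- The sum of the images `N ^ j Z`. -/
def tower (N : Module.End ℝ X) (Z : Submodule ℝ X) : Submodule ℝ X :=
  ⨆ j : ℕ, Z.map (N ^ j)

/-- The map `(z_j) ↦ ∑ N ^ j z_j`. -/
noncomputable def towerMap (N : Module.End ℝ X) (Z : Submodule ℝ X) (n : ℕ) :
    (Fin n → Z) →ₗ[ℝ] X :=
  ∑ j : Fin n, (N ^ (j : ℕ)) ∘ₗ Z.subtype ∘ₗ LinearMap.proj j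

theorem towerMap_apply (N : Module.End ℝ X) (Z : Submodule ℝ X) (n : ℕ) (z : Fin n → Z) :
    towerMap N Z n z = ∑ j : Fin n, (N ^ (j : ℕ)) (z j : X) := by
  simp [towerMap]

theorem pow_mem_tower {N : Module.End ℝ X} {Z : Submodule ℝ X} (j : ℕ) {z : X} (hz : z ∈ Z) :
    (N ^ j) z ∈ tower N Z :=
  Submodule.mem_iSup_of_mem j (Submodule.mem_map_of_mem hz)

theorem le_tower (N : Module.End ℝ X) (Z : Submodule ℝ X) : Z ≤ tower N Z :=
  fun _ hz => pow_mem_tower 0 hz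

theorem tower_induction {N : Module.End ℝ X} {Z : Submodule ℝ X} {p : X → Prop}
    (hp : ∀ (j : ℕ) (z : X), z ∈ Z → p ((N ^ j) z)) (h0 : p 0)
    (hadd : ∀ x y, p x → p y → p (x + y)) {x : X} (hx : x ∈ tower N Z) : p x := by
  refine Submodule.iSup_induction (motive := p) _ hx ?_ h0 hadd
  rintro j _ ⟨z, hz, rfl⟩
  exact hp j z hz

theorem tower_sup (N : Module.End ℝ X) (Z W : Submodule ℝ X) :
    tower N (Z ⊔ W) = tower N Z ⊔ tower N W := by
  simp only [tower, Submodule.map_sup, iSup_sup_eq]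

theorem map_mem_tower {N : Module.End ℝ X} {Z : Submodule ℝ X} {x : X} (hx : x ∈ tower N Z) :
    N x ∈ tower N Z := by
  refine tower_induction (p := fun x => N x ∈ tower N Z) (fun j z hz => ?_) ?_ ?_ hx
  · have := pow_mem_tower (N := N) (j + 1) hz
    rwa [pow_succ'] at this
  · simp
  · intro x y hx hy
    rw [map_add]
    exact add_mem hx hy

theorem apply_pow_of_twisted {N A : Module.End ℝ X} {c : ℝ} (h : ∀ x, A (N x) = c • N (A x))
    (j : ℕ) (x : X) : A ((N ^ j) x) = c ^ j • (N ^ j) (A x) := by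
  induction j generalizing x with
  | zero => simp
  | succ j ih => rw [pow_succ, Module.End.mul_apply, ih, h, map_smul, smul_smul, ← pow_succ]; rfl

theorem apply_mem_tower {N A : Module.End ℝ X} {c : ℝ} (h : ∀ x, A (N x) = c • N (A x))
    {Z : Submodule ℝ X} (hZ : ∀ z ∈ Z, A z ∈ Z) {x : X} (hx : x ∈ tower N Z) :
    A x ∈ tower N Z := by
  refine tower_induction (p := fun x => A x ∈ tower N Z) (fun j z hz => ?_) ?_ ?_ hx
  · rw [apply_pow_of_twisted h]
    exact Submodule.smul_mem _ _ (pow_mem_tower j (hZ z hz))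
  · simp
  · intro x y hx hy
    rw [map_add]
    exact add_mem hx hy

theorem pow_apply_eq_zero {N : Module.End ℝ X} {n k : ℕ} (hN : N ^ n = 0) (h : n ≤ k) (x : X) :
    (N ^ k) x = 0 := by
  rw [pow_eq_zero_of_le h hN, LinearMap.zero_apply]

theorem range_towerMap {N : Module.End ℝ X} {n : ℕ} (hN : N ^ n = 0) (Z : Submodule ℝ X) :
    LinearMap.range (towerMap N Z n) = tower N Z := by
  apply le_antisymm
  · rintro _ ⟨z, rfl⟩
    rw [towerMap_apply]
    exact Submodule.sum_mem _ fun j _ => pow_mem_tower _ (z j).2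
  · intro x hx
    refine tower_induction (p := fun x => x ∈ LinearMap.range (towerMap N Z n))
      (fun j z hz => ?_) (zero_mem _) (fun x y => add_mem) hx
    by_cases hj : j < n
    · refine ⟨Pi.single ⟨j, hj⟩ ⟨z, hz⟩, ?_⟩
      rw [towerMap_apply, Finset.sum_eq_single ⟨j, hj⟩]
      · simp
      · intro i _ hi
        simp [Pi.single_eq_of_ne hi]
      · simp
    · rw [pow_apply_eq_zero hN (not_lt.1 hj)]
      exact zero_mem _

variable {V : Type*} [AddCommGroup V] [Module ℝ V]

/-- The map `x ↦ (π N ^ (n - 1 - i) x)_i`. -/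
noncomputable def cotowerMap (N : Module.End ℝ X) (π : X →ₗ[ℝ] V) (n : ℕ) :
    X →ₗ[ℝ] (Fin n → V) :=
  LinearMap.pi fun i => π ∘ₗ (N ^ (n - 1 - (i : ℕ)))

/-- The composite is block triangular: entry (i, j) is π N^(n-1-i+j), which vanishes for j > i and
is the injective map π N^(n-1) on the diagonal. Solving row by row gives the strong induction. -/
theorem cotowerMap_comp_towerMap_injective {N : Module.End ℝ X} {n : ℕ} (hN : N ^ n = 0)
    {Z : Submodule ℝ X} {π : X →ₗ[ℝ] V} (hπ : ∀ z ∈ Z, π ((N ^ (n - 1)) z) = 0 → z = 0) :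
    Function.Injective (cotowerMap N π n ∘ₗ towerMap N Z n) := by
  rw [injective_iff_map_eq_zero]
  intro z hz
  suffices ∀ (m : ℕ) (hm : m < n), z ⟨m, hm⟩ = 0 from funext fun i => this i i.2
  intro m
  induction m using Nat.strong_induction_on with
  | _ m ih =>
    intro hm
    have h1 := congrFun hz ⟨m, hm⟩
    simp only [cotowerMap, LinearMap.comp_apply, LinearMap.pi_apply, towerMap_apply, map_sum,
      Pi.zero_apply] at h1
    rw [Finset.sum_eq_single ⟨m, hm⟩] at h1
    · rw [← Module.End.mul_apply, ← pow_add, Nat.sub_add_cancel (by omega)] at h1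
      exact Subtype.ext (hπ _ (z _).2 h1)
    · intro i _ hi
      rcases lt_trichotomy (i : ℕ) m with h | h | h
      · rw [show z i = 0 from ih i h i.2]
        simp
      · exact absurd (Fin.ext h) hi
      · rw [← Module.End.mul_apply, ← pow_add, pow_apply_eq_zero hN (by omega), map_zero]
    · simp

theorem towerMap_injective {N : Module.End ℝ X} {n : ℕ} (hN : N ^ n = 0)
    {Z : Submodule ℝ X} (hZ : ∀ z ∈ Z, (N ^ (n - 1)) z = 0 → z = 0) :
    Function.Injective (towerMap N Z n) := by
  have := cotowerMap_comp_towerMap_injective hN (π := LinearMap.id) hZ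
  rw [LinearMap.coe_comp] at this
  exact this.of_comp

/-- The dimension bound turns the injective triangular composite into a bijection, so X splits as
the image of the first map plus the kernel of the second. The choice of π decides which structure
the complement respects: an invariant projection for automorphisms, pairing with Z for
anti-automorphisms. -/
theorem isCompl_tower [FiniteDimensional ℝ X] [FiniteDimensional ℝ V] {N : Module.End ℝ X}
    {n : ℕ} (hN : N ^ n = 0) {Z : Submodule ℝ X} {π : X →ₗ[ℝ] V}
    (hπ : ∀ z ∈ Z, π ((N ^ (n - 1)) z) = 0 → z = 0)
    (hd : Module.finrank ℝ V ≤ Module.finrank ℝ Z) :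
    IsCompl (tower N Z) (⨅ j : ℕ, LinearMap.ker (π ∘ₗ (N ^ j))) := by
  have hinj := cotowerMap_comp_towerMap_injective hN hπ
  have hfin : Module.finrank ℝ (Fin n → Z) = Module.finrank ℝ (Fin n → V) := by
    refine le_antisymm (LinearMap.finrank_le_finrank_of_injective hinj) ?_
    simp only [Module.finrank_pi_fintype, Finset.sum_const, Finset.card_univ, Fintype.card_fin,
      smul_eq_mul]
    exact Nat.mul_le_mul_left n hd
  have hsurj := (LinearMap.injective_iff_surjective_of_finrank_eq_finrank hfin).1 hinj
  rw [← range_towerMap hN]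
  constructor
  · rw [Submodule.disjoint_def]
    rintro _ ⟨z, rfl⟩ hx
    have : (cotowerMap N π n ∘ₗ towerMap N Z n) z = 0 := by
      funext i
      change π ((N ^ (n - 1 - (i : ℕ))) (towerMap N Z n z)) = 0
      simpa using (Submodule.mem_iInf _).1 hx (n - 1 - (i : ℕ))
    rw [(injective_iff_map_eq_zero _).1 hinj z this, map_zero]
  · rw [codisjoint_iff, eq_top_iff]
    intro x _
    obtain ⟨z, hz⟩ := hsurj (cotowerMap N π n x)
    refine Submodule.mem_sup.2 ⟨towerMap N Z n z, ⟨z, rfl⟩, x - towerMap N Z n z, ?_, by abel⟩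
    rw [Submodule.mem_iInf]
    intro j
    by_cases hj : j < n
    · have h1 := congrFun hz ⟨n - 1 - j, by omega⟩
      simp only [cotowerMap, LinearMap.comp_apply, LinearMap.pi_apply,
        show n - 1 - (n - 1 - j) = j by omega] at h1
      simp [h1]
    · simp [pow_apply_eq_zero hN (not_lt.1 hj)]

/-- All Jordan chains start in Z and have full length n, so whatever N^(n-1) kills is not the start
of a chain. -/
theorem range_eq_ker_of_tower_eq_top {N : Module.End ℝ X} {n : ℕ} (hN : N ^ n = 0)
    {Z : Submodule ℝ X} (hZ : ∀ z ∈ Z, (N ^ (n - 1)) z = 0 → z = 0) (ht : tower N Z = ⊤) :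
    LinearMap.range N = LinearMap.ker (N ^ (n - 1)) := by
  have hle : tower N Z ≤ Z ⊔ LinearMap.range N := by
    refine iSup_le fun j => ?_
    rintro _ ⟨z, hz, rfl⟩
    rcases j with _ | j
    · exact Submodule.mem_sup_left hz
    · rw [pow_succ']
      exact Submodule.mem_sup_right ⟨_, rfl⟩
  have h1 : ∀ y, (N ^ (n - 1)) (N y) = 0 := fun y => by
    rw [← Module.End.mul_apply, ← pow_succ, pow_apply_eq_zero hN (by omega)]
  apply le_antisymm
  · rintro _ ⟨y, rfl⟩
    exact h1 y
  · intro x hx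
    obtain ⟨z, hz, _, ⟨y, rfl⟩, rfl⟩ := Submodule.mem_sup.1 (hle (ht ▸ Submodule.mem_top : x ∈ _))
    rw [LinearMap.mem_ker, map_add, h1, add_zero] at hx
    rw [hZ z hz hx, zero_add]
    exact ⟨y, rfl⟩

/-- Nakayama for a nilpotent map: substitute X = Y + NX into itself until the remainder N^k X is
zero. -/
theorem tower_eq_top {N : Module.End ℝ X} (hN : IsNilpotent N) {Y : Submodule ℝ X}
    (hY : Codisjoint Y (LinearMap.range N)) : tower N Y = ⊤ := by
  have h : ∀ k : ℕ, ∀ x, ∃ t ∈ tower N Y, ∃ y, x = t + (N ^ k) y := by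
    intro k
    induction k with
    | zero => exact fun x => ⟨0, zero_mem _, x, by simp⟩
    | succ k ih =>
      intro x
      obtain ⟨y, hy, _, ⟨z, rfl⟩, rfl⟩ :=
        Submodule.mem_sup.1 (hY.eq_top ▸ Submodule.mem_top : x ∈ Y ⊔ LinearMap.range N)
      obtain ⟨t, ht, w, rfl⟩ := ih z
      refine ⟨y + N t, add_mem (le_tower N Y hy) (map_mem_tower ht), w, ?_⟩
      rw [map_add, pow_succ', Module.End.mul_apply, add_assoc]
  obtain ⟨n, hn⟩ := hN
  rw [eq_top_iff]
  intro x _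
  obtain ⟨t, ht, y, rfl⟩ := h n x
  simpa [hn] using ht

theorem isInternal_map_pow {N : Module.End ℝ X} {n : ℕ} (hN : N ^ n = 0) {Y : Submodule ℝ X}
    (hY : ∀ y ∈ Y, (N ^ (n - 1)) y = 0 → y = 0) (ht : tower N Y = ⊤) :
    DirectSum.IsInternal (fun j : Fin n => Y.map (N ^ (j : ℕ))) := by
  have hinj := towerMap_injective hN hY
  refine DirectSum.isInternal_submodule_of_iSupIndep_of_iSup_eq_top ?_ ?_
  · rw [iSupIndep_iff_finsetSum_eq_zero_imp_eq_zero]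
    intro s v hv hs i hi
    have hex : ∀ j : Fin n, ∃ y : Y, j ∈ s → (N ^ (j : ℕ)) (y : X) = v j := by
      intro j
      by_cases hj : j ∈ s
      · obtain ⟨y, hy, h⟩ := hv j hj
        exact ⟨⟨y, hy⟩, fun _ => h⟩
      · exact ⟨0, fun h => absurd h hj⟩
    choose y hy using hex
    have h0 : towerMap N Y n (fun j => if j ∈ s then y j else 0) = 0 := by
      rw [towerMap_apply, ← hs, ← Finset.sum_subset (Finset.subset_univ s)]
      · exact Finset.sum_congr rfl fun j hj => by rw [if_pos hj, hy j hj]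
      · intro j _ hj
        rw [if_neg hj]
        simp
    have h1 := congrFun ((injective_iff_map_eq_zero _).1 hinj _ h0) i
    simp only [if_pos hi, Pi.zero_apply] at h1
    rw [← hy i hi, h1]
    simp
  · rw [eq_top_iff, ← ht, ← range_towerMap hN]
    rintro _ ⟨z, rfl⟩
    rw [towerMap_apply]
    exact Submodule.sum_mem _ fun j _ =>
      Submodule.mem_iSup_of_mem j (Submodule.mem_map_of_mem (z j).2)

theorem finrank_map_pow {N : Module.End ℝ X} {n : ℕ} {Y : Submodule ℝ X}
    (hY : ∀ y ∈ Y, (N ^ (n - 1)) y = 0 → y = 0) {j : ℕ} (hj : j < n) :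
    Module.finrank ℝ (Y.map (N ^ j)) = Module.finrank ℝ Y := by
  refine LinearEquiv.finrank_eq (LinearEquiv.ofBijective ((N ^ j).submoduleMap Y)
    ⟨?_, LinearMap.submoduleMap_surjective _ _⟩).symm
  rw [injective_iff_map_eq_zero]
  intro y hy
  have h1 : (N ^ j) (y : X) = 0 := congrArg Subtype.val hy
  refine Subtype.ext (hY y y.2 ?_)
  rw [show n - 1 = (n - 1 - j) + j by omega, pow_add, Module.End.mul_apply, h1, map_zero]

end Tower

/-! ### Invariance of projections and of the complement of a tower. -/

section Complements

variable {X : Type*} [AddCommGroup X] [Module ℝ X]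

theorem projectionOnto_comm {U W : Submodule ℝ X} (h : IsCompl U W) {A : Module.End ℝ X}
    (hU : ∀ u ∈ U, A u ∈ U) (hW : ∀ w ∈ W, A w ∈ W) (x : X) :
    (U.projectionOnto W h (A x) : X) = A (U.projectionOnto W h x) := by
  obtain ⟨u, hu, w, hw, rfl⟩ := Submodule.mem_sup.1 (h.sup_eq_top ▸ Submodule.mem_top : x ∈ U ⊔ W)
  simp only [map_add, Submodule.coe_add]
  rw [Submodule.projectionOnto_apply_of_mem_left h hu,
    Submodule.projectionOnto_apply_of_mem_left h (hU u hu),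
    (Submodule.projectionOnto_apply_eq_zero_iff h).2 hw,
    (Submodule.projectionOnto_apply_eq_zero_iff h).2 (hW w hw)]
  simp

theorem iInf_ker_invariant {V : Type*} [AddCommGroup V] [Module ℝ V] {N A : Module.End ℝ X}
    {c : ℝ} (hc : c * c = 1) (h : ∀ x, A (N x) = c • N (A x)) {π : X →ₗ[ℝ] V}
    (hπ : ∀ x, π x = 0 → π (A x) = 0) {x : X} (hx : x ∈ ⨅ j : ℕ, LinearMap.ker (π ∘ₗ (N ^ j))) :
    A x ∈ ⨅ j : ℕ, LinearMap.ker (π ∘ₗ (N ^ j)) := by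
  rw [Submodule.mem_iInf] at hx ⊢
  intro j
  have h1 := apply_pow_of_twisted h j x
  have h2 : (N ^ j) (A x) = c ^ j • A ((N ^ j) x) := by
    rw [h1, smul_smul, ← mul_pow, hc, one_pow, one_smul]
  have h3 : π ((N ^ j) x) = 0 := hx j
  rw [LinearMap.mem_ker, LinearMap.comp_apply, h2, map_smul, hπ _ h3, smul_zero]

theorem iInf_ker_invariant_self {V : Type*} [AddCommGroup V] [Module ℝ V] {N : Module.End ℝ X}
    {π : X →ₗ[ℝ] V} {x : X} (hx : x ∈ ⨅ j : ℕ, LinearMap.ker (π ∘ₗ (N ^ j))) :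
    N x ∈ ⨅ j : ℕ, LinearMap.ker (π ∘ₗ (N ^ j)) := by
  rw [Submodule.mem_iInf] at hx ⊢
  intro j
  have h1 := hx (j + 1)
  rw [pow_succ] at h1
  exact h1

end Complements

/-! ### An indecomposable space is a single tower. -/

section Systems

variable {X : Type*} [NormedAddCommGroup X] [InnerProductSpace ℝ X] [FiniteDimensional ℝ X]

/-- Maschke averaging: an S-equivariant projection onto U exists by semisimplicity, and averaging it
with its conjugate by s makes it commute with s as well. Commutation with S survives because μ
enters the conjugate twice. -/
theorem exists_isCompl_auto {ε μ : ℝ} (hε : ε * ε = 1) (hμ : μ * μ = 1) {s : X ≃ₗ[ℝ] X}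
    {S : Module.End ℝ X} (hs : HasSign Kind.auto ε s) (hS : Twisted Kind.auto μ s S)
    (hss : S.IsSemisimple) {U : Submodule ℝ X} (hUS : ∀ u ∈ U, S u ∈ U) (hUs : ∀ u ∈ U, s u ∈ U) :
    ∃ W : Submodule ℝ X, IsCompl U W ∧ (∀ w ∈ W, S w ∈ W) ∧ ∀ w ∈ W, s w ∈ W := by
  have hs' : ∀ x, s (s x) = ε • x := hs
  have hS' : ∀ x, s (S x) = μ • S (s x) := hS
  obtain ⟨W₀, hW₀, hc⟩ := Module.End.isSemisimple_iff.1 hss U hUS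
  let P : Module.End ℝ X := U.projection W₀ hc
  have hPS : ∀ x, P (S x) = S (P x) := fun x => by
    simp only [P, Submodule.projection_apply]
    exact projectionOnto_comm hc hUS hW₀ x
  have hPU : ∀ x, P x ∈ U := fun x => Submodule.projection_apply_mem hc x
  have hPid : ∀ u ∈ U, P u = u := fun u hu => Submodule.projection_apply_of_mem_left hc hu
  -- Since s² = ε, the inverse of s is ε s, so the second summand is the conjugate s P s⁻¹.
  let Q : Module.End ℝ X := (1 / 2 : ℝ) • (P + ε • (s.toLinearMap ∘ₗ P ∘ₗ s.toLinearMap))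
  have hQ : ∀ x, Q x = (1 / 2 : ℝ) • (P x + ε • s (P (s x))) := fun x => rfl
  have hQU : ∀ x, Q x ∈ U := fun x => by
    rw [hQ]
    exact U.smul_mem _ (U.add_mem (hPU _) (U.smul_mem _ (hUs _ (hPU _))))
  have hQid : ∀ u ∈ U, Q u = u := fun u hu => by
    rw [hQ, hPid u hu, hPid _ (hUs u hu), hs', smul_smul, hε]
    module
  have hQS : ∀ x, Q (S x) = S (Q x) := fun x => by
    rw [hQ, hQ, hS', map_smul, hPS, hPS, map_smul, hS', smul_smul μ, hμ, one_smul, map_smul,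
      map_add, map_smul]
  have hQs : ∀ x, Q (s x) = s (Q x) := fun x => by
    rw [hQ, hQ, map_smul, map_add, map_smul, hs', hs', map_smul, map_smul, smul_smul, smul_smul, hε]
    module
  refine ⟨LinearMap.ker Q, ⟨?_, ?_⟩, ?_, ?_⟩
  · rw [Submodule.disjoint_def]
    intro x hx hx'
    rw [← hQid x hx]
    exact hx'
  · rw [codisjoint_iff, eq_top_iff]
    intro x _
    refine Submodule.mem_sup.2 ⟨Q x, hQU x, x - Q x, ?_, by abel⟩
    rw [LinearMap.mem_ker, map_sub, hQid _ (hQU x), sub_self]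
  · intro w hw
    rw [LinearMap.mem_ker] at hw ⊢
    rw [hQS, hw, map_zero]
  · intro w hw
    rw [LinearMap.mem_ker] at hw ⊢
    rw [hQs, hw, map_zero]

/-- The map representing the form `⟪y, s x⟫` for `y ∈ Y`. -/
noncomputable def formMap (s : Module.End ℝ X) (Y : Submodule ℝ X) : X →ₗ[ℝ] Y :=
  Y.orthogonalProjectionOnto.toLinearMap ∘ₗ s

theorem inner_formMap (s : Module.End ℝ X) (Y : Submodule ℝ X) (y : Y) (x : X) :
    ⟪y, formMap s Y x⟫_ℝ = ⟪(y : X), s x⟫_ℝ :=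
  Submodule.inner_orthogonalProjectionOnto_eq_of_mem_left y (s x)

theorem formMap_eq_zero_iff {s : Module.End ℝ X} {Y : Submodule ℝ X} {x : X} :
    formMap s Y x = 0 ↔ ∀ y ∈ Y, ⟪y, s x⟫_ℝ = 0 := by
  constructor
  · intro h y hy
    rw [← inner_formMap s Y ⟨y, hy⟩ x, h, inner_zero_right]
  · intro h
    refine ext_inner_left ℝ fun y => ?_
    rw [inner_formMap, inner_zero_right]
    exact h y y.2

/-- An element `L` of `gl_μ(X)` with its Jordan-Chevalley decomposition on an indecomposable
`(L, s)`-invariant space. -/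
structure IsJCSystem (k : Kind) (ε μ : ℝ) (s : X ≃ₗ[ℝ] X) (L S N : Module.End ℝ X) : Prop where
  eps : ε * ε = 1
  mu : μ * μ = 1
  sign : HasSign k ε s
  jc : IsJordanChevalley L S N
  twistedS : Twisted k μ s S
  twistedN : Twisted k μ s N
  indec : Indecomposable k s L

theorem IsIndecomposablePair.isJCSystem {T : MapType} {L S N : Module.End ℝ X} {s : X ≃ₗ[ℝ] X}
    (h : IsIndecomposablePair T L s) (hJ : IsJordanChevalley L S N) :
    IsJCSystem T.kind T.eps T.mu s L S N :=
  ⟨T.eps_mul_eps, T.mu_mul_mu, h.structureMap.hasSign, hJ, (hJ.twisted T.mu_mul_mu h.eigen).1,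
    (hJ.twisted T.mu_mul_mu h.eigen).2, h.indecomposable⟩

theorem Twisted.inner_pow {μ : ℝ} {s : X ≃ₗ[ℝ] X} {A : Module.End ℝ X}
    (h : Twisted Kind.anti μ s A) (j : ℕ) (x y : X) :
    ⟪(A ^ j) x, s y⟫_ℝ = μ ^ j * ⟪x, s ((A ^ j) y)⟫_ℝ := by
  induction j generalizing x y with
  | zero => simp
  | succ j ih =>
    rw [pow_succ', Module.End.mul_apply, h, ih, ← mul_assoc, ← pow_succ', ← Module.End.mul_apply,
      ← pow_succ, ← pow_succ']

theorem eq_zero_of_forall_inner_eq_zero {s : X ≃ₗ[ℝ] X} {x : X}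
    (h : ∀ y, ⟪y, s x⟫_ℝ = 0) : x = 0 := by
  have : s x = 0 := ext_inner_left ℝ fun y => by rw [h, inner_zero_right]
  simpa using this

namespace IsJCSystem

variable {k : Kind} {ε μ : ℝ} {s : X ≃ₗ[ℝ] X} {L S N : Module.End ℝ X}

theorem commN (h : IsJCSystem k ε μ s L S N) (x : X) : S (N x) = (1 : ℝ) • N (S x) := by
  rw [one_smul]
  exact LinearMap.congr_fun h.jc.comm.eq x

theorem comm_pow (h : IsJCSystem k ε μ s L S N) (j : ℕ) (x : X) :
    S ((N ^ j) x) = (N ^ j) (S x) := by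
  rw [apply_pow_of_twisted h.commN, one_pow, one_smul]

theorem pow_class (h : IsJCSystem k ε μ s L S N) : N ^ nilpotencyClass N = 0 :=
  pow_nilpotencyClass h.jc.nilpotent

theorem pow_pred_ne (h : IsJCSystem k ε μ s L S N) : N ^ (nilpotencyClass N - 1) ≠ 0 :=
  have := h.indec.1
  pow_pred_nilpotencyClass h.jc.nilpotent

theorem class_pos (h : IsJCSystem k ε μ s L S N) : 0 < nilpotencyClass N :=
  have := h.indec.1
  pos_nilpotencyClass_iff.2 h.jc.nilpotent

theorem apply_mem_of_mem (h : IsJCSystem k ε μ s L S N) {U : Submodule ℝ X}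
    (hS : ∀ u ∈ U, S u ∈ U) (hN : ∀ u ∈ U, N u ∈ U) : ∀ u ∈ U, L u ∈ U := by
  intro u hu
  rw [h.jc.sum]
  exact add_mem (hS u hu) (hN u hu)

theorem ker_pow_invariant (h : IsJCSystem k ε μ s L S N) (j : ℕ) :
    ∀ x ∈ LinearMap.ker (N ^ j), S x ∈ LinearMap.ker (N ^ j) := fun x hx => by
  rw [LinearMap.mem_ker] at hx ⊢
  rw [← h.comm_pow, hx, map_zero]

theorem range_pow_invariant (h : IsJCSystem k ε μ s L S N) (j : ℕ) :
    ∀ x ∈ LinearMap.range (N ^ j), S x ∈ LinearMap.range (N ^ j) := by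
  rintro _ ⟨x, rfl⟩
  exact ⟨S x, (h.comm_pow j x).symm⟩

theorem ker_pow_structure_invariant (h : IsJCSystem Kind.auto ε μ s L S N) (j : ℕ) :
    ∀ x ∈ LinearMap.ker (N ^ j), s x ∈ LinearMap.ker (N ^ j) := fun x hx => by
  rw [LinearMap.mem_ker] at hx ⊢
  have h1 := apply_pow_of_twisted (A := s.toLinearMap) h.twistedN j x
  rw [hx, map_zero] at h1
  have h2 : μ ^ j ≠ 0 := pow_ne_zero _ (left_ne_zero_of_mul_eq_one h.mu)
  simpa [h2] using h1.symm

theorem range_pow_structure_invariant (h : IsJCSystem Kind.auto ε μ s L S N) (j : ℕ) :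
    ∀ x ∈ LinearMap.range (N ^ j), s x ∈ LinearMap.range (N ^ j) := by
  rintro _ ⟨x, rfl⟩
  have h1 := apply_pow_of_twisted (A := s.toLinearMap) h.twistedN j x
  exact ⟨μ ^ j • s x, by rw [map_smul]; exact h1.symm⟩

theorem exists_isReducedSpace (h : IsJCSystem k ε μ s L S N) :
    ∃ Y : Submodule ℝ X, IsReducedSpace k s S N Y := by
  have hS := h.range_pow_invariant 1
  rw [pow_one] at hS
  cases k
  · have hs := h.range_pow_structure_invariant 1
    rw [pow_one] at hs
    obtain ⟨Y, hc, hYS, hYs⟩ :=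
      exists_isCompl_auto h.eps h.mu h.sign h.twistedS h.jc.semisimple hS hs
    exact ⟨Y, hYS, hc.symm, hYs⟩
  · obtain ⟨Y, hYS, hc⟩ := Module.End.isSemisimple_iff.1 h.jc.semisimple _ hS
    exact ⟨Y, hYS, hc.symm, trivial⟩

/-- The tower over an invariant complement Z of ker N^(n-1) is nonzero and has an L-invariant
complement compatible with the structure; indecomposability kills that complement. This is where the
equal length of all Jordan chains comes from. -/
theorem exists_tower_eq_top (h : IsJCSystem k ε μ s L S N) :
    ∃ Z : Submodule ℝ X, (∀ z ∈ Z, (N ^ (nilpotencyClass N - 1)) z = 0 → z = 0) ∧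
      tower N Z = ⊤ := by
  set n := nilpotencyClass N
  have hker : ∀ {Z : Submodule ℝ X}, IsCompl (LinearMap.ker (N ^ (n - 1))) Z →
      ∀ z ∈ Z, (N ^ (n - 1)) z = 0 → z = 0 := fun hc z hz h0 =>
    Submodule.disjoint_def.1 hc.disjoint z h0 hz
  have hbot : ∀ {Z : Submodule ℝ X}, IsCompl (LinearMap.ker (N ^ (n - 1))) Z →
      tower N Z ≠ ⊥ := fun {Z} hc h0 => by
    have h1 : Z = ⊥ := by
      rw [eq_bot_iff, ← h0]
      exact le_tower N Z
    rw [h1] at hc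
    exact h.pow_pred_ne (LinearMap.ker_eq_top.1 (eq_top_of_isCompl_bot hc))
  cases k
  · obtain ⟨Z, hc, hZS, hZs⟩ := exists_isCompl_auto h.eps h.mu h.sign h.twistedS h.jc.semisimple
      (h.ker_pow_invariant (n - 1)) (h.ker_pow_structure_invariant (n - 1))
    obtain ⟨W, hW, hWS, hWs⟩ := exists_isCompl_auto h.eps h.mu h.sign h.twistedS h.jc.semisimple
      (h.range_pow_invariant (n - 1)) (h.range_pow_structure_invariant (n - 1))
    -- Here π is the projection onto N^(n-1)X along a complement invariant under S and s;
    -- rank-nullity gives dim N^(n-1)X = dim Z.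
    have hcompl := isCompl_tower h.pow_class (Z := Z)
      (π := Submodule.projectionOnto _ W hW) (fun z hz h0 => by
        rw [Submodule.projectionOnto_apply_of_mem_left hW ⟨z, rfl⟩] at h0
        exact hker hc z hz (congrArg Subtype.val h0)) (by
        have h1 := LinearMap.finrank_range_add_finrank_ker (N ^ (n - 1))
        have h2 := Submodule.finrank_add_eq_of_isCompl hc
        omega)
    refine ⟨Z, hker hc, ?_⟩
    have hπ : ∀ {A : Module.End ℝ X},
        (∀ u ∈ LinearMap.range (N ^ (n - 1)), A u ∈ LinearMap.range (N ^ (n - 1))) →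
        (∀ w ∈ W, A w ∈ W) → ∀ x, Submodule.projectionOnto _ W hW x = 0 →
          Submodule.projectionOnto _ W hW (A x) = 0 := fun hA hA' x hx =>
      Subtype.ext (by rw [projectionOnto_comm hW hA hA', hx]; simp)
    rcases h.indec.2 _ _ hcompl
      (h.apply_mem_of_mem (fun u hu => apply_mem_tower h.commN hZS hu)
        fun u hu => map_mem_tower hu)
      (h.apply_mem_of_mem (fun u hu => iInf_ker_invariant (one_mul 1) h.commN
        (hπ (h.range_pow_invariant (n - 1)) hWS) hu) fun u hu => iInf_ker_invariant_self hu)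
      ⟨fun u hu => apply_mem_tower (A := s.toLinearMap) h.twistedN hZs hu,
        fun u hu => iInf_ker_invariant (A := s.toLinearMap) h.mu h.twistedN
          (hπ (A := s.toLinearMap) (h.range_pow_structure_invariant (n - 1)) hWs) hu⟩ with h0 | h0
    · exact absurd h0 (hbot hc)
    · exact eq_top_of_isCompl_bot (h0 ▸ hcompl)
  · obtain ⟨Z, hZS, hc⟩ :=
      Module.End.isSemisimple_iff.1 h.jc.semisimple _ (h.ker_pow_invariant (n - 1))
    replace hZS : ∀ z ∈ Z, S z ∈ Z := hZS
    have hN := h.twistedN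
    -- Now π x represents the functional z ↦ ω(z, x) on Z, so the complement is the ω-orthogonal
    -- space of the tower.
    have hcompl := isCompl_tower h.pow_class (Z := Z)
      (π := formMap s.toLinearMap Z) (fun z hz h0 => by
        rw [formMap_eq_zero_iff] at h0
        -- N^(n-1)z is orthogonal to Z by assumption and to ker N^(n-1) by moving N^(n-1) across ω;
        -- these two span X, and ω is nondegenerate.
        have h4 : ∀ y, ⟪y, s ((N ^ (n - 1)) z)⟫_ℝ = 0 := fun y => by
          obtain ⟨u, hu, w, hw, rfl⟩ :=
            Submodule.mem_sup.1 (hc.sup_eq_top ▸ Submodule.mem_top : y ∈ _ ⊔ Z)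
          have h1 := hN.inner_pow (n - 1) u z
          rw [LinearMap.mem_ker.1 hu, inner_zero_left] at h1
          have h2 : μ ^ (n - 1) ≠ 0 := pow_ne_zero _ (left_ne_zero_of_mul_eq_one h.mu)
          have h3 := h0 w hw
          rw [LinearEquiv.coe_coe] at h3
          rw [inner_add_left, h3, add_zero]
          simpa [h2] using h1.symm
        exact hker hc z hz (eq_zero_of_forall_inner_eq_zero h4)) le_rfl
    refine ⟨Z, hker hc, ?_⟩
    rcases h.indec.2 _ _ hcompl
      (h.apply_mem_of_mem (fun u hu => apply_mem_tower h.commN hZS hu)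
        fun u hu => map_mem_tower hu)
      (h.apply_mem_of_mem (fun u hu => iInf_ker_invariant (one_mul 1) h.commN
        (fun x hx => by
          rw [formMap_eq_zero_iff] at hx ⊢
          intro y hy
          have h1 := h.twistedS y x
          have h2 := hx _ (hZS y hy)
          rw [LinearEquiv.coe_coe] at h2 ⊢
          rw [h2] at h1
          simpa [left_ne_zero_of_mul_eq_one h.mu] using h1.symm) hu)
        fun u hu => iInf_ker_invariant_self hu)
      (fun u hu w hw => by
        refine tower_induction (p := fun u => ⟪u, s w⟫_ℝ = 0) (fun j z hz => ?_) ?_ ?_ hu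
        · rw [hN.inner_pow]
          have h1 := formMap_eq_zero_iff.1 ((Submodule.mem_iInf _).1 hw j) z hz
          rw [LinearEquiv.coe_coe] at h1
          rw [h1, mul_zero]
        · exact inner_zero_left _
        · intro x y hx hy
          rw [inner_add_left, hx, hy, add_zero]) with h0 | h0
    · exact absurd h0 (hbot hc)
    · exact eq_top_of_isCompl_bot (h0 ▸ hcompl)

theorem range_eq_ker (h : IsJCSystem k ε μ s L S N) :
    LinearMap.range N = LinearMap.ker (N ^ (nilpotencyClass N - 1)) := by
  obtain ⟨Z, hZ, ht⟩ := h.exists_tower_eq_top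
  exact range_eq_ker_of_tower_eq_top h.pow_class hZ ht

variable {Y : Submodule ℝ X}

theorem eq_zero_of_pow_eq_zero (h : IsJCSystem k ε μ s L S N) (hY : IsReducedSpace k s S N Y) :
    ∀ y ∈ Y, (N ^ (nilpotencyClass N - 1)) y = 0 → y = 0 := fun y hy h0 =>
  Submodule.disjoint_def.1 hY.compl.disjoint y hy (by rw [h.range_eq_ker]; exact h0)

theorem tower_eq_top (h : IsJCSystem k ε μ s L S N) (hY : IsReducedSpace k s S N Y) :
    tower N Y = ⊤ :=
  AntiAut.tower_eq_top h.jc.nilpotent hY.compl.codisjoint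

end IsJCSystem

end Systems

/-! ### Equivalence of pairs. -/

section PairEquiv

variable {X : Type*} [NormedAddCommGroup X] [InnerProductSpace ℝ X] [FiniteDimensional ℝ X]
variable {X' : Type*} [NormedAddCommGroup X'] [InnerProductSpace ℝ X'] [FiniteDimensional ℝ X']
variable {X'' : Type*} [NormedAddCommGroup X''] [InnerProductSpace ℝ X'']

theorem PairEquiv.refl (k : Kind) (L s : Module.End ℝ X) : PairEquiv k L s L s :=
  ⟨LinearEquiv.refl ℝ X, fun _ => rfl, by cases k <;> simp⟩

theorem PairEquiv.symm {k : Kind} {L s : Module.End ℝ X} {L' s' : Module.End ℝ X'}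
    (h : PairEquiv k L s L' s') : PairEquiv k L' s' L s := by
  obtain ⟨g, hL, hs⟩ := h
  refine ⟨g.symm, fun x => ?_, ?_⟩
  · rw [LinearEquiv.symm_apply_eq, hL, LinearEquiv.apply_symm_apply]
  · cases k
    · intro x
      rw [LinearEquiv.symm_apply_eq]
      simpa using (hs (g.symm x)).symm
    · intro x y
      simpa using (hs (g.symm x) (g.symm y)).symm

theorem PairEquiv.trans {k : Kind} {L s : Module.End ℝ X} {L' s' : Module.End ℝ X'}
    {L'' s'' : Module.End ℝ X''} (h : PairEquiv k L s L' s') (h' : PairEquiv k L' s' L'' s'') :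
    PairEquiv k L s L'' s'' := by
  obtain ⟨g, hL, hs⟩ := h
  obtain ⟨g', hL', hs'⟩ := h'
  refine ⟨g.trans g', fun x => by simp [hL, hL'], ?_⟩
  cases k
  · intro x
    simp only [LinearEquiv.trans_apply]
    rw [hs x, hs' (g x)]
  · intro x y
    simp only [LinearEquiv.trans_apply]
    rw [hs' (g x) (g y), hs x y]

theorem map_pow_of_intertwine {g : X →ₗ[ℝ] X'} {N : Module.End ℝ X} {N' : Module.End ℝ X'}
    (h : ∀ x, g (N x) = N' (g x)) (j : ℕ) (x : X) : g ((N ^ j) x) = (N' ^ j) (g x) := by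
  induction j generalizing x with
  | zero => rfl
  | succ j ih => rw [pow_succ, Module.End.mul_apply, ih, h, pow_succ, Module.End.mul_apply]

theorem pow_eq_zero_iff_of_intertwine {g : X ≃ₗ[ℝ] X'} {N : Module.End ℝ X} {N' : Module.End ℝ X'}
    (h : ∀ x, g (N x) = N' (g x)) (j : ℕ) : N ^ j = 0 ↔ N' ^ j = 0 := by
  have h1 := map_pow_of_intertwine (g := g.toLinearMap) h j
  constructor
  · intro h0
    ext x
    have := h1 (g.symm x)
    simpa [h0] using this.symm
  · intro h0
    ext x
    have := h1 x
    simpa [h0] using this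

/-- Conjugation by g carries the decomposition of L to one of L', and that one is unique. -/
theorem IsJordanChevalley.intertwine {L S N : Module.End ℝ X} {L' S' N' : Module.End ℝ X'}
    (h : IsJordanChevalley L S N) (h' : IsJordanChevalley L' S' N') {g : X ≃ₗ[ℝ] X'}
    (hg : ∀ x, g (L x) = L' (g x)) :
    (∀ x, g (S x) = S' (g x)) ∧ ∀ x, g (N x) = N' (g x) := by
  have hconj : ∀ A : Module.End ℝ X, ∀ x, g (A x) = g.conj A (g x) := fun A x => by simp
  have h1 : IsJordanChevalley L' (g.conj S) (g.conj N) := by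
    refine ⟨?_, ?_, ?_, ?_⟩
    · ext x
      rw [← map_add, ← h.sum]
      simp [LinearEquiv.conj_apply, hg]
    · ext x
      have := LinearMap.congr_fun h.comm.eq (g.symm x)
      simp only [Module.End.mul_apply] at this
      simp [LinearEquiv.conj_apply, this]
    · refine (LinearEquiv.isSemisimple_iff S (g.conj S) g ?_).1 h.semisimple
      ext x
      simp
    · obtain ⟨n, hn⟩ := h.nilpotent
      exact ⟨n, (pow_eq_zero_iff_of_intertwine (hconj N) n).1 hn⟩
  obtain ⟨h2, h3⟩ := h1.unique h'
  exact ⟨fun x => by rw [hconj, h2], fun x => by rw [hconj, h3]⟩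

theorem nilpotencyClass_eq_of_intertwine {g : X ≃ₗ[ℝ] X'} {N : Module.End ℝ X}
    {N' : Module.End ℝ X'} (h : ∀ x, g (N x) = N' (g x)) :
    nilpotencyClass N = nilpotencyClass N' := by
  unfold nilpotencyClass
  congr 1
  ext j
  exact pow_eq_zero_iff_of_intertwine h j

theorem PairEquiv.indecomposable {k : Kind} {L : Module.End ℝ X} {s : X ≃ₗ[ℝ] X}
    {L' : Module.End ℝ X'} {s' : X' ≃ₗ[ℝ] X'} (h : PairEquiv k L s.toLinearMap L' s'.toLinearMap)
    (hi : Indecomposable k s' L') : Indecomposable k s L := by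
  obtain ⟨g, hL, hs⟩ := h
  refine ⟨?_, fun U W hc hU hW hst => ?_⟩
  · have := hi.1
    exact g.toEquiv.nontrivial
  have hmap : ∀ {V : Submodule ℝ X}, (∀ v ∈ V, L v ∈ V) →
      ∀ v ∈ V.map g.toLinearMap, L' v ∈ V.map g.toLinearMap := by
    rintro V hV _ ⟨v, hv, rfl⟩
    exact ⟨L v, hV v hv, hL v⟩
  have hbot : ∀ {V : Submodule ℝ X}, V.map g.toLinearMap = ⊥ → V = ⊥ := fun {V} hV => by
    rwa [Submodule.map_eq_bot_iff] at hV
  refine (hi.2 (U.map g.toLinearMap) (W.map g.toLinearMap) ?_ (hmap hU) (hmap hW) ?_).imp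
    hbot hbot
  · exact (Submodule.orderIsoMapComap g).isCompl_iff.1 hc
  · cases k
    · refine ⟨?_, ?_⟩
      · rintro _ ⟨v, hv, rfl⟩
        exact ⟨s v, hst.1 v hv, hs v⟩
      · rintro _ ⟨v, hv, rfl⟩
        exact ⟨s v, hst.2 v hv, hs v⟩
    · rintro _ ⟨u, hu, rfl⟩ _ ⟨w, hw, rfl⟩
      exact (hs u w).trans (hst u hu w hw)

end PairEquiv

/-! ### The reduced pair and its independence of the reduced space. -/

section Reduced

variable {X : Type*} [NormedAddCommGroup X] [InnerProductSpace ℝ X] [FiniteDimensional ℝ X]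
variable {k : Kind} {ε μ : ℝ} {s : X ≃ₗ[ℝ] X} {L S N : Module.End ℝ X} {Y : Submodule ℝ X}

namespace IsJCSystem

theorem inner_pow_pow (h : IsJCSystem Kind.anti ε μ s L S N) (i j : ℕ) (x y : X) :
    ⟪(N ^ i) x, s ((N ^ j) y)⟫_ℝ = μ ^ i * ⟪x, s ((N ^ (i + j)) y)⟫_ℝ := by
  have h1 : Twisted Kind.anti μ s N := h.twistedN
  rw [h1.inner_pow, pow_add, Module.End.mul_apply]

theorem inner_pow_swap (h : IsJCSystem Kind.anti ε μ s L S N) (j : ℕ) (x y : X) :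
    ⟪y, s ((N ^ j) x)⟫_ℝ = ε * μ ^ j * ⟪x, s ((N ^ j) y)⟫_ℝ := by
  have h1 : Twisted Kind.anti μ s N := h.twistedN
  have h2 : ∀ x y, ⟪y, s x⟫_ℝ = ε * ⟪x, s y⟫_ℝ := h.sign
  rw [h2, h1.inner_pow, mul_assoc]

/-- The top form lives on X/NX: in the second slot N^(n-1) kills NX = ker N^(n-1), and in the first
slot an extra N moves across to produce N^n = 0. -/
theorem inner_top_congr (h : IsJCSystem Kind.anti ε μ s L S N) {x x' y y' : X}
    (hx : x - x' ∈ LinearMap.range N) (hy : y - y' ∈ LinearMap.range N) :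
    ⟪x, s ((N ^ (nilpotencyClass N - 1)) y)⟫_ℝ = ⟪x', s ((N ^ (nilpotencyClass N - 1)) y')⟫_ℝ := by
  rw [h.range_eq_ker, LinearMap.mem_ker, map_sub, sub_eq_zero] at hy
  obtain ⟨z, hz⟩ := hx
  obtain rfl : x = x' + N z := by rw [hz]; abel
  have h1 := h.inner_pow_pow 1 (nilpotencyClass N - 1) z y
  have hpos := h.class_pos
  rw [pow_apply_eq_zero (k := 1 + (nilpotencyClass N - 1)) h.pow_class (by omega), map_zero,
    inner_zero_right, mul_zero, pow_one] at h1
  rw [inner_add_left, h1, add_zero, hy]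

theorem exists_isReducedStructureMap (h : IsJCSystem k ε μ s L S N)
    (hY : IsReducedSpace k s S N Y) : ∃ t : Y ≃ₗ[ℝ] Y, IsReducedStructureMap k s N Y t := by
  cases k
  · have hs : ∀ y ∈ Y, s.toLinearMap y ∈ Y := hY.structure_invariant
    refine ⟨LinearEquiv.ofInjectiveEndo (s.toLinearMap.restrict hs) ?_, fun y => rfl⟩
    intro x y hxy
    exact Subtype.ext (s.injective (congrArg Subtype.val hxy))
  -- The reduced form is nondegenerate on Y because it factors through X/NX: orthogonality to Y is
  -- orthogonality to all of X.
  · refine ⟨LinearEquiv.ofInjectiveEndo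
      (formMap s.toLinearMap Y ∘ₗ (N ^ (nilpotencyClass N - 1)) ∘ₗ Y.subtype) ?_, fun x y => ?_⟩
    · rw [injective_iff_map_eq_zero]
      intro y hy
      have h1 : ∀ x ∈ Y, ⟪x, s ((N ^ (nilpotencyClass N - 1)) y)⟫_ℝ = 0 :=
        formMap_eq_zero_iff.1 hy
      refine Subtype.ext (h.eq_zero_of_pow_eq_zero hY y y.2
        (eq_zero_of_forall_inner_eq_zero (s := s) fun x => ?_))
      obtain ⟨u, hu, v, hv, rfl⟩ := Submodule.mem_sup.1
        (hY.compl.sup_eq_top ▸ Submodule.mem_top : x ∈ Y ⊔ LinearMap.range N)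
      rw [← h1 u hu]
      exact h.inner_top_congr (by simpa using hv) (by simp)
    · exact inner_formMap _ _ _ _

theorem hasSign_reduced_auto (h : IsJCSystem k ε μ s L S N) (hk : k = Kind.auto)
    {t : Y ≃ₗ[ℝ] Y} (ht : IsReducedStructureMap k s N Y t) : HasSign k ε t := by
  subst hk
  intro y
  have ht' : ∀ y : Y, (t y : X) = s y := ht
  have hs : ∀ x, s (s x) = ε • x := h.sign
  exact Subtype.ext (by rw [ht', ht', hs]; rfl)

theorem hasSign_reduced_anti (h : IsJCSystem k ε μ s L S N) (hk : k = Kind.anti)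
    {t : Y ≃ₗ[ℝ] Y} (ht : IsReducedStructureMap k s N Y t) :
    HasSign k (ε * μ ^ (nilpotencyClass N - 1)) t := by
  subst hk
  intro x y
  rw [ht x y, ht y x, h.inner_pow_swap]

theorem twisted_reduced (h : IsJCSystem k ε μ s L S N) (hY : IsReducedSpace k s S N Y)
    {t : Y ≃ₗ[ℝ] Y} (ht : IsReducedStructureMap k s N Y t) :
    Twisted k μ t (S.restrict hY.invariant) := by
  cases k
  · intro y
    have ht' : ∀ y : Y, (t y : X) = s y := ht
    have hS : ∀ x, s (S x) = μ • S (s x) := h.twistedS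
    refine Subtype.ext ?_
    rw [ht', Submodule.coe_smul, LinearMap.coe_restrict_apply, LinearMap.coe_restrict_apply, ht',
      hS]
  · intro x y
    have hS : ∀ x y, ⟪S x, s y⟫_ℝ = μ * ⟪x, s (S y)⟫_ℝ := h.twistedS
    rw [ht, ht, LinearMap.coe_restrict_apply, LinearMap.coe_restrict_apply, hS, h.comm_pow]

variable {X' : Type*} [NormedAddCommGroup X'] [InnerProductSpace ℝ X'] [FiniteDimensional ℝ X']
variable {ε' μ' : ℝ} {s' : X' ≃ₗ[ℝ] X'} {L' S' N' : Module.End ℝ X'} {Y' : Submodule ℝ X'}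

/-- The equivalence g induces a map X/NX → X'/N'X', and `f` is this map read on the two sections Y
and Y'. With g the identity it compares two reduced spaces of the same system. -/
theorem pairEquiv_reduced (h : IsJCSystem k ε μ s L S N) (h' : IsJCSystem k ε' μ' s' L' S' N')
    (he : PairEquiv k L s.toLinearMap L' s'.toLinearMap)
    (hY : IsReducedSpace k s S N Y) {t : Y ≃ₗ[ℝ] Y} (ht : IsReducedStructureMap k s N Y t)
    (hY' : IsReducedSpace k s' S' N' Y') {t' : Y' ≃ₗ[ℝ] Y'}
    (ht' : IsReducedStructureMap k s' N' Y' t') :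
    nilpotencyClass N = nilpotencyClass N' ∧
      PairEquiv k (S.restrict hY.invariant) t.toLinearMap
        (S'.restrict hY'.invariant) t'.toLinearMap := by
  obtain ⟨g, hL, hs⟩ := he
  obtain ⟨hS, hN⟩ := h.jc.intertwine h'.jc hL
  have hcl := nilpotencyClass_eq_of_intertwine hN
  refine ⟨hcl, ?_⟩
  -- g need not carry Y into Y', only NX onto N'X'; projecting along N'X' repairs this without
  -- changing classes.
  let p : X' →ₗ[ℝ] Y' := Y'.projectionOnto (LinearMap.range N') hY'.compl
  have hpN : ∀ x, p (N' x) = 0 := fun x =>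
    (Submodule.projectionOnto_apply_eq_zero_iff hY'.compl).2 ⟨x, rfl⟩
  have hpsub : ∀ x, (p x : X') - x ∈ LinearMap.range N' := fun x => by
    rw [← neg_mem_iff, neg_sub]
    have := Submodule.sub_projection_mem hY'.compl x
    rwa [Submodule.projection_apply] at this
  have hpY : ∀ y : Y', p (y : X') = y := fun y => Submodule.projectionOnto_apply_left hY'.compl y
  have hrange : ∀ {A : Module.End ℝ X'} {c : ℝ}, (∀ x, A (N' x) = c • N' (A x)) →
      ∀ w ∈ LinearMap.range N', A w ∈ LinearMap.range N' := by
    rintro A c hA _ ⟨x, rfl⟩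
    exact ⟨c • A x, by rw [hA, map_smul]⟩
  let f : Y →ₗ[ℝ] Y' := p ∘ₗ g.toLinearMap ∘ₗ Y.subtype
  have hf : ∀ y : Y, f y = p (g y) := fun y => rfl
  have hfbij : Function.Bijective f := by
    constructor
    · rw [injective_iff_map_eq_zero]
      intro y hy
      obtain ⟨w, hw⟩ := (Submodule.projectionOnto_apply_eq_zero_iff hY'.compl).1 hy
      have h1 : (y : X) = N (g.symm w) := g.injective (by
        rw [hN, LinearEquiv.apply_symm_apply]; exact hw.symm)
      exact Subtype.ext (Submodule.disjoint_def.1 hY.compl.disjoint y y.2 ⟨_, h1.symm⟩)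
    · intro y'
      obtain ⟨y, hy, _, ⟨w, rfl⟩, hyw⟩ := Submodule.mem_sup.1
        (hY.compl.sup_eq_top ▸ Submodule.mem_top : g.symm y' ∈ Y ⊔ LinearMap.range N)
      refine ⟨⟨y, hy⟩, ?_⟩
      have h1 : g y = y' - N' (g w) := by
        rw [← hN, eq_sub_iff_add_eq, ← map_add, hyw, LinearEquiv.apply_symm_apply]
      rw [hf, h1, map_sub, hpN, sub_zero, hpY]
  refine ⟨LinearEquiv.ofBijective f hfbij, fun y => ?_, ?_⟩
  · rw [LinearEquiv.ofBijective_apply, LinearEquiv.ofBijective_apply, hf, hf]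
    refine Subtype.ext ?_
    rw [LinearMap.coe_restrict_apply, LinearMap.coe_restrict_apply, hS]
    exact projectionOnto_comm hY'.compl hY'.invariant (hrange h'.commN) (g y)
  · cases k
    · intro y
      have ht1 : ∀ y : Y, (t y : X) = s y := ht
      have ht1' : ∀ y : Y', (t' y : X') = s' y := ht'
      have hs1 : ∀ x, g (s x) = s' (g x) := hs
      rw [LinearEquiv.ofBijective_apply, LinearEquiv.ofBijective_apply, hf, hf]
      refine Subtype.ext ?_
      rw [LinearEquiv.coe_coe, LinearEquiv.coe_coe, ht1, ht1', hs1]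
      exact projectionOnto_comm (A := s'.toLinearMap) hY'.compl hY'.structure_invariant
        (hrange (A := s'.toLinearMap) h'.twistedN) (g y)
    · intro x y
      have hs1 : ∀ x y, ⟪g x, s' (g y)⟫_ℝ = ⟪x, s y⟫_ℝ := hs
      rw [LinearEquiv.ofBijective_apply, LinearEquiv.ofBijective_apply, hf, hf,
        LinearEquiv.coe_coe, LinearEquiv.coe_coe, ht, ht', h'.inner_top_congr (hpsub _) (hpsub _),
        ← hcl, ← hs1]
      congr 2
      exact (map_pow_of_intertwine (g := g.toLinearMap) hN _ _).symm

end IsJCSystem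

/-! ### Normalised reduced spaces. -/

/-- The form `⟪x, s N ^ j y⟫` vanishes on `Y` for all `j` except the largest one. -/
def IsNormalized (k : Kind) (s : X ≃ₗ[ℝ] X) (N : Module.End ℝ X) (Y : Submodule ℝ X) : Prop :=
  match k with
  | Kind.auto => True
  | Kind.anti => ∀ j < nilpotencyClass N - 1, ∀ x ∈ Y, ∀ y ∈ Y, ⟪x, s ((N ^ j) y)⟫_ℝ = 0

namespace IsJCSystem

/-- The nondegenerate top form represents the form of index m by an endomorphism `a` of Y. Shifting
y by -½ N^(d+1) a(y) cancels that form and leaves the forms of higher index untouched, because N^n =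
0. -/
theorem exists_normalized_step (h : IsJCSystem Kind.anti ε μ s L S N)
    (hY : IsReducedSpace Kind.anti s S N Y) {m d : ℕ} (hm : m + (d + 1) = nilpotencyClass N - 1)
    (hform : ∀ j, m < j → j < nilpotencyClass N - 1 → ∀ x ∈ Y, ∀ y ∈ Y,
      ⟪x, s ((N ^ j) y)⟫_ℝ = 0) :
    ∃ Y₁ : Submodule ℝ X, IsReducedSpace Kind.anti s S N Y₁ ∧
      ∀ j, m ≤ j → j < nilpotencyClass N - 1 → ∀ x ∈ Y₁, ∀ y ∈ Y₁, ⟪x, s ((N ^ j) y)⟫_ℝ = 0 := by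
  obtain ⟨t, ht⟩ := h.exists_isReducedStructureMap hY
  set n := nilpotencyClass N with hn
  have ht' : ∀ x y : Y, ⟪x, t y⟫_ℝ = ⟪(x : X), s ((N ^ (n - 1)) (y : X))⟫_ℝ := ht
  have hSt : ∀ x y, ⟪S x, s y⟫_ℝ = μ * ⟪x, s (S y)⟫_ℝ := h.twistedS
  let a : Y →ₗ[ℝ] Y :=
    t.symm.toLinearMap ∘ₗ formMap s.toLinearMap Y ∘ₗ (N ^ m) ∘ₗ Y.subtype
  have ha : ∀ x y : Y, ⟪(x : X), s ((N ^ (n - 1)) (a y : X))⟫_ℝ = ⟪(x : X), s ((N ^ m) (y : X))⟫_ℝ :=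
    fun x y => by
      rw [← ht']
      simp only [a, LinearMap.comp_apply, LinearEquiv.coe_coe, LinearEquiv.apply_symm_apply]
      exact inner_formMap _ _ _ _
  -- Both forms are S-equivariant with the same μ, so `a` commutes with S; this keeps the shifted
  -- space S-invariant.
  have haS : ∀ y : Y, a (S.restrict hY.invariant y) = S.restrict hY.invariant (a y) := fun y => by
    apply t.injective
    refine ext_inner_left ℝ fun x => ?_
    rw [ht', ht', ha, LinearMap.coe_restrict_apply, LinearMap.coe_restrict_apply, ← h.comm_pow,
      ← h.comm_pow]
    have hμ : μ ≠ 0 := left_ne_zero_of_mul_eq_one h.mu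
    have h1 := ha (S.restrict hY.invariant x) y
    rw [LinearMap.coe_restrict_apply, hSt, hSt] at h1
    exact (mul_left_cancel₀ hμ h1).symm
  -- The exponent d + 1 raises the index m to n - 1 and is positive, so the shift lies in NX. The
  -- factor ½ appears since the correction enters through both slots of the form.
  let q : Y →ₗ[ℝ] X := Y.subtype - (1 / 2 : ℝ) • ((N ^ (d + 1)) ∘ₗ Y.subtype ∘ₗ a)
  have hq : ∀ y : Y, q y = y - (1 / 2 : ℝ) • (N ^ (d + 1)) (a y : X) := fun y => rfl
  have hqN : ∀ y : Y, (y : X) - q y ∈ LinearMap.range N := fun y => by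
    rw [hq, sub_sub_cancel, pow_succ', Module.End.mul_apply, ← map_smul]
    exact ⟨_, rfl⟩
  refine ⟨LinearMap.range q, ⟨?_, ⟨?_, ?_⟩, trivial⟩, ?_⟩
  · rintro _ ⟨y, rfl⟩
    refine ⟨S.restrict hY.invariant y, ?_⟩
    rw [hq, hq, haS, map_sub, map_smul, h.comm_pow, LinearMap.coe_restrict_apply,
      LinearMap.coe_restrict_apply]
  · rw [Submodule.disjoint_def]
    rintro _ ⟨y, rfl⟩ hy
    have h1 := add_mem (hqN y) hy
    rw [sub_add_cancel] at h1
    have h2 : y = 0 := Subtype.ext (Submodule.disjoint_def.1 hY.compl.disjoint y y.2 h1)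
    rw [h2, map_zero]
  · rw [codisjoint_iff, eq_top_iff]
    intro x _
    obtain ⟨y, hy, w, hw, rfl⟩ := Submodule.mem_sup.1
      (hY.compl.sup_eq_top ▸ Submodule.mem_top : x ∈ Y ⊔ LinearMap.range N)
    exact Submodule.mem_sup.2 ⟨q ⟨y, hy⟩, ⟨_, rfl⟩, _, add_mem (hqN ⟨y, hy⟩) hw, by simp; abel⟩
  · rintro j hmj hjn _ ⟨x, rfl⟩ _ ⟨y, rfl⟩
    have hz : ∀ i, n ≤ i → ∀ v, (N ^ i) v = 0 := fun i hi v => pow_apply_eq_zero h.pow_class hi v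
    have hexp : ⟪q x, s ((N ^ j) (q y))⟫_ℝ =
        ⟪(x : X), s ((N ^ j) (y : X))⟫_ℝ
          - 1 / 2 * ⟪(x : X), s ((N ^ (j + (d + 1))) (a y : X))⟫_ℝ
          - 1 / 2 * (μ ^ (d + 1) * ⟪(a x : X), s ((N ^ ((d + 1) + j)) (y : X))⟫_ℝ) := by
      rw [hq, hq, map_sub, map_sub, inner_sub_left, inner_sub_right, inner_sub_right, map_smul,
        map_smul, inner_smul_left, inner_smul_left, inner_smul_right, inner_smul_right,
        h.inner_pow_pow, ← Module.End.mul_apply, ← pow_add, h.inner_pow_pow (d + 1) (j + (d + 1)),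
        hz (d + 1 + (j + (d + 1))) (by omega)]
      simp
    rw [hexp]
    rcases hmj.eq_or_lt with rfl | hlt
    -- Two swaps of the slots turn the correction from the first slot into the one from the second;
    -- the signs ε² and μ^(2(n-1)) are both 1, so the two halves cancel the form.
    · rw [hm, add_comm (d + 1) m, hm, ha, h.inner_pow_swap (n - 1), ha, h.inner_pow_swap m x y]
      have h1 : μ ^ (d + 1) * μ ^ (n - 1) * μ ^ m = 1 := by
        rw [← pow_add, ← pow_add, show d + 1 + (n - 1) + m = 2 * (n - 1) by omega, pow_mul,
          pow_two, h.mu, one_pow]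
      have h2 := h.eps
      linear_combination (-(1 / 2) * ε ^ 2 * ⟪(x : X), s ((N ^ m) (y : X))⟫_ℝ) * h1 -
        (1 / 2) * ⟪(x : X), s ((N ^ m) (y : X))⟫_ℝ * h2
    · rw [hform j hlt hjn x x.2 y y.2, hz _ (by omega), hz _ (by omega)]
      simp

theorem exists_normalized (h : IsJCSystem k ε μ s L S N) :
    ∃ Y : Submodule ℝ X, IsReducedSpace k s S N Y ∧ IsNormalized k s N Y := by
  obtain ⟨Y₀, hY₀⟩ := h.exists_isReducedSpace
  cases k
  · exact ⟨Y₀, hY₀, trivial⟩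
  -- Induction from the top index downwards: d counts the forms below index n - 1 already cleared.
  have key : ∀ d : ℕ, ∃ Y : Submodule ℝ X, IsReducedSpace Kind.anti s S N Y ∧
      ∀ j, nilpotencyClass N - 1 - d ≤ j → j < nilpotencyClass N - 1 → ∀ x ∈ Y, ∀ y ∈ Y,
        ⟪x, s ((N ^ j) y)⟫_ℝ = 0 := by
    intro d
    induction d with
    | zero => exact ⟨Y₀, hY₀, fun j h1 h2 => by omega⟩
    | succ d ih =>
      obtain ⟨Y, hY, hf⟩ := ih
      by_cases hd : d + 1 ≤ nilpotencyClass N - 1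
      · exact h.exists_normalized_step hY (m := nilpotencyClass N - 1 - (d + 1)) (d := d)
          (by omega) fun j hj => hf j (by omega)
      · exact ⟨Y, hY, fun j _ => hf j (by omega)⟩
  obtain ⟨Y, hY, hf⟩ := key (nilpotencyClass N - 1)
  exact ⟨Y, hY, fun j hj => hf j (by omega) hj⟩

end IsJCSystem

end Reduced

/-! ### Recovering a system from its reduced pair. -/

section Reduced

variable {X : Type*} [NormedAddCommGroup X] [InnerProductSpace ℝ X] [FiniteDimensional ℝ X]
variable {X' : Type*} [NormedAddCommGroup X'] [InnerProductSpace ℝ X'] [FiniteDimensional ℝ X']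
variable {k : Kind} {ε μ : ℝ} {s : X ≃ₗ[ℝ] X} {L S N : Module.End ℝ X} {Y : Submodule ℝ X}
variable {s' : X' ≃ₗ[ℝ] X'} {L' S' N' : Module.End ℝ X'} {Y' : Submodule ℝ X'}

namespace IsJCSystem

/-- On a normalized reduced space all forms `⟪x, s N ^ j y⟫` are determined by the reduced one. -/
theorem inner_pow_pow_of_normalized (h : IsJCSystem Kind.anti ε μ s L S N)
    (hn : IsNormalized Kind.anti s N Y) {t : Y ≃ₗ[ℝ] Y}
    (ht : IsReducedStructureMap Kind.anti s N Y t) (i j : ℕ) (x y : Y) :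
    ⟪(N ^ i) (x : X), s ((N ^ j) (y : X))⟫_ℝ =
      if i + j = nilpotencyClass N - 1 then μ ^ i * ⟪x, t y⟫_ℝ else 0 := by
  have ht' : ∀ x y : Y, ⟪x, t y⟫_ℝ = ⟪(x : X), s ((N ^ (nilpotencyClass N - 1)) (y : X))⟫_ℝ := ht
  rw [h.inner_pow_pow]
  split_ifs with hij
  · rw [hij, ht']
  · rcases lt_or_gt_of_ne hij with h1 | h1
    · have hn' : ∀ j < nilpotencyClass N - 1, ∀ x ∈ Y, ∀ y ∈ Y, ⟪x, s ((N ^ j) y)⟫_ℝ = 0 := hn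
      rw [hn' _ h1 x x.2 y y.2, mul_zero]
    · rw [pow_apply_eq_zero h.pow_class (by omega), map_zero, inner_zero_right, mul_zero]

/-- The isomorphism e of reduced spaces extends to X through the chain decomposition, N^j y ↦ N'^j
e(y). Normalisation leaves ω(N^i x, N^j y) nonzero only for i + j = n - 1, where it is the reduced
form up to μ^i. -/
theorem pairEquiv_of_normalized (h : IsJCSystem k ε μ s L S N)
    (h' : IsJCSystem k ε μ s' L' S' N') (hcl : nilpotencyClass N = nilpotencyClass N')
    (hY : IsReducedSpace k s S N Y) (hn : IsNormalized k s N Y)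
    {t : Y ≃ₗ[ℝ] Y} (ht : IsReducedStructureMap k s N Y t)
    (hY' : IsReducedSpace k s' S' N' Y') (hn' : IsNormalized k s' N' Y')
    {t' : Y' ≃ₗ[ℝ] Y'} (ht' : IsReducedStructureMap k s' N' Y' t')
    (he : PairEquiv k (S.restrict hY.invariant) t.toLinearMap
        (S'.restrict hY'.invariant) t'.toLinearMap) :
    PairEquiv k L s.toLinearMap L' s'.toLinearMap := by
  obtain ⟨e, heS, het⟩ := he
  set n := nilpotencyClass N with hndef
  have hN : N ^ n = 0 := h.pow_class
  have hN' : N' ^ n = 0 := by rw [hcl]; exact h'.pow_class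
  have htop := h.tower_eq_top hY
  have htop' := h'.tower_eq_top hY'
  let Φ : (Fin n → Y) ≃ₗ[ℝ] X := LinearEquiv.ofBijective (towerMap N Y n)
    ⟨towerMap_injective hN (h.eq_zero_of_pow_eq_zero hY),
      LinearMap.range_eq_top.1 (by rw [range_towerMap hN, htop])⟩
  let Φ' : (Fin n → Y') ≃ₗ[ℝ] X' := LinearEquiv.ofBijective (towerMap N' Y' n)
    ⟨towerMap_injective hN' (by rw [hcl]; exact h'.eq_zero_of_pow_eq_zero hY'),
      LinearMap.range_eq_top.1 (by rw [range_towerMap hN', htop'])⟩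
  let g : X ≃ₗ[ℝ] X' := Φ.symm ≪≫ₗ LinearEquiv.piCongrRight (fun _ => e) ≪≫ₗ Φ'
  have hΦ : ∀ (j : Fin n) (y : Y), Φ (Pi.single j y) = (N ^ (j : ℕ)) (y : X) := fun j y => by
    change towerMap N Y n (Pi.single j y) = _
    rw [towerMap_apply, Finset.sum_eq_single j]
    · simp
    · intro i _ hi
      simp [Pi.single_eq_of_ne hi]
    · simp
  have hΦ' : ∀ (j : Fin n) (y : Y'), Φ' (Pi.single j y) = (N' ^ (j : ℕ)) (y : X') := fun j y => by
    change towerMap N' Y' n (Pi.single j y) = _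
    rw [towerMap_apply, Finset.sum_eq_single j]
    · simp
    · intro i _ hi
      simp [Pi.single_eq_of_ne hi]
    · simp
  have hg : ∀ (j : ℕ) (y : Y), g ((N ^ j) (y : X)) = (N' ^ j) (e y : X') := by
    intro j y
    by_cases hj : j < n
    · have h1 := hΦ ⟨j, hj⟩ y
      have h2 := hΦ' ⟨j, hj⟩ (e y)
      simp only at h1 h2
      rw [← h1, ← h2]
      simp only [g, LinearEquiv.trans_apply, LinearEquiv.symm_apply_apply]
      congr 1
      funext i
      rw [LinearEquiv.piCongrRight_apply]
      by_cases hi : i = ⟨j, hj⟩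
      · subst hi
        simp
      · simp [Pi.single_eq_of_ne hi]
    · rw [pow_apply_eq_zero hN (not_lt.1 hj), pow_apply_eq_zero hN' (not_lt.1 hj), map_zero]
  -- Additive properties need to be checked on the vectors N^j y only.
  have hind : ∀ {p : X → Prop}, (∀ (j : ℕ) (y : Y), p ((N ^ j) (y : X))) →
      (∀ x y, p x → p y → p (x + y)) → ∀ x, p x := fun {p} h1 h2 x =>
    tower_induction (N := N) (Z := Y) (p := p) (fun j z hz => h1 j ⟨z, hz⟩)
      (by simpa using h1 n 0) h2 (htop ▸ Submodule.mem_top : x ∈ tower N Y)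
  have hgN : ∀ x, g (N x) = N' (g x) := by
    refine hind (fun j y => ?_) fun x y hx hy => by simp only [map_add, hx, hy]
    rw [hg, ← Module.End.mul_apply, ← Module.End.mul_apply, ← pow_succ', ← pow_succ', hg]
  have hgS : ∀ x, g (S x) = S' (g x) := by
    refine hind (fun j y => ?_) fun x y hx hy => by simp only [map_add, hx, hy]
    rw [hg, h.comm_pow, h'.comm_pow]
    have h1 := hg j (S.restrict hY.invariant y)
    rw [LinearMap.coe_restrict_apply, heS, LinearMap.coe_restrict_apply] at h1
    exact h1
  refine ⟨g, fun x => ?_, ?_⟩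
  · rw [h.jc.sum, h'.jc.sum, LinearMap.add_apply, map_add, hgS, hgN]
    rfl
  · cases k
    · have ht1 : ∀ y : Y, (t y : X) = s y := ht
      have ht1' : ∀ y : Y', (t' y : X') = s' y := ht'
      have het1 : ∀ y : Y, e (t y) = t' (e y) := het
      refine hind (fun j y => ?_) fun x y hx hy => by simp only [map_add, hx, hy]
      have h1 := apply_pow_of_twisted (A := s.toLinearMap) h.twistedN j y
      have h1' := apply_pow_of_twisted (A := s'.toLinearMap) h'.twistedN j (e y : X')
      have h2 := hg j (t y)
      rw [het1, ht1, ht1'] at h2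
      rw [h1, map_smul, hg, h1']
      congr 1
    · have het1 : ∀ x y : Y, ⟪e x, t' (e y)⟫_ℝ = ⟪x, t y⟫_ℝ := het
      have key : ∀ x y, ⟪g x, s' (g y)⟫_ℝ = ⟪x, s y⟫_ℝ := by
        refine hind (fun i x => ?_)
          fun x y hx hy z => by simp only [map_add, inner_add_left, hx, hy]
        refine hind (fun j y => ?_)
          fun y z hy hz => by simp only [map_add, inner_add_right, hy, hz]
        rw [hg, hg, h.inner_pow_pow_of_normalized hn ht, h'.inner_pow_pow_of_normalized hn' ht',
          het1, ← hcl]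
      exact key

/-- Each given reduced pair is equivalent to that of a normalised space in the same system, so the
hypothesis transfers to normalised spaces. -/
theorem pairEquiv_of_reduced (h : IsJCSystem k ε μ s L S N)
    (h' : IsJCSystem k ε μ s' L' S' N') (hcl : nilpotencyClass N = nilpotencyClass N')
    (hY : IsReducedSpace k s S N Y) {t : Y ≃ₗ[ℝ] Y} (ht : IsReducedStructureMap k s N Y t)
    (hY' : IsReducedSpace k s' S' N' Y') {t' : Y' ≃ₗ[ℝ] Y'}
    (ht' : IsReducedStructureMap k s' N' Y' t')
    (he : PairEquiv k (S.restrict hY.invariant) t.toLinearMap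
        (S'.restrict hY'.invariant) t'.toLinearMap) :
    PairEquiv k L s.toLinearMap L' s'.toLinearMap := by
  obtain ⟨Z, hZ, hn⟩ := h.exists_normalized
  obtain ⟨Z', hZ', hn'⟩ := h'.exists_normalized
  obtain ⟨u, hu⟩ := h.exists_isReducedStructureMap hZ
  obtain ⟨u', hu'⟩ := h'.exists_isReducedStructureMap hZ'
  have h1 := (h.pairEquiv_reduced h (PairEquiv.refl k L _) hZ hu hY ht).2
  have h2 := (h'.pairEquiv_reduced h' (PairEquiv.refl k L' _) hY' ht' hZ' hu').2
  exact h.pairEquiv_of_normalized h' hcl hZ hn hu hZ' hn' hu' (h1.trans (he.trans h2))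

theorem nontrivial_reduced (h : IsJCSystem k ε μ s L S N) (hY : IsReducedSpace k s S N Y) :
    Nontrivial Y := by
  rw [Submodule.nontrivial_iff_ne_bot]
  rintro rfl
  have h1 := h.tower_eq_top hY
  simp only [tower, Submodule.map_bot, iSup_bot] at h1
  have := h.indec.1
  exact bot_ne_top h1

theorem isCompl_tower_tower (h : IsJCSystem k ε μ s L S N) (hY : IsReducedSpace k s S N Y)
    {U W : Submodule ℝ Y} (hc : IsCompl U W) :
    IsCompl (tower N (U.map Y.subtype)) (tower N (W.map Y.subtype)) := by
  constructor
  · rw [Submodule.disjoint_def]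
    intro x hxU hxW
    have hlift : ∀ {V : Submodule ℝ Y}, x ∈ tower N (V.map Y.subtype) →
        ∃ v : Fin (nilpotencyClass N) → Y, (∀ j, v j ∈ V) ∧
          towerMap N Y (nilpotencyClass N) v = x := by
      intro V hx
      rw [← range_towerMap h.pow_class] at hx
      obtain ⟨v, hv⟩ := hx
      have hex : ∀ j, ∃ y : Y, y ∈ V ∧ (y : X) = v j := fun j => by
        obtain ⟨y, hy, hy'⟩ := (v j).2
        exact ⟨y, hy, hy'⟩
      choose y hy hy' using hex
      refine ⟨y, hy, ?_⟩
      rw [← hv, towerMap_apply, towerMap_apply]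
      exact Finset.sum_congr rfl fun j _ => by rw [hy']
    obtain ⟨u, hu, rfl⟩ := hlift hxU
    obtain ⟨w, hw, hwu⟩ := hlift hxW
    have h1 := towerMap_injective h.pow_class (h.eq_zero_of_pow_eq_zero hY) hwu
    subst h1
    have h2 : w = 0 := funext fun j => Submodule.disjoint_def.1 hc.disjoint _ (hu j) (hw j)
    rw [h2, map_zero]
  · rw [codisjoint_iff, ← tower_sup, ← Submodule.map_sup, hc.sup_eq_top, Submodule.map_top,
      Submodule.range_subtype, h.tower_eq_top hY]

/-- A splitting of Y yields two complementary towers in X. For anti-automorphisms normalisation is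
what makes the towers orthogonal, since the reduced form sees only the top index. -/
theorem indecomposable_of_normalized (h : IsJCSystem k ε μ s L S N)
    (hY : IsReducedSpace k s S N Y) (hn : IsNormalized k s N Y) {t : Y ≃ₗ[ℝ] Y}
    (ht : IsReducedStructureMap k s N Y t) :
    Indecomposable k t (S.restrict hY.invariant) := by
  refine ⟨h.nontrivial_reduced hY, fun U W hc hU hW hst => ?_⟩
  have hinv : ∀ {V : Submodule ℝ Y}, (∀ v ∈ V, S.restrict hY.invariant v ∈ V) →
      ∀ x ∈ tower N (V.map Y.subtype), L x ∈ tower N (V.map Y.subtype) := fun {V} hV =>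
    h.apply_mem_of_mem (fun x hx => apply_mem_tower h.commN (by
      rintro _ ⟨v, hv, rfl⟩
      exact ⟨_, hV v hv, rfl⟩) hx) fun x hx => map_mem_tower hx
  have hbot : ∀ {V : Submodule ℝ Y}, tower N (V.map Y.subtype) = ⊥ → V = ⊥ := fun {V} hV => by
    have h1 := le_tower N (V.map Y.subtype)
    rw [hV, le_bot_iff] at h1
    rw [eq_bot_iff]
    intro v hv
    have h2 : (v : X) ∈ V.map Y.subtype := ⟨v, hv, rfl⟩
    rw [h1, Submodule.mem_bot] at h2
    exact Subtype.ext h2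
  refine (h.indec.2 _ _ (h.isCompl_tower_tower hY hc) (hinv hU) (hinv hW) ?_).imp hbot hbot
  cases k
  · have ht1 : ∀ y : Y, (t y : X) = s y := ht
    have hs : ∀ {V : Submodule ℝ Y}, (∀ v ∈ V, t v ∈ V) →
        ∀ x ∈ tower N (V.map Y.subtype), s x ∈ tower N (V.map Y.subtype) := fun {V} hV x hx =>
      apply_mem_tower (A := s.toLinearMap) h.twistedN (by
        rintro _ ⟨v, hv, rfl⟩
        exact ⟨_, hV v hv, ht1 v⟩) hx
    exact ⟨hs hst.1, hs hst.2⟩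
  · intro u hu w hw
    refine tower_induction (p := fun u => ⟪u, s w⟫_ℝ = 0) ?_ (inner_zero_left _)
      (fun x y hx hy => by rw [inner_add_left, hx, hy, add_zero]) hu
    rintro i _ ⟨u, hu, rfl⟩
    refine tower_induction (p := fun w => ⟪(N ^ i) (Y.subtype u), s w⟫_ℝ = 0) ?_ (by simp)
      (fun x y hx hy => by rw [map_add, inner_add_right, hx, hy, add_zero]) hw
    rintro j _ ⟨w, hw, rfl⟩
    have h1 := h.inner_pow_pow_of_normalized hn ht i j u w
    have h2 : ⟪u, t w⟫_ℝ = 0 := hst u hu w hw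
    rw [h2, mul_zero, ite_self] at h1
    exact h1

theorem indecomposable_reduced (h : IsJCSystem k ε μ s L S N)
    (hY : IsReducedSpace k s S N Y) {t : Y ≃ₗ[ℝ] Y} (ht : IsReducedStructureMap k s N Y t) :
    Indecomposable k t (S.restrict hY.invariant) := by
  obtain ⟨Z, hZ, hn⟩ := h.exists_normalized
  obtain ⟨u, hu⟩ := h.exists_isReducedStructureMap hZ
  exact (h.pairEquiv_reduced h (PairEquiv.refl k L _) hY ht hZ hu).2.indecomposable
    (h.indecomposable_of_normalized hZ hn hu)

end IsJCSystem

theorem IsIndecomposablePair.reduced {T : MapType} (hL : IsIndecomposablePair T L s)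
    (hJ : IsJordanChevalley L S N) (hY : IsReducedSpace T.kind s S N Y) {t : Y ≃ₗ[ℝ] Y}
    (ht : IsReducedStructureMap T.kind s N Y t) :
    IsIndecomposablePair (T.reduced (nilpotencyClass N)) (S.restrict hY.invariant) t := by
  have h := hL.isJCSystem hJ
  rw [isIndecomposablePair_iff, T.reduced_kind, T.reduced_mu]
  refine ⟨?_, h.twisted_reduced hY ht, h.indecomposable_reduced hY ht⟩
  cases hk : T.kind
  · rw [MapType.reduced_of_auto hk, ← hk]
    exact h.hasSign_reduced_auto hk ht
  · rw [MapType.reduced_eps_of_anti hk h.class_pos.ne', ← hk]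
    exact h.hasSign_reduced_anti hk ht

end Reduced

/-! ### Indecomposability through idempotents. -/

section Idempotents

variable {X : Type*} [NormedAddCommGroup X] [InnerProductSpace ℝ X] [FiniteDimensional ℝ X]

/-- `P` commutes with `s` for automorphisms and is self-adjoint for `⟪x, s y⟫` for
anti-automorphisms. -/
def Preserves (k : Kind) (s : X ≃ₗ[ℝ] X) (P : Module.End ℝ X) : Prop :=
  match k with
  | Kind.auto => ∀ x, P (s x) = s (P x)
  | Kind.anti => ∀ x y, ⟪P x, s y⟫_ℝ = ⟪x, s (P y)⟫_ℝ

theorem indecomposable_of_idempotents {k : Kind} {s : X ≃ₗ[ℝ] X} {L : Module.End ℝ X}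
    [Nontrivial X] {ε : ℝ} (hs : HasSign k ε s)
    (h : ∀ P : Module.End ℝ X, P * P = P → P * L = L * P → Preserves k s P → P = 0 ∨ P = 1) :
    Indecomposable k s L := by
  refine ⟨inferInstance, fun U W hc hU hW hst => ?_⟩
  let P : Module.End ℝ X := U.projection W hc
  have hP : ∀ x, P x ∈ U := fun x => Submodule.projection_apply_mem hc x
  have hP' : ∀ x, x - P x ∈ W := fun x => Submodule.sub_projection_mem hc x
  have hPid : ∀ u ∈ U, P u = u := fun u hu => Submodule.projection_apply_of_mem_left hc hu
  have hP0 : ∀ w ∈ W, P w = 0 := fun w hw => (Submodule.projection_apply_eq_zero_iff hc).2 hw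
  have hcomm : ∀ {A : Module.End ℝ X}, (∀ u ∈ U, A u ∈ U) → (∀ w ∈ W, A w ∈ W) →
      ∀ x, P (A x) = A (P x) := fun hA hA' x => by
    simp only [P, Submodule.projection_apply]
    exact projectionOnto_comm hc hA hA' x
  rcases h P (LinearMap.ext fun x => hPid _ (hP x)) (LinearMap.ext (hcomm hU hW)) (by
    cases k
    · exact hcomm (A := s.toLinearMap) hst.1 hst.2
    · have hst1 : ∀ u ∈ U, ∀ w ∈ W, ⟪u, s w⟫_ℝ = 0 := hst
      have hs1 : ∀ x y, ⟪y, s x⟫_ℝ = ε * ⟪x, s y⟫_ℝ := hs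
      -- Orthogonality of U to W gives ω(Px, y - Py) = 0, and with the sign of ω also ω(x - Px, Py)
      -- = 0; together they say that P is self-adjoint.
      intro x y
      have h1 := hst1 _ (hP x) _ (hP' y)
      have h2 := hst1 _ (hP y) _ (hP' x)
      have h3 := hs1 (P y) (x - P x)
      rw [h2, mul_zero, inner_sub_left, sub_eq_zero] at h3
      rw [map_sub, inner_sub_right, sub_eq_zero] at h1
      rw [h1, h3]) with h0 | h0
  · left
    rw [eq_bot_iff]
    intro u hu
    rw [Submodule.mem_bot, ← hPid u hu, h0, LinearMap.zero_apply]
  · right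
    rw [eq_bot_iff]
    intro w hw
    rw [Submodule.mem_bot, ← hP0 w hw, h0, Module.End.one_apply]

end Idempotents

/-! ### From matrices to operators on Euclidean space. -/

section Matrices

open Matrix

variable {n : ℕ}

theorem toEuclideanLin_mul (A B : Matrix (Fin n) (Fin n) ℝ) :
    (toEuclideanLin (A * B) : Module.End ℝ (EuclideanSpace ℝ (Fin n))) =
      toEuclideanLin A * toEuclideanLin B :=
  toLpLin_mul 2 2 2 A B

theorem toEuclideanLin_one :
    (toEuclideanLin (1 : Matrix (Fin n) (Fin n) ℝ) : Module.End ℝ (EuclideanSpace ℝ (Fin n))) = 1 :=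
  toLpLin_one 2

theorem inner_toEuclideanLin_left (A : Matrix (Fin n) (Fin n) ℝ) (x y : EuclideanSpace ℝ (Fin n)) :
    ⟪toEuclideanLin A x, y⟫_ℝ = ⟪x, toEuclideanLin Aᵀ y⟫_ℝ := by
  have := toEuclideanLin_conjTranspose_eq_adjoint A
  rw [conjTranspose_eq_transpose_of_trivial] at this
  rw [this, LinearMap.adjoint_inner_right]

theorem isSemisimple_of_mul_self {D : Matrix (Fin n) (Fin n) ℝ} (h : D * D = 1 ∨ D * D = -1) :
    Module.End.IsSemisimple (toEuclideanLin D : Module.End ℝ (EuclideanSpace ℝ (Fin n))) := by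
  open Polynomial in
  have key : ∀ c : ℝ, c ≠ 0 → D * D = c • (1 : Matrix (Fin n) (Fin n) ℝ) →
      Module.End.IsSemisimple
        (toEuclideanLin D : Module.End ℝ (EuclideanSpace ℝ (Fin n))) := by
    intro c hc hD
    have hsep : (X ^ 2 - C c : ℝ[X]).Separable :=
      separable_X_pow_sub_C c (by norm_num) hc
    refine Module.End.isSemisimple_of_squarefree_aeval_eq_zero hsep.squarefree ?_
    rw [map_sub, map_pow, aeval_X, aeval_C, pow_two, ← toEuclideanLin_mul, hD, map_smul,
      toEuclideanLin_one, Algebra.algebraMap_eq_smul_one, sub_self]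
  rcases h with h | h
  · exact key 1 one_ne_zero (by rw [h, one_smul])
  · exact key (-1) (by norm_num) (by rw [h, neg_one_smul])

/-- D and K are killed by the separable polynomials X² - 1 and X² + 1, and sums of commuting
semisimple operators over ℝ are semisimple. Every table matrix with a complex parameter has this
shape. -/
theorem isSemisimple_smul_add {D K : Matrix (Fin n) (Fin n) ℝ} (α β : ℝ) (hD : D * D = 1)
    (hK : K * K = -1) (hDK : D * K = K * D) :
    Module.End.IsSemisimple
      (toEuclideanLin (α • D + β • K) : Module.End ℝ (EuclideanSpace ℝ (Fin n))) := by
  rw [map_add, map_smul, map_smul]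
  refine Module.End.IsSemisimple.add_of_commute ?_
    (Module.End.IsSemisimple_smul α (isSemisimple_of_mul_self (Or.inl hD)))
    (Module.End.IsSemisimple_smul β (isSemisimple_of_mul_self (Or.inr hK)))
  have : Commute (toEuclideanLin D : Module.End ℝ (EuclideanSpace ℝ (Fin n)))
      (toEuclideanLin K) := by
    rw [commute_iff_eq, ← toEuclideanLin_mul, hDK, toEuclideanLin_mul]
  exact (this.smul_left α).smul_right β

/-- A pair of matrices of type `T` which is semisimple and only commutes with trivial compatible
idempotents. -/
structure MatrixPair.IsSimple (T : MapType) (F : MatrixPair) : Prop where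
  dim_pos : 0 < F.dim
  sq : F.s * F.s = 1 ∨ F.s * F.s = -1
  sign : match T.kind with
    | Kind.auto => F.s * F.s = T.eps • (1 : Matrix (Fin F.dim) (Fin F.dim) ℝ)
    | Kind.anti => F.sᵀ = T.eps • F.s
  twisted : match T.kind with
    | Kind.auto => F.s * F.S = T.mu • (F.S * F.s)
    | Kind.anti => F.Sᵀ * F.s = T.mu • (F.s * F.S)
  semisimple : F.SMap.IsSemisimple
  idempotent : ∀ P : Matrix (Fin F.dim) (Fin F.dim) ℝ, P * P = P → P * F.S = F.S * P →
    (match T.kind with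
      | Kind.auto => P * F.s = F.s * P
      | Kind.anti => Pᵀ * F.s = F.s * P) → P = 0 ∨ P = 1

theorem MatrixPair.IsSimple.isIndecomposablePair {T : MapType} {F : MatrixPair}
    (h : F.IsSimple T) :
    ∃ s₀ : EuclideanSpace ℝ (Fin F.dim) ≃ₗ[ℝ] EuclideanSpace ℝ (Fin F.dim),
      s₀.toLinearMap = F.sMap ∧ IsIndecomposablePair T F.SMap s₀ := by
  obtain ⟨δ, hδ, hsq⟩ : ∃ δ : ℝ, δ * δ = 1 ∧
      F.s * F.s = δ • (1 : Matrix (Fin F.dim) (Fin F.dim) ℝ) := by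
    rcases h.sq with h1 | h1
    · exact ⟨1, by norm_num, by rw [h1, one_smul]⟩
    · exact ⟨-1, by norm_num, by rw [h1, neg_one_smul]⟩
  have hss : F.sMap * F.sMap = δ • 1 := by
    rw [MatrixPair.sMap, ← toEuclideanLin_mul, hsq, map_smul, toEuclideanLin_one]
  have hinv : ∀ x, F.sMap (F.sMap x) = δ • x := fun x => LinearMap.congr_fun hss x
  let s₀ : EuclideanSpace ℝ (Fin F.dim) ≃ₗ[ℝ] EuclideanSpace ℝ (Fin F.dim) :=
    -- From s² = δ and δ² = 1 the inverse is δ s.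
    LinearEquiv.ofLinearMap F.sMap (δ • F.sMap)
      (LinearMap.ext fun x => by simp [hinv, smul_smul, hδ])
      (LinearMap.ext fun x => by simp [hinv, smul_smul, hδ])
  have hs₀ : ∀ x, s₀ x = F.sMap x := fun x => rfl
  have hne : Nonempty (Fin F.dim) := ⟨⟨0, h.dim_pos⟩⟩
  refine ⟨s₀, rfl, ?_⟩
  have hT : Twisted T.kind T.mu s₀ F.SMap := by
    have := h.twisted
    cases hk : T.kind <;> simp only [hk] at this
    · intro x
      rw [hs₀, hs₀]
      have h1 := congrArg (fun A => toEuclideanLin A x) this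
      simp only [toEuclideanLin_mul, map_smul] at h1
      exact h1
    · intro x y
      rw [hs₀, hs₀]
      have h1 := congrArg (fun A => toEuclideanLin A y) this
      simp only [toEuclideanLin_mul, map_smul] at h1
      change ⟪toEuclideanLin F.S x, _⟫_ℝ = _
      rw [inner_toEuclideanLin_left, ← inner_smul_right]
      exact congrArg (fun z => ⟪x, z⟫_ℝ) h1
  have hS : HasSign T.kind T.eps s₀ := by
    have := h.sign
    cases hk : T.kind <;> simp only [hk] at this
    · intro x
      have h1 := congrArg (fun A => toEuclideanLin A x) this
      simp only [toEuclideanLin_mul, map_smul, toEuclideanLin_one] at h1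
      exact h1
    · intro x y
      rw [hs₀, hs₀, real_inner_comm]
      change ⟪toEuclideanLin F.s x, _⟫_ℝ = _
      rw [inner_toEuclideanLin_left, this, map_smul, LinearMap.smul_apply, inner_smul_right]
      rfl
  refine isIndecomposablePair_iff.2 ⟨hS, hT,
    indecomposable_of_idempotents hS fun P hPP hPL hPs => ?_⟩
  obtain ⟨M, rfl⟩ := (toEuclideanLin (𝕜 := ℝ)).surjective P
  have hinj : ∀ {A B : Matrix (Fin F.dim) (Fin F.dim) ℝ},
      (toEuclideanLin A : Module.End ℝ (EuclideanSpace ℝ (Fin F.dim))) = toEuclideanLin B → A = B :=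
    fun hAB => (toEuclideanLin (𝕜 := ℝ)).injective hAB
  refine (h.idempotent M (hinj ?_) (hinj ?_) ?_).imp ?_ ?_
  · rw [toEuclideanLin_mul]
    exact hPP
  · rw [toEuclideanLin_mul, toEuclideanLin_mul]
    exact hPL
  · unfold Preserves at hPs
    cases hk : T.kind <;> simp only [hk] at hPs
    · refine hinj (LinearMap.ext fun x => ?_)
      rw [toEuclideanLin_mul, toEuclideanLin_mul]
      exact hPs x
    · refine hinj (LinearMap.ext fun x => ext_inner_left ℝ fun v => ?_)
      rw [toEuclideanLin_mul, toEuclideanLin_mul, Module.End.mul_apply, Module.End.mul_apply,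
        ← inner_toEuclideanLin_left]
      exact hPs v x
  · rintro rfl
    rw [map_zero]
  · rintro rfl
    rw [toEuclideanLin_one]

end Matrices

/-! ### Compatible idempotents of the listed matrices. -/

section IdempotentMatrices

open Matrix

theorem forall_fin_four {p : Fin 4 → Prop} : (∀ i, p i) ↔ p 0 ∧ p 1 ∧ p 2 ∧ p 3 := by
  constructor
  · exact fun h => ⟨h 0, h 1, h 2, h 3⟩
  · rintro ⟨h0, h1, h2, h3⟩ i
    fin_cases i <;> assumption

/-- The equations say that a + bi is an idempotent of the field ℂ. -/
theorem eq_zero_or_one_of_complex {a b : ℝ} (h1 : a * a - b * b = a) (h2 : 2 * (a * b) = b) :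
    b = 0 ∧ (a = 0 ∨ a = 1) := by
  have h3 : b = 0 := by
    by_contra hb
    have : a = 1 / 2 := mul_right_cancel₀ hb (by linarith)
    subst this
    nlinarith [sq_nonneg b]
  subst h3
  refine ⟨rfl, ?_⟩
  have : a * (a - 1) = 0 := by linarith
  exact (mul_eq_zero.1 this).imp id fun h => by linarith

/-- The equations say that a + xi + yj + zk is an idempotent of the division algebra ℍ. -/
theorem eq_zero_or_one_of_quaternion {a x y z : ℝ} (h : a * a - x * x - y * y - z * z = a)
    (hx : (2 * a - 1) * x = 0) (hy : (2 * a - 1) * y = 0) (hz : (2 * a - 1) * z = 0) :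
    x = 0 ∧ y = 0 ∧ z = 0 ∧ (a = 0 ∨ a = 1) := by
  have h0 : 2 * a - 1 ≠ 0 := fun h0 => by
    obtain rfl : a = 1 / 2 := by linarith
    nlinarith [sq_nonneg x, sq_nonneg y, sq_nonneg z]
  obtain rfl := (mul_eq_zero.1 hx).resolve_left h0
  obtain rfl := (mul_eq_zero.1 hy).resolve_left h0
  obtain rfl := (mul_eq_zero.1 hz).resolve_left h0
  have : a * (a - 1) = 0 := by linarith
  exact ⟨rfl, rfl, rfl, (mul_eq_zero.1 this).imp id fun h => by linarith⟩

theorem matrix_two_eq_zero_or_one {P : Matrix (Fin 2) (Fin 2) ℝ}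
    (h : P 1 1 = P 0 0 ∧ P 0 1 = 0 ∧ P 1 0 = 0) (h' : P 0 0 = 0 ∨ P 0 0 = 1) : P = 0 ∨ P = 1 := by
  obtain ⟨h1, h2, h3⟩ := h
  refine h'.imp (fun h0 => ?_) fun h0 => ?_ <;> ext i j <;> fin_cases i <;> fin_cases j <;>
    simp [h0, h1, h2, h3]

theorem matrix_four_eq_zero_or_one {P : Matrix (Fin 4) (Fin 4) ℝ}
    (h : (P 1 1 = P 0 0 ∧ P 2 2 = P 0 0 ∧ P 3 3 = P 0 0) ∧
      (P 0 1 = 0 ∧ P 0 2 = 0 ∧ P 0 3 = 0) ∧ (P 1 0 = 0 ∧ P 1 2 = 0 ∧ P 1 3 = 0) ∧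
      (P 2 0 = 0 ∧ P 2 1 = 0 ∧ P 2 3 = 0) ∧ (P 3 0 = 0 ∧ P 3 1 = 0 ∧ P 3 2 = 0))
    (h' : P 0 0 = 0 ∨ P 0 0 = 1) : P = 0 ∨ P = 1 := by
  obtain ⟨⟨a1, a2, a3⟩, ⟨b1, b2, b3⟩, ⟨c1, c2, c3⟩, ⟨d1, d2, d3⟩, e1, e2, e3⟩ := h
  refine h'.imp (fun h0 => ?_) fun h0 => ?_ <;> ext i j <;> fin_cases i <;> fin_cases j <;>
    simp [*]

theorem idempotent_fin_one {P : Matrix (Fin 1) (Fin 1) ℝ} (h : P * P = P) : P = 0 ∨ P = 1 := by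
  have h0 := congrFun (congrFun h 0) 0
  simp only [Matrix.mul_apply, Fin.sum_univ_one] at h0
  have h1 : P 0 0 * (P 0 0 - 1) = 0 := by linarith
  refine (mul_eq_zero.1 h1).imp (fun h => ?_) fun h => ?_ <;> ext i j <;> fin_cases i <;>
    fin_cases j
  · exact h
  · simpa using sub_eq_zero.1 h

/-- For β ≠ 0 the commutant of C is a copy of ℂ. With α = 0 and β = 1 this also serves the structure
map J. -/
theorem idempotent_rotation {α β : ℝ} (hβ : β ≠ 0) {P : Matrix (Fin 2) (Fin 2) ℝ}
    (hP : P * P = P) (h : P * !![α, -β; β, α] = !![α, -β; β, α] * P) : P = 0 ∨ P = 1 := by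
  simp only [← Matrix.ext_iff, Fin.forall_fin_two, Matrix.mul_apply, Fin.sum_univ_two,
    Matrix.of_apply, Matrix.cons_val', Matrix.cons_val] at h hP
  have b1 : P 1 1 = P 0 0 := by grind
  have b2 : P 1 0 = -P 0 1 := by grind
  obtain ⟨b3, b4⟩ := eq_zero_or_one_of_complex (a := P 0 0) (b := P 0 1) (by grind) (by grind)
  exact matrix_two_eq_zero_or_one (by grind) b4

theorem idempotent_real_T_auto {α : ℝ} (hα : α ≠ 0) {P : Matrix (Fin 2) (Fin 2) ℝ}
    (hP : P * P = P) (h : P * !![α, 0; 0, -α] = !![α, 0; 0, -α] * P)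
    (h' : P * matT = matT * P) : P = 0 ∨ P = 1 := by
  simp only [← Matrix.ext_iff, Fin.forall_fin_two, Matrix.mul_apply, Fin.sum_univ_two,
    Matrix.of_apply, Matrix.cons_val', Matrix.cons_val, matT] at h h' hP
  have b3 : P 0 1 = 0 := by grind
  have b4 : P 1 0 = 0 := by grind
  obtain ⟨-, b5⟩ := eq_zero_or_one_of_complex (a := P 0 0) (b := 0) (by grind) (by grind)
  exact matrix_two_eq_zero_or_one (by grind) b5

theorem idempotent_real_T_anti {α : ℝ} (hα : α ≠ 0) {P : Matrix (Fin 2) (Fin 2) ℝ}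
    (hP : P * P = P) (h : P * !![α, 0; 0, -α] = !![α, 0; 0, -α] * P)
    (h' : Pᵀ * matT = matT * P) : P = 0 ∨ P = 1 := by
  simp only [← Matrix.ext_iff, Fin.forall_fin_two, Matrix.mul_apply, Fin.sum_univ_two,
    Matrix.of_apply, Matrix.cons_val', Matrix.cons_val, matT, Matrix.transpose_apply] at h h' hP
  have b3 : P 0 1 = 0 := by grind
  have b4 : P 1 0 = 0 := by grind
  obtain ⟨-, b5⟩ := eq_zero_or_one_of_complex (a := P 0 0) (b := 0) (by grind) (by grind)
  exact matrix_two_eq_zero_or_one (by grind) b5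

/-- The adjoint for the area form of the plane is the adjugate, so self-adjoint matrices are scalar
and S plays no role. -/
theorem idempotent_J_anti {P : Matrix (Fin 2) (Fin 2) ℝ} (hP : P * P = P)
    (h' : Pᵀ * matJ = matJ * P) : P = 0 ∨ P = 1 := by
  simp only [← Matrix.ext_iff, Fin.forall_fin_two, Matrix.mul_apply, Fin.sum_univ_two,
    Matrix.of_apply, Matrix.cons_val', Matrix.cons_val, matJ, Matrix.transpose_apply] at h' hP
  have b3 : P 0 1 = 0 := by grind
  have b4 : P 1 0 = 0 := by grind
  obtain ⟨-, b5⟩ := eq_zero_or_one_of_complex (a := P 0 0) (b := 0) (by grind) (by grind)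
  exact matrix_two_eq_zero_or_one (by grind) b5

/-- For α ≠ 0 the blocks C and -C have disjoint spectra, so P is block diagonal; the structure map
makes its two blocks equal, and each is a complex number. -/
theorem idempotent_T4_auto {α β : ℝ} (hα : α ≠ 0) (hβ : β ≠ 0) {P : Matrix (Fin 4) (Fin 4) ℝ}
    (hP : P * P = P)
    (h : P * !![α, -β, 0, 0; β, α, 0, 0; 0, 0, -α, β; 0, 0, -β, -α] =
      !![α, -β, 0, 0; β, α, 0, 0; 0, 0, -α, β; 0, 0, -β, -α] * P)
    (h' : P * matT4 = matT4 * P) : P = 0 ∨ P = 1 := by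
  simp only [← Matrix.ext_iff, forall_fin_four, Matrix.mul_apply, Fin.sum_univ_four,
    Matrix.of_apply, Matrix.cons_val', Matrix.cons_val, matT4, mul_zero, zero_mul, add_zero,
    zero_add, mul_one, one_mul] at h h' hP
  have a1 : P 0 2 = P 1 3 := by grind
  have a2 : P 0 3 = -P 1 2 := by grind
  have a3 : (α ^ 2 + β ^ 2) * P 0 2 = 0 := by grind
  have a4 : α ^ 2 + β ^ 2 ≠ 0 := by positivity
  have a5 : P 0 2 = 0 := by grind
  have a6 : P 0 3 = 0 := by grind
  have b1 : P 0 0 = P 1 1 := by grind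
  have b2 : P 0 1 = -P 1 0 := by grind
  obtain ⟨b3, b4⟩ := eq_zero_or_one_of_complex (a := P 0 0) (b := P 0 1) (by grind) (by grind)
  exact matrix_four_eq_zero_or_one (by grind) b4

-- The case α = 0 is included. There S and s generate a copy of ℍ whose commutant is again ℍ, so
-- off-diagonal blocks survive commutation and only idempotency in a division algebra removes them.
set_option maxHeartbeats 1000000 in
theorem idempotent_J4_auto {α β : ℝ} (hβ : β ≠ 0) {P : Matrix (Fin 4) (Fin 4) ℝ}
    (hP : P * P = P)
    (h : P * !![α, -β, 0, 0; β, α, 0, 0; 0, 0, -α, β; 0, 0, -β, -α] =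
      !![α, -β, 0, 0; β, α, 0, 0; 0, 0, -α, β; 0, 0, -β, -α] * P)
    (h' : P * matJ4 = matJ4 * P) : P = 0 ∨ P = 1 := by
  simp only [← Matrix.ext_iff, forall_fin_four, Matrix.mul_apply, Fin.sum_univ_four,
    Matrix.of_apply, Matrix.cons_val', Matrix.cons_val, matJ4, mul_zero, zero_mul, add_zero,
    zero_add, mul_one, one_mul] at h h' hP
  have b1 : P 1 1 = P 0 0 := by grind
  have b2 : P 1 0 = -P 0 1 := by grind
  have b3 : P 2 2 = P 0 0 ∧ P 3 3 = P 0 0 ∧ P 2 3 = P 0 1 ∧ P 3 2 = -P 0 1 := by grind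
  have b4 : P 2 0 = -P 0 2 ∧ P 2 1 = -P 0 3 ∧ P 3 0 = -P 1 2 ∧ P 3 1 = -P 1 3 := by grind
  have a1 : (α ^ 2 + β ^ 2) * (P 0 2 + P 1 3) = 0 := by grind
  have a2 : (α ^ 2 + β ^ 2) * (P 0 3 - P 1 2) = 0 := by grind
  have a4 : α ^ 2 + β ^ 2 ≠ 0 := by positivity
  have a5 : P 1 3 = -P 0 2 := by grind
  have a6 : P 1 2 = P 0 3 := by grind
  have e1 : P 0 0 * P 0 0 - P 0 1 * P 0 1 - P 0 2 * P 0 2 - P 0 3 * P 0 3 = P 0 0 := by grind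
  have e2 : (2 * P 0 0 - 1) * P 0 1 = 0 := by grind
  have e3 : (2 * P 0 0 - 1) * P 0 2 = 0 := by grind
  have e4 : (2 * P 0 0 - 1) * P 0 3 = 0 := by grind
  obtain ⟨f2, f3, f4, b5⟩ := eq_zero_or_one_of_quaternion e1 e2 e3 e4
  exact matrix_four_eq_zero_or_one (by grind) b5

theorem idempotent_T4_anti {α β : ℝ} (hα : α ≠ 0) (hβ : β ≠ 0) {P : Matrix (Fin 4) (Fin 4) ℝ}
    (hP : P * P = P)
    (h : P * !![α, -β, 0, 0; β, α, 0, 0; 0, 0, -α, -β; 0, 0, β, -α] =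
      !![α, -β, 0, 0; β, α, 0, 0; 0, 0, -α, -β; 0, 0, β, -α] * P)
    (h' : Pᵀ * matT4 = matT4 * P) : P = 0 ∨ P = 1 := by
  simp only [← Matrix.ext_iff, forall_fin_four, Matrix.mul_apply, Fin.sum_univ_four,
    Matrix.of_apply, Matrix.cons_val', Matrix.cons_val, matT4, mul_zero, zero_mul, add_zero,
    zero_add, mul_one, one_mul, Matrix.transpose_apply] at h h' hP
  have a4 : α ^ 2 + β ^ 2 ≠ 0 := by positivity
  have a1 : P 0 2 = -P 1 3 ∧ P 2 0 = -P 3 1 := by grind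
  have a2 : P 0 3 = P 1 2 ∧ P 2 1 = P 3 0 := by grind
  have a3 : (α ^ 2 + β ^ 2) * P 0 2 = 0 := by grind
  have a3' : (α ^ 2 + β ^ 2) * P 2 0 = 0 := by grind
  have a5 : P 0 2 = 0 ∧ P 2 0 = 0 := by grind
  have a6 : P 0 3 = 0 ∧ P 2 1 = 0 := by grind
  have b1 : P 0 0 = P 1 1 := by grind
  have b2 : P 0 1 = -P 1 0 := by grind
  obtain ⟨b3, b4⟩ := eq_zero_or_one_of_complex (a := P 0 0) (b := P 0 1) (by grind) (by grind)
  exact matrix_four_eq_zero_or_one (by grind) b4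

theorem idempotent_J4_anti {α β : ℝ} (hα : α ≠ 0) (hβ : β ≠ 0) {P : Matrix (Fin 4) (Fin 4) ℝ}
    (hP : P * P = P)
    (h : P * !![α, -β, 0, 0; β, α, 0, 0; 0, 0, -α, -β; 0, 0, β, -α] =
      !![α, -β, 0, 0; β, α, 0, 0; 0, 0, -α, -β; 0, 0, β, -α] * P)
    (h' : Pᵀ * matJ4 = matJ4 * P) : P = 0 ∨ P = 1 := by
  simp only [← Matrix.ext_iff, forall_fin_four, Matrix.mul_apply, Fin.sum_univ_four,
    Matrix.of_apply, Matrix.cons_val', Matrix.cons_val, matJ4, mul_zero, zero_mul, add_zero,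
    zero_add, mul_one, one_mul, Matrix.transpose_apply] at h h' hP
  have a4 : α ^ 2 + β ^ 2 ≠ 0 := by positivity
  have a1 : P 0 2 = -P 1 3 ∧ P 2 0 = -P 3 1 := by grind
  have a2 : P 0 3 = P 1 2 ∧ P 2 1 = P 3 0 := by grind
  have a3 : (α ^ 2 + β ^ 2) * P 0 2 = 0 := by grind
  have a3' : (α ^ 2 + β ^ 2) * P 2 0 = 0 := by grind
  have a5 : P 0 2 = 0 ∧ P 2 0 = 0 := by grind
  have a6 : P 0 3 = 0 ∧ P 2 1 = 0 := by grind
  have b1 : P 0 0 = P 1 1 := by grind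
  have b2 : P 0 1 = -P 1 0 := by grind
  obtain ⟨b3, b4⟩ := eq_zero_or_one_of_complex (a := P 0 0) (b := P 0 1) (by grind) (by grind)
  exact matrix_four_eq_zero_or_one (by grind) b4

/-- C and its transpose have equal spectra, so commuting with S is not enough to make P block
diagonal. It makes the off-diagonal blocks symmetric and traceless, while self-adjointness makes
them skew, so they vanish. -/
theorem idempotent_antiSymplectic {α β : ℝ} (hβ : β ≠ 0) {P : Matrix (Fin 4) (Fin 4) ℝ}
    (hP : P * P = P)
    (h : P * !![α, -β, 0, 0; β, α, 0, 0; 0, 0, α, β; 0, 0, -β, α] =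
      !![α, -β, 0, 0; β, α, 0, 0; 0, 0, α, β; 0, 0, -β, α] * P)
    (h' : Pᵀ * matJ4 = matJ4 * P) : P = 0 ∨ P = 1 := by
  simp only [← Matrix.ext_iff, forall_fin_four, Matrix.mul_apply, Fin.sum_univ_four,
    Matrix.of_apply, Matrix.cons_val', Matrix.cons_val, matJ4, mul_zero, zero_mul, add_zero,
    zero_add, mul_one, one_mul, Matrix.transpose_apply] at h h' hP
  have a1 : P 0 2 = -P 1 3 ∧ P 2 0 = -P 3 1 := by grind
  have a2 : P 0 3 = P 1 2 ∧ P 2 1 = P 3 0 := by grind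
  have a5 : P 0 2 = 0 ∧ P 2 0 = 0 := by grind
  have a6 : P 0 3 = 0 ∧ P 2 1 = 0 := by grind
  have b1 : P 0 0 = P 1 1 := by grind
  have b2 : P 0 1 = -P 1 0 := by grind
  obtain ⟨b3, b4⟩ := eq_zero_or_one_of_complex (a := P 0 0) (b := P 0 1) (by grind) (by grind)
  exact matrix_four_eq_zero_or_one (by grind) b4

end IdempotentMatrices

/-! ### The listed pairs are semisimple and indecomposable. -/

section ListedPairs

open Matrix

variable {T : MapType} {n : ℕ} {s S : Matrix (Fin n) (Fin n) ℝ}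

theorem MatrixPair.isSimple_of_auto (hk : T.kind = Kind.auto) (hn : 0 < n)
    (hsq : s * s = T.eps • (1 : Matrix (Fin n) (Fin n) ℝ)) (htw : s * S = T.mu • (S * s))
    (hss : Module.End.IsSemisimple (toEuclideanLin S : Module.End ℝ (EuclideanSpace ℝ (Fin n))))
    (hid : ∀ P : Matrix (Fin n) (Fin n) ℝ, P * P = P → P * S = S * P → P * s = s * P →
      P = 0 ∨ P = 1) : MatrixPair.IsSimple T ⟨n, s, S⟩ where
  dim_pos := hn
  sq := by
    rcases mul_self_eq_one_iff.1 T.eps_mul_eps with h | h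
    · left
      rw [hsq, h, one_smul]
    · right
      rw [hsq, h, neg_one_smul]
  sign := by
    rw [hk]
    exact hsq
  twisted := by
    rw [hk]
    exact htw
  semisimple := hss
  idempotent P h1 h2 h3 := by
    rw [hk] at h3
    exact hid P h1 h2 h3

theorem MatrixPair.isSimple_of_anti (hk : T.kind = Kind.anti) (hn : 0 < n)
    (hsq : s * s = 1 ∨ s * s = -1)
    (hsign : sᵀ = T.eps • s) (htw : Sᵀ * s = T.mu • (s * S))
    (hss : Module.End.IsSemisimple (toEuclideanLin S : Module.End ℝ (EuclideanSpace ℝ (Fin n))))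
    (hid : ∀ P : Matrix (Fin n) (Fin n) ℝ, P * P = P → P * S = S * P → Pᵀ * s = s * P →
      P = 0 ∨ P = 1) : MatrixPair.IsSimple T ⟨n, s, S⟩ where
  dim_pos := hn
  sq := hsq
  sign := by
    rw [hk]
    exact hsign
  twisted := by
    rw [hk]
    exact htw
  semisimple := hss
  idempotent P h1 h2 h3 := by
    rw [hk] at h3
    exact hid P h1 h2 h3

theorem isSemisimple_fin_one (α : ℝ) :
    Module.End.IsSemisimple
      (toEuclideanLin !![α] : Module.End ℝ (EuclideanSpace ℝ (Fin 1))) := by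
  have : !![α] = α • (1 : Matrix (Fin 1) (Fin 1) ℝ) := by
    ext i j; fin_cases i; fin_cases j; simp
  rw [this, map_smul]
  exact Module.End.IsSemisimple_smul α (isSemisimple_of_mul_self (Or.inl (one_mul 1)))

theorem isSemisimple_rotation (α β : ℝ) :
    Module.End.IsSemisimple
      (toEuclideanLin !![α, -β; β, α] : Module.End ℝ (EuclideanSpace ℝ (Fin 2))) := by
  have : !![α, -β; β, α] = α • (1 : Matrix (Fin 2) (Fin 2) ℝ) + β • matJ := by
    ext i j; fin_cases i <;> fin_cases j <;> simp [matJ]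
  rw [this]
  refine isSemisimple_smul_add α β (one_mul 1) ?_ (by simp)
  ext i j; fin_cases i <;> fin_cases j <;> simp [matJ]

theorem isSemisimple_scalar (α : ℝ) :
    Module.End.IsSemisimple
      (toEuclideanLin !![α, 0; 0, α] : Module.End ℝ (EuclideanSpace ℝ (Fin 2))) := by
  simpa using isSemisimple_rotation α 0

theorem isSemisimple_smul_R (α : ℝ) :
    Module.End.IsSemisimple
      (toEuclideanLin !![α, 0; 0, -α] : Module.End ℝ (EuclideanSpace ℝ (Fin 2))) := by
  have : !![α, 0; 0, -α] = α • matR := by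
    ext i j; fin_cases i <;> fin_cases j <;> simp [matR]
  rw [this, map_smul]
  refine Module.End.IsSemisimple_smul α (isSemisimple_of_mul_self (Or.inl ?_))
  ext i j; fin_cases i <;> fin_cases j <;> simp [matR]

theorem isSemisimple_diag_neg (α β : ℝ) :
    Module.End.IsSemisimple
      (toEuclideanLin !![α, -β, 0, 0; β, α, 0, 0; 0, 0, -α, β; 0, 0, -β, -α] :
        Module.End ℝ (EuclideanSpace ℝ (Fin 4))) := by
  have : !![α, -β, 0, 0; β, α, 0, 0; 0, 0, -α, β; 0, 0, -β, -α] =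
      α • (!![1, 0, 0, 0; 0, 1, 0, 0; 0, 0, -1, 0; 0, 0, 0, -1] : Matrix (Fin 4) (Fin 4) ℝ) +
      β • !![0, -1, 0, 0; 1, 0, 0, 0; 0, 0, 0, 1; 0, 0, -1, 0] := by
    ext i j; fin_cases i <;> fin_cases j <;> simp
  rw [this]
  refine isSemisimple_smul_add α β ?_ ?_ ?_ <;>
    ext i j <;> fin_cases i <;> fin_cases j <;> simp [Matrix.mul_apply, Fin.sum_univ_four]

theorem isSemisimple_diag_neg_transpose (α β : ℝ) :
    Module.End.IsSemisimple
      (toEuclideanLin !![α, -β, 0, 0; β, α, 0, 0; 0, 0, -α, -β; 0, 0, β, -α] :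
        Module.End ℝ (EuclideanSpace ℝ (Fin 4))) := by
  have : !![α, -β, 0, 0; β, α, 0, 0; 0, 0, -α, -β; 0, 0, β, -α] =
      α • (!![1, 0, 0, 0; 0, 1, 0, 0; 0, 0, -1, 0; 0, 0, 0, -1] : Matrix (Fin 4) (Fin 4) ℝ) +
      β • !![0, -1, 0, 0; 1, 0, 0, 0; 0, 0, 0, -1; 0, 0, 1, 0] := by
    ext i j; fin_cases i <;> fin_cases j <;> simp
  rw [this]
  refine isSemisimple_smul_add α β ?_ ?_ ?_ <;>
    ext i j <;> fin_cases i <;> fin_cases j <;> simp [Matrix.mul_apply, Fin.sum_univ_four]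

theorem isSemisimple_diag_transpose (α β : ℝ) :
    Module.End.IsSemisimple
      (toEuclideanLin !![α, -β, 0, 0; β, α, 0, 0; 0, 0, α, β; 0, 0, -β, α] :
        Module.End ℝ (EuclideanSpace ℝ (Fin 4))) := by
  have : !![α, -β, 0, 0; β, α, 0, 0; 0, 0, α, β; 0, 0, -β, α] =
      α • (1 : Matrix (Fin 4) (Fin 4) ℝ) +
      β • !![0, -1, 0, 0; 1, 0, 0, 0; 0, 0, 0, 1; 0, 0, -1, 0] := by
    ext i j; fin_cases i <;> fin_cases j <;> simp
  rw [this]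
  refine isSemisimple_smul_add α β (one_mul 1) ?_ (by rw [one_mul, mul_one])
  ext i j; fin_cases i <;> fin_cases j <;> simp [Matrix.mul_apply, Fin.sum_univ_four]

theorem matR_mul_self : matR * matR = 1 := by
  ext i j; fin_cases i <;> fin_cases j <;> simp [matR]

theorem matT_mul_self : matT * matT = 1 := by
  ext i j; fin_cases i <;> fin_cases j <;> simp [matT]

theorem matJ_mul_self : matJ * matJ = -1 := by
  ext i j; fin_cases i <;> fin_cases j <;> simp [matJ]

theorem matT4_mul_self : matT4 * matT4 = 1 := by
  ext i j; fin_cases i <;> fin_cases j <;> simp [matT4, Matrix.mul_apply, Fin.sum_univ_four]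

theorem matJ4_mul_self : matJ4 * matJ4 = -1 := by
  ext i j; fin_cases i <;> fin_cases j <;> simp [matJ4, Matrix.mul_apply, Fin.sum_univ_four]

theorem matJ_transpose : matJᵀ = -matJ := by
  ext i j; fin_cases i <;> fin_cases j <;> simp [matJ]

theorem matT4_transpose : matT4ᵀ = matT4 := by
  ext i j; fin_cases i <;> fin_cases j <;> simp [matT4]

theorem matJ4_transpose : matJ4ᵀ = -matJ4 := by
  ext i j; fin_cases i <;> fin_cases j <;> simp [matJ4]

theorem sign_mul_self {σ : ℝ} (h : σ = 1 ∨ σ = -1) : σ * σ = 1 := mul_self_eq_one_iff.2 h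

theorem sign_smul_matJ_mul_self {σ : ℝ} (h : σ = 1 ∨ σ = -1) :
    (σ • matJ) * (σ • matJ) = -1 := by
  rw [smul_mul_smul_comm, sign_mul_self h, matJ_mul_self, one_smul]

theorem Listed.isSimple {T : MapType} {F : MatrixPair} (h : Listed T F) : F.IsSimple T := by
  cases h with
  | equivariantR_real σ α hσ =>
    refine MatrixPair.isSimple_of_auto rfl one_pos ?_ ?_ (isSemisimple_fin_one α)
      fun P h1 _ _ => idempotent_fin_one h1
    · ext i j; fin_cases i; fin_cases j; simp [MapType.eps, sign_mul_self hσ]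
    · ext i j; fin_cases i; fin_cases j; simp [MapType.mu, mul_comm]
  | equivariantR_complex σ α β hσ hβ =>
    refine MatrixPair.isSimple_of_auto rfl two_pos ?_ ?_ (isSemisimple_rotation α β)
      fun P h1 h2 _ => idempotent_rotation hβ.ne' h1 h2
    · ext i j; fin_cases i <;> fin_cases j <;> simp [MapType.eps, sign_mul_self hσ]
    · ext i j; fin_cases i <;> fin_cases j <;> simp [MapType.mu, mul_comm]
  | reversibleR_zero σ hσ =>
    refine MatrixPair.isSimple_of_auto rfl one_pos ?_ ?_ (isSemisimple_fin_one 0)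
      fun P h1 _ _ => idempotent_fin_one h1
    · ext i j; fin_cases i; fin_cases j; simp [MapType.eps, sign_mul_self hσ]
    · ext i j; fin_cases i; fin_cases j; simp
  | reversibleR_real α hα =>
    refine MatrixPair.isSimple_of_auto rfl two_pos ?_ ?_ (isSemisimple_smul_R α)
      fun P h1 h2 h3 => idempotent_real_T_auto hα.ne' h1 h2 h3
    · simp [matT_mul_self, MapType.eps]
    · ext i j; fin_cases i <;> fin_cases j <;> simp [matT, MapType.mu]
  | reversibleR_imaginary β hβ =>
    refine MatrixPair.isSimple_of_auto rfl two_pos ?_ ?_ (isSemisimple_rotation 0 β)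
      fun P h1 h2 _ => idempotent_rotation hβ.ne' h1 h2
    · simp [matR_mul_self, MapType.eps]
    · ext i j; fin_cases i <;> fin_cases j <;> simp [matR, MapType.mu]
  | reversibleR_complex α β hα hβ =>
    refine MatrixPair.isSimple_of_auto rfl four_pos ?_ ?_ (isSemisimple_diag_neg α β)
      fun P h1 h2 h3 => idempotent_T4_auto hα.ne' hβ.ne' h1 h2 h3
    · simp [matT4_mul_self, MapType.eps]
    · ext i j
      fin_cases i <;> fin_cases j <;>
        simp [matT4, MapType.mu, Matrix.mul_apply, Fin.sum_univ_four]
  | equivariantC_real α =>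
    refine MatrixPair.isSimple_of_auto rfl two_pos ?_ ?_ (isSemisimple_scalar α)
      fun P h1 _ h3 => idempotent_rotation (α := 0) one_ne_zero h1 h3
    · simp [matJ_mul_self, MapType.eps]
    · ext i j; fin_cases i <;> fin_cases j <;> simp [matJ, MapType.mu]
  | equivariantC_complex σ α β hσ hβ =>
    refine MatrixPair.isSimple_of_auto rfl two_pos ?_ ?_ (isSemisimple_rotation α β)
      fun P h1 h2 _ => idempotent_rotation hβ.ne' h1 h2
    · rw [sign_smul_matJ_mul_self hσ]
      simp [MapType.eps]
    · ext i j; fin_cases i <;> fin_cases j <;> simp [matJ, MapType.mu, mul_comm]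
  | reversibleC_real α hα =>
    refine MatrixPair.isSimple_of_auto rfl two_pos ?_ ?_ (isSemisimple_smul_R α)
      fun P h1 _ h3 => idempotent_rotation (α := 0) one_ne_zero h1 h3
    · simp [matJ_mul_self, MapType.eps]
    · ext i j; fin_cases i <;> fin_cases j <;> simp [matJ, MapType.mu]
  | reversibleC_complex α β hα hβ =>
    refine MatrixPair.isSimple_of_auto rfl four_pos ?_ ?_ (isSemisimple_diag_neg α β)
      fun P h1 h2 h3 => idempotent_J4_auto hβ.ne' h1 h2 h3
    · simp [matJ4_mul_self, MapType.eps]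
    · ext i j
      fin_cases i <;> fin_cases j <;>
        simp [matJ4, MapType.mu, Matrix.mul_apply, Fin.sum_univ_four]
  | symmetric_real σ α hσ =>
    refine MatrixPair.isSimple_of_anti rfl one_pos (Or.inl ?_) ?_ ?_ (isSemisimple_fin_one α)
      fun P h1 _ _ => idempotent_fin_one h1
    · ext i j; fin_cases i; fin_cases j; simp [sign_mul_self hσ]
    · ext i j; fin_cases i; fin_cases j; simp [MapType.eps]
    · ext i j; fin_cases i; fin_cases j; simp [Matrix.mul_apply, MapType.mu, mul_comm]
  | symmetric_complex α β hβ =>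
    refine MatrixPair.isSimple_of_anti rfl two_pos (Or.inl matR_mul_self) ?_ ?_
      (isSemisimple_rotation α β) fun P h1 h2 _ => idempotent_rotation hβ.ne' h1 h2
    · ext i j; fin_cases i <;> fin_cases j <;> simp [matR, MapType.eps]
    · ext i j; fin_cases i <;> fin_cases j <;>
        simp [Matrix.mul_apply, matR, MapType.mu]
  | antiSymmetric_zero σ hσ =>
    refine MatrixPair.isSimple_of_anti rfl one_pos (Or.inl ?_) ?_ ?_ (isSemisimple_fin_one 0)
      fun P h1 _ _ => idempotent_fin_one h1
    · ext i j; fin_cases i; fin_cases j; simp [sign_mul_self hσ]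
    · ext i j; fin_cases i; fin_cases j; simp [MapType.eps]
    · ext i j; fin_cases i; fin_cases j; simp [Matrix.mul_apply, MapType.mu, mul_comm]
  | antiSymmetric_real α hα =>
    refine MatrixPair.isSimple_of_anti rfl two_pos (Or.inl matT_mul_self) ?_ ?_
      (isSemisimple_smul_R α) fun P h1 h2 h3 => idempotent_real_T_anti hα.ne' h1 h2 h3
    · ext i j; fin_cases i <;> fin_cases j <;> simp [matT, MapType.eps]
    · ext i j; fin_cases i <;> fin_cases j <;>
        simp [Matrix.mul_apply, matT, MapType.mu]
  | antiSymmetric_imaginary σ β hσ hβ =>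
    refine MatrixPair.isSimple_of_anti rfl two_pos (Or.inl ?_) ?_ ?_
      (isSemisimple_rotation 0 β) fun P h1 h2 _ => idempotent_rotation hβ.ne' h1 h2
    · ext i j; fin_cases i <;> fin_cases j <;> simp [sign_mul_self hσ]
    · ext i j; fin_cases i <;> fin_cases j <;> simp [MapType.eps]
    · ext i j; fin_cases i <;> fin_cases j <;>
        simp [Matrix.mul_apply, MapType.mu, mul_comm]
  | antiSymmetric_complex α β hα hβ =>
    refine MatrixPair.isSimple_of_anti rfl four_pos (Or.inl matT4_mul_self) ?_ ?_
      (isSemisimple_diag_neg_transpose α β)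
      fun P h1 h2 h3 => idempotent_T4_anti hα.ne' hβ.ne' h1 h2 h3
    · simp [matT4_transpose, MapType.eps]
    · ext i j
      fin_cases i <;> fin_cases j <;>
        simp [matT4, MapType.mu, Matrix.mul_apply, Fin.sum_univ_four]
  | antiSymplectic_real α =>
    refine MatrixPair.isSimple_of_anti rfl two_pos (Or.inr matJ_mul_self) ?_ ?_
      (isSemisimple_scalar α) fun P h1 _ h3 => idempotent_J_anti h1 h3
    · simp [matJ_transpose, MapType.eps]
    · ext i j; fin_cases i <;> fin_cases j <;>
        simp [Matrix.mul_apply, matJ, MapType.mu]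
  | antiSymplectic_complex α β hβ =>
    refine MatrixPair.isSimple_of_anti rfl four_pos (Or.inr matJ4_mul_self) ?_ ?_
      (isSemisimple_diag_transpose α β)
      fun P h1 h2 h3 => idempotent_antiSymplectic hβ.ne' h1 h2 h3
    · simp [matJ4_transpose, MapType.eps]
    · ext i j
      fin_cases i <;> fin_cases j <;>
        simp [matJ4, MapType.mu, Matrix.mul_apply, Fin.sum_univ_four]
  | symplectic_real α hα =>
    refine MatrixPair.isSimple_of_anti rfl two_pos (Or.inr matJ_mul_self) ?_ ?_
      (isSemisimple_smul_R α) fun P h1 _ h3 => idempotent_J_anti h1 h3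
    · simp [matJ_transpose, MapType.eps]
    · ext i j; fin_cases i <;> fin_cases j <;>
        simp [Matrix.mul_apply, matJ, MapType.mu]
  | symplectic_imaginary σ β hσ hβ =>
    refine MatrixPair.isSimple_of_anti rfl two_pos (Or.inr (sign_smul_matJ_mul_self hσ)) ?_ ?_
      (isSemisimple_rotation 0 β) fun P h1 h2 _ => idempotent_rotation hβ.ne' h1 h2
    · rw [transpose_smul, matJ_transpose]
      simp [MapType.eps]
    · ext i j; fin_cases i <;> fin_cases j <;>
        simp [Matrix.mul_apply, matJ, MapType.mu, mul_comm]
  | symplectic_complex α β hα hβ =>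
    refine MatrixPair.isSimple_of_anti rfl four_pos (Or.inr matJ4_mul_self) ?_ ?_
      (isSemisimple_diag_neg_transpose α β)
      fun P h1 h2 h3 => idempotent_J4_anti hα.ne' hβ.ne' h1 h2 h3
    · simp [matJ4_transpose, MapType.eps]
    · ext i j
      fin_cases i <;> fin_cases j <;>
        simp [matJ4, MapType.mu, Matrix.mul_apply, Fin.sum_univ_four]

end ListedPairs

/-! ### Invariants that separate the listed pairs. -/

section Inequivalence

open Matrix

theorem trace_toEuclideanLin {n : ℕ} (A : Matrix (Fin n) (Fin n) ℝ) :
    LinearMap.trace ℝ (EuclideanSpace ℝ (Fin n)) (toEuclideanLin A) = A.trace := by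
  rw [toEuclideanLin_eq_toLin_orthonormal, LinearMap.trace_eq_matrix_trace ℝ
    (EuclideanSpace.basisFun (Fin n) ℝ).toBasis, LinearMap.toMatrix_toLin]

theorem trace_eq_of_intertwine {n m : ℕ} {A : Matrix (Fin n) (Fin n) ℝ}
    {B : Matrix (Fin m) (Fin m) ℝ} {g : EuclideanSpace ℝ (Fin n) ≃ₗ[ℝ] EuclideanSpace ℝ (Fin m)}
    (h : ∀ x, g (toEuclideanLin A x) = toEuclideanLin B (g x)) : A.trace = B.trace := by
  have h1 : g.conj (toEuclideanLin A) = toEuclideanLin B := by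
    refine LinearMap.ext fun x => ?_
    rw [LinearEquiv.conj_apply_apply, h, LinearEquiv.apply_symm_apply]
  rw [← trace_toEuclideanLin, ← trace_toEuclideanLin, ← h1, LinearMap.trace_conj']

theorem intertwine_mul {n m : ℕ} {A A' : Matrix (Fin n) (Fin n) ℝ}
    {B B' : Matrix (Fin m) (Fin m) ℝ}
    {g : EuclideanSpace ℝ (Fin n) ≃ₗ[ℝ] EuclideanSpace ℝ (Fin m)}
    (h : ∀ x, g (toEuclideanLin A x) = toEuclideanLin B (g x))
    (h' : ∀ x, g (toEuclideanLin A' x) = toEuclideanLin B' (g x)) (x) :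
    g (toEuclideanLin (A * A') x) = toEuclideanLin (B * B') (g x) := by
  rw [toEuclideanLin_mul, toEuclideanLin_mul, Module.End.mul_apply, Module.End.mul_apply, h, h']

variable {F F' : MatrixPair}

theorem PairEquiv.dim_eq {k : Kind} (h : PairEquiv k F.SMap F.sMap F'.SMap F'.sMap) :
    F.dim = F'.dim := by
  obtain ⟨g, -⟩ := h
  simpa using g.finrank_eq

theorem PairEquiv.trace_eq {k : Kind} (h : PairEquiv k F.SMap F.sMap F'.SMap F'.sMap) :
    F.S.trace = F'.S.trace := by
  obtain ⟨g, hS, -⟩ := h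
  exact trace_eq_of_intertwine hS

theorem PairEquiv.trace_sq_eq {k : Kind} (h : PairEquiv k F.SMap F.sMap F'.SMap F'.sMap) :
    (F.S * F.S).trace = (F'.S * F'.S).trace := by
  obtain ⟨g, hS, -⟩ := h
  exact trace_eq_of_intertwine (intertwine_mul hS hS)

theorem PairEquiv.trace_fourth_eq {k : Kind} (h : PairEquiv k F.SMap F.sMap F'.SMap F'.sMap) :
    (F.S * F.S * (F.S * F.S)).trace = (F'.S * F'.S * (F'.S * F'.S)).trace := by
  obtain ⟨g, hS, -⟩ := h
  have h2 := intertwine_mul hS hS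
  exact trace_eq_of_intertwine (intertwine_mul h2 h2)

theorem PairEquiv.trace_structure_eq (h : PairEquiv Kind.auto F.SMap F.sMap F'.SMap F'.sMap) :
    F.s.trace = F'.s.trace ∧ (F.s * F.S).trace = (F'.s * F'.S).trace := by
  obtain ⟨g, hS, hs⟩ := h
  exact ⟨trace_eq_of_intertwine hs, trace_eq_of_intertwine (intertwine_mul hs hS)⟩

theorem sign_eq_of_mul_eq {σ σ' a b : ℝ} (hσ : σ = 1 ∨ σ = -1) (hσ' : σ' = 1 ∨ σ' = -1)
    (ha : 0 < a) (hb : 0 < b) (h : σ * a = σ' * b) : σ = σ' := by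
  rcases hσ with rfl | rfl <;> rcases hσ' with rfl | rfl <;> first | rfl | linarith

/-- If `s` and `s'` are definite scalars, they have the same sign. -/
theorem PairEquiv.sign_eq_of_scalar (h : PairEquiv Kind.anti F.SMap F.sMap F'.SMap F'.sMap)
    (hd : 0 < F.dim) {σ σ' : ℝ} (hσ : σ = 1 ∨ σ = -1) (hσ' : σ' = 1 ∨ σ' = -1)
    (hs : F.s = σ • (1 : Matrix (Fin F.dim) (Fin F.dim) ℝ))
    (hs' : F'.s = σ' • (1 : Matrix (Fin F'.dim) (Fin F'.dim) ℝ)) : σ = σ' := by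
  obtain ⟨g, -, hg⟩ := h
  have hne : Nonempty (Fin F.dim) := ⟨⟨0, hd⟩⟩
  obtain ⟨x, hx⟩ := exists_ne (0 : EuclideanSpace ℝ (Fin F.dim))
  have hgx : g x ≠ 0 := by simpa using hx
  have h1 : ⟪g x, F'.sMap (g x)⟫_ℝ = ⟪x, F.sMap x⟫_ℝ := hg x x
  rw [MatrixPair.sMap, MatrixPair.sMap, hs, hs', map_smul, map_smul, toEuclideanLin_one,
    toEuclideanLin_one, LinearMap.smul_apply, LinearMap.smul_apply, inner_smul_right,
    inner_smul_right] at h1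
  exact sign_eq_of_mul_eq hσ hσ' (real_inner_self_pos.2 hx) (real_inner_self_pos.2 hgx) h1.symm

/-- If `s S` and `s' S'` are definite scalars, they have the same sign. -/
theorem PairEquiv.sign_eq_of_scalar_mul (h : PairEquiv Kind.anti F.SMap F.sMap F'.SMap F'.sMap)
    (hd : 0 < F.dim) {σ σ' β β' : ℝ} (hσ : σ = 1 ∨ σ = -1) (hσ' : σ' = 1 ∨ σ' = -1)
    (hβ : 0 < β) (hβ' : 0 < β')
    (hs : F.s * F.S = -(σ * β) • (1 : Matrix (Fin F.dim) (Fin F.dim) ℝ))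
    (hs' : F'.s * F'.S = -(σ' * β') • (1 : Matrix (Fin F'.dim) (Fin F'.dim) ℝ)) : σ = σ' := by
  obtain ⟨g, hS, hg⟩ := h
  have hne : Nonempty (Fin F.dim) := ⟨⟨0, hd⟩⟩
  obtain ⟨x, hx⟩ := exists_ne (0 : EuclideanSpace ℝ (Fin F.dim))
  have hgx : g x ≠ 0 := by simpa using hx
  have h1 : ⟪g x, F'.sMap (g (F.SMap x))⟫_ℝ = ⟪x, F.sMap (F.SMap x)⟫_ℝ := hg x (F.SMap x)
  have h2 : F.sMap (F.SMap x) = -(σ * β) • x := by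
    rw [MatrixPair.sMap, MatrixPair.SMap, ← Module.End.mul_apply, ← toEuclideanLin_mul, hs,
      map_smul, toEuclideanLin_one]
    rfl
  have h3 : F'.sMap (F'.SMap (g x)) = -(σ' * β') • g x := by
    rw [MatrixPair.sMap, MatrixPair.SMap, ← Module.End.mul_apply, ← toEuclideanLin_mul, hs',
      map_smul, toEuclideanLin_one]
    rfl
  rw [hS, h2, h3, inner_smul_right, inner_smul_right] at h1
  exact sign_eq_of_mul_eq hσ hσ' (mul_pos hβ (real_inner_self_pos.2 hx))
    (mul_pos hβ' (real_inner_self_pos.2 hgx)) (by linarith)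

theorem trace_rotation_sq (α β : ℝ) :
    (!![α, -β; β, α] * !![α, -β; β, α]).trace = 2 * (α ^ 2 - β ^ 2) := by
  simp; ring

theorem trace_smul_R_sq (α : ℝ) :
    (!![α, 0; 0, -α] * !![α, 0; 0, -α]).trace = 2 * α ^ 2 := by
  simp; ring

theorem diag_neg_sq (α β : ℝ) :
    !![α, -β, 0, 0; β, α, 0, 0; 0, 0, -α, β; 0, 0, -β, -α] *
      !![α, -β, 0, 0; β, α, 0, 0; 0, 0, -α, β; 0, 0, -β, -α] =
    !![α ^ 2 - β ^ 2, -(2 * α * β), 0, 0; 2 * α * β, α ^ 2 - β ^ 2, 0, 0;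
      0, 0, α ^ 2 - β ^ 2, -(2 * α * β); 0, 0, 2 * α * β, α ^ 2 - β ^ 2] := by
  ext i j
  fin_cases i <;> fin_cases j <;> simp [Matrix.mul_apply, Fin.sum_univ_four] <;> ring

theorem diag_neg_transpose_sq (α β : ℝ) :
    !![α, -β, 0, 0; β, α, 0, 0; 0, 0, -α, -β; 0, 0, β, -α] *
      !![α, -β, 0, 0; β, α, 0, 0; 0, 0, -α, -β; 0, 0, β, -α] =
    !![α ^ 2 - β ^ 2, -(2 * α * β), 0, 0; 2 * α * β, α ^ 2 - β ^ 2, 0, 0;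
      0, 0, α ^ 2 - β ^ 2, 2 * α * β; 0, 0, -(2 * α * β), α ^ 2 - β ^ 2] := by
  ext i j
  fin_cases i <;> fin_cases j <;> simp [Matrix.mul_apply, Fin.sum_univ_four] <;> ring

theorem diag_transpose_sq (α β : ℝ) :
    !![α, -β, 0, 0; β, α, 0, 0; 0, 0, α, β; 0, 0, -β, α] *
      !![α, -β, 0, 0; β, α, 0, 0; 0, 0, α, β; 0, 0, -β, α] =
    !![α ^ 2 - β ^ 2, -(2 * α * β), 0, 0; 2 * α * β, α ^ 2 - β ^ 2, 0, 0;
      0, 0, α ^ 2 - β ^ 2, 2 * α * β; 0, 0, -(2 * α * β), α ^ 2 - β ^ 2] := by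
  ext i j
  fin_cases i <;> fin_cases j <;> simp [Matrix.mul_apply, Fin.sum_univ_four] <;> ring

theorem trace_diag_neg_sq (α β : ℝ) :
    (!![α, -β, 0, 0; β, α, 0, 0; 0, 0, -α, β; 0, 0, -β, -α] *
      !![α, -β, 0, 0; β, α, 0, 0; 0, 0, -α, β; 0, 0, -β, -α]).trace = 4 * (α ^ 2 - β ^ 2) := by
  rw [diag_neg_sq]
  simp [Matrix.trace, Fin.sum_univ_four]; ring

theorem trace_diag_neg_transpose_sq (α β : ℝ) :
    (!![α, -β, 0, 0; β, α, 0, 0; 0, 0, -α, -β; 0, 0, β, -α] *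
      !![α, -β, 0, 0; β, α, 0, 0; 0, 0, -α, -β; 0, 0, β, -α]).trace = 4 * (α ^ 2 - β ^ 2) := by
  rw [diag_neg_transpose_sq]
  simp [Matrix.trace, Fin.sum_univ_four]; ring

theorem trace_diag_transpose_sq (α β : ℝ) :
    (!![α, -β, 0, 0; β, α, 0, 0; 0, 0, α, β; 0, 0, -β, α] *
      !![α, -β, 0, 0; β, α, 0, 0; 0, 0, α, β; 0, 0, -β, α]).trace = 4 * (α ^ 2 - β ^ 2) := by
  rw [diag_transpose_sq]
  simp [Matrix.trace, Fin.sum_univ_four]; ring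

theorem trace_diag_neg_fourth (α β : ℝ) :
    (!![α, -β, 0, 0; β, α, 0, 0; 0, 0, -α, β; 0, 0, -β, -α] *
      !![α, -β, 0, 0; β, α, 0, 0; 0, 0, -α, β; 0, 0, -β, -α] *
      (!![α, -β, 0, 0; β, α, 0, 0; 0, 0, -α, β; 0, 0, -β, -α] *
      !![α, -β, 0, 0; β, α, 0, 0; 0, 0, -α, β; 0, 0, -β, -α])).trace =
      4 * ((α ^ 2 - β ^ 2) ^ 2 - (2 * α * β) ^ 2) := by
  rw [diag_neg_sq]
  simp [Matrix.trace, Fin.sum_univ_four]; ring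

theorem trace_diag_neg_transpose_fourth (α β : ℝ) :
    (!![α, -β, 0, 0; β, α, 0, 0; 0, 0, -α, -β; 0, 0, β, -α] *
      !![α, -β, 0, 0; β, α, 0, 0; 0, 0, -α, -β; 0, 0, β, -α] *
      (!![α, -β, 0, 0; β, α, 0, 0; 0, 0, -α, -β; 0, 0, β, -α] *
      !![α, -β, 0, 0; β, α, 0, 0; 0, 0, -α, -β; 0, 0, β, -α])).trace =
      4 * ((α ^ 2 - β ^ 2) ^ 2 - (2 * α * β) ^ 2) := by
  rw [diag_neg_transpose_sq, trace_diag_transpose_sq]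

/-- The hypotheses fix the real parts of (α + iβ)² and (α + iβ)⁴, hence the modulus α² + β², hence
α² and β². They stand for the traces of S² and S⁴ where S itself has trace zero. -/
theorem params_eq_of_traces {α β α' β' : ℝ} (hα : 0 ≤ α) (hβ : 0 ≤ β) (hα' : 0 ≤ α')
    (hβ' : 0 ≤ β') (h1 : α ^ 2 - β ^ 2 = α' ^ 2 - β' ^ 2)
    (h2 : (α ^ 2 - β ^ 2) ^ 2 - (2 * α * β) ^ 2 = (α' ^ 2 - β' ^ 2) ^ 2 - (2 * α' * β') ^ 2) :
    α = α' ∧ β = β' := by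
  have h3 : (α ^ 2 + β ^ 2) ^ 2 = (α' ^ 2 + β' ^ 2) ^ 2 := by
    linear_combination (2 * (α ^ 2 - β ^ 2) + 2 * (α' ^ 2 - β' ^ 2)) * h1 - h2
  have h4 : α ^ 2 + β ^ 2 = α' ^ 2 + β' ^ 2 := (sq_eq_sq₀ (by positivity) (by positivity)).1 h3
  exact ⟨(sq_eq_sq₀ hα hα').1 (by linarith), (sq_eq_sq₀ hβ hβ').1 (by linarith)⟩

theorem rotation_params_eq {α β α' β' : ℝ} (hβ : 0 < β) (hβ' : 0 < β')
    (h1 : Matrix.trace !![α, -β; β, α] = Matrix.trace !![α', -β'; β', α'])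
    (h2 : (!![α, -β; β, α] * !![α, -β; β, α]).trace =
      (!![α', -β'; β', α'] * !![α', -β'; β', α']).trace) : α = α' ∧ β = β' := by
  rw [trace_fin_two_of, trace_fin_two_of] at h1
  rw [trace_rotation_sq, trace_rotation_sq] at h2
  obtain rfl : α = α' := by linarith
  exact ⟨rfl, (sq_eq_sq₀ hβ.le hβ'.le).1 (by linarith)⟩

theorem smul_R_params_eq {α α' : ℝ} (hα : 0 ≤ α) (hα' : 0 ≤ α')
    (h2 : (!![α, 0; 0, -α] * !![α, 0; 0, -α]).trace =
      (!![α', 0; 0, -α'] * !![α', 0; 0, -α']).trace) : α = α' := by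
  rw [trace_smul_R_sq, trace_smul_R_sq] at h2
  exact (sq_eq_sq₀ hα hα').1 (by linarith)

theorem trace_smul_R_sq_ne {α β : ℝ} (hβ : 0 < β) :
    (!![α, 0; 0, -α] * !![α, 0; 0, -α]).trace ≠ (!![0, -β; β, 0] * !![0, -β; β, 0]).trace := by
  rw [trace_smul_R_sq, trace_rotation_sq]
  have : 0 < β ^ 2 := by positivity
  nlinarith [sq_nonneg α]

theorem not_pairEquiv_equivariantC {k : Kind} {s s' : Matrix (Fin 2) (Fin 2) ℝ} {α β α' : ℝ}
    (hβ : 0 < β) : ¬ PairEquiv k (MatrixPair.SMap ⟨2, s, !![α, -β; β, α]⟩)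
      (MatrixPair.sMap ⟨2, s, !![α, -β; β, α]⟩) (MatrixPair.SMap ⟨2, s', !![α', 0; 0, α']⟩)
      (MatrixPair.sMap ⟨2, s', !![α', 0; 0, α']⟩) := fun he => by
  have h1 : Matrix.trace !![α, -β; β, α] = Matrix.trace !![α', 0; 0, α'] := he.trace_eq
  have h2 : (!![α, -β; β, α] * !![α, -β; β, α]).trace =
    (!![α', 0; 0, α'] * !![α', 0; 0, α']).trace := he.trace_sq_eq
  have h3 := trace_rotation_sq α' 0
  rw [neg_zero] at h3
  rw [trace_fin_two_of, trace_fin_two_of] at h1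
  rw [trace_rotation_sq, h3] at h2
  obtain rfl : α = α' := by linarith
  have : 0 < β ^ 2 := by positivity
  linarith

theorem fin_one_eq_smul_one (σ : ℝ) : !![σ] = σ • (1 : Matrix (Fin 1) (Fin 1) ℝ) := by
  ext i j; fin_cases i; fin_cases j; simp

theorem fin_two_eq_smul_one (σ : ℝ) :
    !![σ, 0; 0, σ] = σ • (1 : Matrix (Fin 2) (Fin 2) ℝ) := by
  ext i j; fin_cases i <;> fin_cases j <;> simp

theorem sign_smul_matJ_mul (σ β : ℝ) :
    (σ • matJ) * !![0, -β; β, 0] = -(σ * β) • (1 : Matrix (Fin 2) (Fin 2) ℝ) := by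
  ext i j; fin_cases i <;> fin_cases j <;> simp [matJ]

theorem Listed.eq_of_pairEquiv {T : MapType} {F F' : MatrixPair} (h : Listed T F)
    (h' : Listed T F') (he : PairEquiv T.kind F.SMap F.sMap F'.SMap F'.sMap) : F = F' := by
  have hd := PairEquiv.dim_eq he
  -- Rows of different dimension are discarded here; rows of the same type and dimension remain.
  cases h <;> cases h' <;> (try (exfalso; revert hd; norm_num; done)) <;> clear hd
  case equivariantR_real.equivariantR_real σ α hσ σ' α' hσ' =>
    have h1 : Matrix.trace !![α] = Matrix.trace !![α'] := he.trace_eq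
    have h2 : Matrix.trace !![σ] = Matrix.trace !![σ'] := (PairEquiv.trace_structure_eq he).1
    simp only [trace_fin_one_of] at h1 h2
    rw [h1, h2]
  case equivariantR_complex.equivariantR_complex σ α β hσ hβ σ' α' β' hσ' hβ' =>
    obtain ⟨rfl, rfl⟩ := rotation_params_eq hβ hβ' he.trace_eq he.trace_sq_eq
    have h2 : Matrix.trace !![σ, 0; 0, σ] = Matrix.trace !![σ', 0; 0, σ'] :=
      (PairEquiv.trace_structure_eq he).1
    simp only [trace_fin_two_of] at h2
    obtain rfl : σ = σ' := by linarith
    rfl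
  case reversibleR_zero.reversibleR_zero σ hσ σ' hσ' =>
    have h2 : Matrix.trace !![σ] = Matrix.trace !![σ'] := (PairEquiv.trace_structure_eq he).1
    simp only [trace_fin_one_of] at h2
    rw [h2]
  case reversibleR_real.reversibleR_real α hα α' hα' =>
    obtain rfl := smul_R_params_eq hα.le hα'.le he.trace_sq_eq
    rfl
  case reversibleR_real.reversibleR_imaginary α hα β hβ =>
    exact absurd he.trace_sq_eq (trace_smul_R_sq_ne hβ)
  case reversibleR_imaginary.reversibleR_real β hβ α hα =>
    exact absurd he.trace_sq_eq (trace_smul_R_sq_ne hβ).symm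
  case reversibleR_imaginary.reversibleR_imaginary β hβ β' hβ' =>
    obtain ⟨-, rfl⟩ := rotation_params_eq hβ hβ' he.trace_eq he.trace_sq_eq
    rfl
  case reversibleR_complex.reversibleR_complex α β hα hβ α' β' hα' hβ' =>
    have h2 := (trace_diag_neg_sq α β).symm.trans
      (he.trace_sq_eq.trans (trace_diag_neg_sq α' β'))
    have h4 := (trace_diag_neg_fourth α β).symm.trans
      (he.trace_fourth_eq.trans (trace_diag_neg_fourth α' β'))
    obtain ⟨rfl, rfl⟩ := params_eq_of_traces hα.le hβ.le hα'.le hβ'.le (by linarith) (by linarith)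
    rfl
  case equivariantC_real.equivariantC_real α α' =>
    have h1 : Matrix.trace !![α, 0; 0, α] = Matrix.trace !![α', 0; 0, α'] := he.trace_eq
    simp only [trace_fin_two_of] at h1
    obtain rfl : α = α' := by linarith
    rfl
  case equivariantC_real.equivariantC_complex α σ α' β' hσ' hβ' =>
    exact absurd he.symm (not_pairEquiv_equivariantC hβ')
  case equivariantC_complex.equivariantC_real σ α β hσ hβ α' =>
    exact absurd he (not_pairEquiv_equivariantC hβ)
  case equivariantC_complex.equivariantC_complex σ α β hσ hβ σ' α' β' hσ' hβ' =>
    obtain ⟨rfl, rfl⟩ := rotation_params_eq hβ hβ' he.trace_eq he.trace_sq_eq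
    have h2 : ((σ • matJ) * !![α, -β; β, α]).trace = ((σ' • matJ) * !![α, -β; β, α]).trace :=
      (PairEquiv.trace_structure_eq he).2
    -- tr s vanishes for both signs; tr(sS) = -2σβ detects σ, and it is zero exactly when β = 0,
    -- where the sign disappears.
    have h3 : (matJ * !![α, -β; β, α]).trace = -(2 * β) := by simp [matJ]; ring
    rw [smul_mul_assoc, smul_mul_assoc, trace_smul, trace_smul, h3, smul_eq_mul, smul_eq_mul] at h2
    obtain rfl : σ = σ' := mul_right_cancel₀ (by linarith : -(2 * β) ≠ 0) h2
    rfl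
  case reversibleC_real.reversibleC_real α hα α' hα' =>
    obtain rfl := smul_R_params_eq hα hα' he.trace_sq_eq
    rfl
  case reversibleC_complex.reversibleC_complex α β hα hβ α' β' hα' hβ' =>
    have h2 := (trace_diag_neg_sq α β).symm.trans
      (he.trace_sq_eq.trans (trace_diag_neg_sq α' β'))
    have h4 := (trace_diag_neg_fourth α β).symm.trans
      (he.trace_fourth_eq.trans (trace_diag_neg_fourth α' β'))
    obtain ⟨rfl, rfl⟩ := params_eq_of_traces hα hβ.le hα' hβ'.le (by linarith) (by linarith)
    rfl
  case symmetric_real.symmetric_real σ α hσ σ' α' hσ' =>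
    have h1 : Matrix.trace !![α] = Matrix.trace !![α'] := he.trace_eq
    simp only [trace_fin_one_of] at h1
    obtain rfl := PairEquiv.sign_eq_of_scalar he one_pos hσ hσ' (fin_one_eq_smul_one σ)
      (fin_one_eq_smul_one σ')
    rw [h1]
  case symmetric_complex.symmetric_complex α β hβ α' β' hβ' =>
    obtain ⟨rfl, rfl⟩ := rotation_params_eq hβ hβ' he.trace_eq he.trace_sq_eq
    rfl
  case antiSymmetric_zero.antiSymmetric_zero σ hσ σ' hσ' =>
    obtain rfl := PairEquiv.sign_eq_of_scalar he one_pos hσ hσ' (fin_one_eq_smul_one σ)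
      (fin_one_eq_smul_one σ')
    rfl
  case antiSymmetric_real.antiSymmetric_real α hα α' hα' =>
    obtain rfl := smul_R_params_eq hα.le hα'.le he.trace_sq_eq
    rfl
  case antiSymmetric_real.antiSymmetric_imaginary α hα σ β hσ hβ =>
    exact absurd he.trace_sq_eq (trace_smul_R_sq_ne hβ)
  case antiSymmetric_imaginary.antiSymmetric_real σ β hσ hβ α hα =>
    exact absurd he.trace_sq_eq (trace_smul_R_sq_ne hβ).symm
  case antiSymmetric_imaginary.antiSymmetric_imaginary σ β hσ hβ σ' β' hσ' hβ' =>
    obtain ⟨-, rfl⟩ := rotation_params_eq hβ hβ' he.trace_eq he.trace_sq_eq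
    obtain rfl := PairEquiv.sign_eq_of_scalar he two_pos hσ hσ' (fin_two_eq_smul_one σ)
      (fin_two_eq_smul_one σ')
    rfl
  case antiSymmetric_complex.antiSymmetric_complex α β hα hβ α' β' hα' hβ' =>
    have h2 := (trace_diag_neg_transpose_sq α β).symm.trans
      (he.trace_sq_eq.trans (trace_diag_neg_transpose_sq α' β'))
    have h4 := (trace_diag_neg_transpose_fourth α β).symm.trans
      (he.trace_fourth_eq.trans (trace_diag_neg_transpose_fourth α' β'))
    obtain ⟨rfl, rfl⟩ := params_eq_of_traces hα.le hβ.le hα'.le hβ'.le (by linarith) (by linarith)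
    rfl
  case antiSymplectic_real.antiSymplectic_real α α' =>
    have h1 : Matrix.trace !![α, 0; 0, α] = Matrix.trace !![α', 0; 0, α'] := he.trace_eq
    simp only [trace_fin_two_of] at h1
    obtain rfl : α = α' := by linarith
    rfl
  case antiSymplectic_complex.antiSymplectic_complex α β hβ α' β' hβ' =>
    have h1 : ∀ a b : ℝ, Matrix.trace !![a, -b, 0, 0; b, a, 0, 0; 0, 0, a, b; 0, 0, -b, a] =
        4 * a := fun a b => by
      simp [Matrix.trace, Fin.sum_univ_four]; ring
    have h2 := (h1 α β).symm.trans (he.trace_eq.trans (h1 α' β'))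
    have h3 := (trace_diag_transpose_sq α β).symm.trans
      (he.trace_sq_eq.trans (trace_diag_transpose_sq α' β'))
    obtain rfl : α = α' := by linarith
    obtain rfl : β = β' := (sq_eq_sq₀ hβ.le hβ'.le).1 (by linarith)
    rfl
  case symplectic_real.symplectic_real α hα α' hα' =>
    obtain rfl := smul_R_params_eq hα hα' he.trace_sq_eq
    rfl
  case symplectic_real.symplectic_imaginary α hα σ β hσ hβ =>
    exact absurd he.trace_sq_eq (trace_smul_R_sq_ne hβ)
  case symplectic_imaginary.symplectic_real σ β hσ hβ α hα =>
    exact absurd he.trace_sq_eq (trace_smul_R_sq_ne hβ).symm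
  case symplectic_imaginary.symplectic_imaginary σ β hσ hβ σ' β' hσ' hβ' =>
    obtain ⟨-, rfl⟩ := rotation_params_eq hβ hβ' he.trace_eq he.trace_sq_eq
    -- ω is alternating, so ω(x, x) carries no information; the sign is that of the definite form
    -- ω(x, Sx).
    obtain rfl := PairEquiv.sign_eq_of_scalar_mul he two_pos hσ hσ' hβ hβ'
      (sign_smul_matJ_mul σ β) (sign_smul_matJ_mul σ' β)
    rfl
  case symplectic_complex.symplectic_complex α β hα hβ α' β' hα' hβ' =>
    have h2 := (trace_diag_neg_transpose_sq α β).symm.trans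
      (he.trace_sq_eq.trans (trace_diag_neg_transpose_sq α' β'))
    have h4 := (trace_diag_neg_transpose_fourth α β).symm.trans
      (he.trace_fourth_eq.trans (trace_diag_neg_transpose_fourth α' β'))
    obtain ⟨rfl, rfl⟩ := params_eq_of_traces hα.le hβ.le hα'.le hβ'.le (by linarith) (by linarith)
    rfl

end Inequivalence

/-! ### Real and complex eigenvectors. -/

section Spectrum

open Polynomial

variable {V : Type*} [AddCommGroup V] [Module ℝ V] [FiniteDimensional ℝ V]

/-- Write the minimal polynomial as p r. By minimality r(S) ≠ 0, and p(S) annihilates its image. -/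
theorem exists_ne_zero_aeval_apply_eq_zero {S : Module.End ℝ V} {p : ℝ[X]} (hp : 0 < p.degree)
    (h : p ∣ minpoly ℝ S) : ∃ x, x ≠ 0 ∧ aeval S p x = 0 := by
  have hint := Algebra.IsIntegral.isIntegral (R := ℝ) S
  obtain ⟨r, hr⟩ := h
  have hm : minpoly ℝ S ≠ 0 := minpoly.ne_zero hint
  have hr0 : r ≠ 0 := by rintro rfl; exact hm (by rw [hr, mul_zero])
  have hrS : aeval S r ≠ 0 := fun h0 => by
    have h1 := minpoly.degree_le_of_ne_zero ℝ S hr0 h0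
    rw [hr, degree_mul] at h1
    have h2 : degree r ≠ ⊥ := degree_ne_bot.2 hr0
    have h3 : degree r < degree p + degree r := by
      rw [degree_eq_natDegree hr0, degree_eq_natDegree (ne_zero_of_degree_gt hp)] at *
      norm_cast at *
      omega
    exact absurd h1 (not_le.2 h3)
  obtain ⟨v, hv⟩ : ∃ v, aeval S r v ≠ 0 := by
    by_contra! h0
    exact hrS (LinearMap.ext h0)
  refine ⟨aeval S r v, hv, ?_⟩
  rw [← Module.End.mul_apply, ← map_mul, ← hr, minpoly.aeval, LinearMap.zero_apply]

/-- The real and imaginary part of an eigenvector of `S` for the eigenvalue `α - β i`. -/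
def IsComplexPair (S : Module.End ℝ V) (α β : ℝ) (x y : V) : Prop :=
  x ≠ 0 ∧ S x = α • x + β • y ∧ S y = -β • x + α • y

theorem exists_eigenvector_or_isComplexPair [Nontrivial V] (S : Module.End ℝ V) :
    (∃ (α : ℝ) (x : V), x ≠ 0 ∧ S x = α • x) ∨
      ∃ (α β : ℝ) (x y : V), 0 < β ∧ IsComplexPair S α β x y := by
  have hint := Algebra.IsIntegral.isIntegral (R := ℝ) S
  obtain ⟨c, hc⟩ := IsAlgClosed.exists_aeval_eq_zero ℂ (minpoly ℝ S)
    (minpoly.degree_pos hint).ne'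
  by_cases him : c.im = 0
  · left
    have hcr : c = (c.re : ℂ) := Complex.ext rfl (by simpa using him)
    have hroot : aeval c.re (minpoly ℝ S) = 0 := by
      have h1 : aeval (algebraMap ℝ ℂ c.re) (minpoly ℝ S) = 0 := by
        rw [Complex.coe_algebraMap, ← hcr, hc]
      rw [aeval_algebraMap_apply] at h1
      exact (algebraMap ℝ ℂ).injective (by rw [h1, map_zero])
    obtain ⟨x, hx, h0⟩ := exists_ne_zero_aeval_apply_eq_zero (S := S) (p := X - C c.re) (by simp)
      (dvd_iff_isRoot.2 (by simpa using hroot))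
    refine ⟨c.re, x, hx, ?_⟩
    simpa [sub_eq_zero, Module.algebraMap_end_apply] using h0
  · right
    obtain ⟨x, hx, h0⟩ := exists_ne_zero_aeval_apply_eq_zero (S := S) (by
      have : (X ^ 2 - C (2 * c.re) * X + C (‖c‖ ^ 2) : ℝ[X]).degree = 2 := by compute_degree!
      rw [this]; norm_num)
      (quadratic_dvd_of_aeval_eq_zero_im_ne_zero (p := minpoly ℝ S) hc him)
    -- Roots come in conjugate pairs, so the imaginary part may be replaced by its absolute value.
    have hβ : 0 < |c.im| := abs_pos.2 him
    have hn : ‖c‖ ^ 2 = c.re ^ 2 + |c.im| ^ 2 := by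
      rw [sq_abs, Complex.sq_norm, Complex.normSq_apply]; ring
    rw [hn] at h0
    generalize |c.im| = β at *
    generalize c.re = α at *
    have h1 : S (S x) - (2 * α) • S x + (α ^ 2 + β ^ 2) • x = 0 := by
      simpa [Module.algebraMap_end_apply, pow_two, add_smul, ← mul_smul, mul_comm (2 : ℝ) α] using h0
    -- The first equation of a complex pair forces this y; the second is then (S - α)²x = -β²x.
    refine ⟨α, β, x, β⁻¹ • (S x - α • x), hβ, hx, ?_, ?_⟩
    · rw [smul_smul, mul_inv_cancel₀ hβ.ne', one_smul]; abel
    · have h2 : S (S x) = (2 * α) • S x - (α ^ 2 + β ^ 2) • x := by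
        rw [← sub_eq_zero, ← h1]; abel
      rw [map_smul, map_sub, map_smul, h2]
      match_scalars <;> field_simp <;> ring

theorem ker_sup_range_of_isSemisimple {A : Module.End ℝ V} (hA : A.IsSemisimple) :
    LinearMap.ker A ⊔ LinearMap.range A = ⊤ := by
  obtain ⟨W, hW, hc⟩ := Module.End.isSemisimple_iff.1 hA (LinearMap.ker A) fun x hx => by
    rw [Submodule.mem_comap, LinearMap.mem_ker, LinearMap.mem_ker.1 hx, map_zero]
  rw [eq_top_iff, ← hc.sup_eq_top]
  refine sup_le_sup_left (fun w hw => ?_) _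
  have hinj : Function.Injective (A.restrict hW) := by
    rw [← LinearMap.ker_eq_bot, LinearMap.ker_eq_bot']
    intro m hm
    have h1 : A m = 0 := congrArg Subtype.val hm
    exact Subtype.ext (Submodule.disjoint_def.1 hc.disjoint m h1 m.2)
  obtain ⟨v, hv⟩ := LinearMap.injective_iff_surjective.1 hinj ⟨w, hw⟩
  exact ⟨v, congrArg Subtype.val hv⟩

end Spectrum

/-! ### Linear maps out of Euclidean space, and splitting off a listed pair. -/

section Vectors

open Matrix

variable {X : Type*} [NormedAddCommGroup X] [InnerProductSpace ℝ X] [FiniteDimensional ℝ X]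
variable {n : ℕ}

/-- The linear map from Euclidean space with prescribed values on the standard basis. -/
noncomputable def ofVectors (v : Fin n → X) : EuclideanSpace ℝ (Fin n) →ₗ[ℝ] X :=
  (EuclideanSpace.basisFun (Fin n) ℝ).toBasis.constr ℝ v

theorem ofVectors_single (v : Fin n → X) (i : Fin n) :
    ofVectors v (EuclideanSpace.single i 1) = v i := by
  rw [ofVectors, ← EuclideanSpace.basisFun_apply, ← OrthonormalBasis.coe_toBasis,
    Module.Basis.constr_basis]

theorem ext_single {V : Type*} [AddCommGroup V] [Module ℝ V]
    {f g : EuclideanSpace ℝ (Fin n) →ₗ[ℝ] V}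
    (h : ∀ i, f (EuclideanSpace.single i 1) = g (EuclideanSpace.single i 1)) : f = g :=
  (EuclideanSpace.basisFun (Fin n) ℝ).toBasis.ext fun i => by simpa using h i

theorem toEuclideanLin_single (A : Matrix (Fin n) (Fin n) ℝ) (j : Fin n) :
    toEuclideanLin A (EuclideanSpace.single j 1) =
      ∑ i, A i j • EuclideanSpace.single i (1 : ℝ) := by
  ext i
  simp [Matrix.toLpLin_apply, Finset.sum_apply, Pi.single_apply]

theorem ofVectors_toEuclideanLin {v : Fin n → X} {A : Matrix (Fin n) (Fin n) ℝ}
    {B : Module.End ℝ X} (h : ∀ j, B (v j) = ∑ i, A i j • v i) (x) :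
    ofVectors v (toEuclideanLin A x) = B (ofVectors v x) := by
  refine LinearMap.congr_fun (f := ofVectors v ∘ₗ toEuclideanLin A) (g := B ∘ₗ ofVectors v)
    (ext_single fun j => ?_) x
  rw [LinearMap.comp_apply, LinearMap.comp_apply, toEuclideanLin_single, map_sum,
    ofVectors_single, h]
  simp only [map_smul, ofVectors_single]

theorem inner_ofVectors {v : Fin n → X} {A : Matrix (Fin n) (Fin n) ℝ}
    {B : Module.End ℝ X} (h : ∀ i j, ⟪v i, B (v j)⟫_ℝ = A i j) (x y) :
    ⟪ofVectors v x, B (ofVectors v y)⟫_ℝ = ⟪x, toEuclideanLin A y⟫_ℝ := by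
  have h1 : (innerₗ X).compl₁₂ (ofVectors v) (B ∘ₗ ofVectors v) =
      (innerₗ _).compl₁₂ LinearMap.id (toEuclideanLin A) := by
    refine ext_single fun i => ext_single fun j => ?_
    simp only [LinearMap.compl₁₂_apply, innerₗ_apply_apply, LinearMap.comp_apply, ofVectors_single,
      LinearMap.id_apply, h, toEuclideanLin_single]
    simp [inner_sum, inner_smul_right, EuclideanSpace.inner_single_left]
  exact LinearMap.congr_fun₂ h1 x y

end Vectors

section Existence

variable {X : Type*} [NormedAddCommGroup X] [InnerProductSpace ℝ X] [FiniteDimensional ℝ X]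
variable {T : MapType} {S : Module.End ℝ X} {s : X ≃ₗ[ℝ] X}

/-- A nonzero map that intertwines a listed pair with an indecomposable semisimple pair is an
equivalence. -/
theorem Listed.pairEquiv_of_auto {n : ℕ} {A B : Matrix (Fin n) (Fin n) ℝ}
    (hF : Listed T ⟨n, B, A⟩) (hk : T.kind = Kind.auto) (h : IsIndecomposablePair T S s)
    (hss : S.IsSemisimple) (v : Fin n → X) (hv : ∃ i, v i ≠ 0)
    (hS : ∀ j, S (v j) = ∑ i, A i j • v i) (hs : ∀ j, s (v j) = ∑ i, B i j • v i) :
    ∃ F, Listed T F ∧ PairEquiv T.kind S s.toLinearMap F.SMap F.sMap := by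
  refine ⟨_, hF, PairEquiv.symm ?_⟩
  obtain ⟨s₀, hs₀, h₀⟩ := hF.isSimple.isIndecomposablePair
  have hss₀ := hF.isSimple.semisimple
  rw [isIndecomposablePair_iff, hk] at h h₀
  have hfS : ∀ x, ofVectors v (Matrix.toEuclideanLin A x) = S (ofVectors v x) :=
    ofVectors_toEuclideanLin hS
  have hfs : ∀ x, ofVectors v (Matrix.toEuclideanLin B x) = s (ofVectors v x) :=
    ofVectors_toEuclideanLin (B := s.toLinearMap) hs
  have hs₀' : ∀ x, s₀ x = Matrix.toEuclideanLin B x := LinearMap.congr_fun hs₀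
  have hne : ofVectors v ≠ 0 := fun h0 => by
    obtain ⟨i, hi⟩ := hv
    rw [← ofVectors_single v i, h0] at hi
    exact hi rfl
  have hkS : ∀ u ∈ LinearMap.ker (ofVectors v),
      MatrixPair.SMap ⟨n, B, A⟩ u ∈ LinearMap.ker (ofVectors v) := fun u hu => by
    rw [LinearMap.mem_ker] at hu ⊢
    exact (hfS u).trans (by rw [hu, map_zero])
  have hks : ∀ u ∈ LinearMap.ker (ofVectors v), s₀ u ∈ LinearMap.ker (ofVectors v) :=
    fun u hu => by
      rw [LinearMap.mem_ker] at hu ⊢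
      rw [hs₀', hfs, hu, map_zero]
  have hrS : ∀ u ∈ LinearMap.range (ofVectors v), S u ∈ LinearMap.range (ofVectors v) := by
    rintro _ ⟨x, rfl⟩
    exact ⟨_, hfS x⟩
  have hrs : ∀ u ∈ LinearMap.range (ofVectors v), s u ∈ LinearMap.range (ofVectors v) := by
    rintro _ ⟨x, rfl⟩
    exact ⟨_, hfs x⟩
  obtain ⟨W, hc, hWS, hWs⟩ :=
    exists_isCompl_auto T.eps_mul_eps T.mu_mul_mu h₀.1 h₀.2.1 hss₀ hkS hks
  obtain ⟨W', hc', hWS', hWs'⟩ :=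
    exists_isCompl_auto T.eps_mul_eps T.mu_mul_mu h.1 h.2.1 hss hrS hrs
  -- As in Schur's lemma: kernel and range have invariant complements, and both sides are
  -- indecomposable, so a nonzero map is bijective.
  have hker : LinearMap.ker (ofVectors v) = ⊥ := by
    refine (h₀.2.2.2 _ _ hc hkS hWS ⟨hks, hWs⟩).resolve_right fun h0 => hne ?_
    rw [h0] at hc
    exact LinearMap.ker_eq_top.1 (eq_top_of_isCompl_bot hc)
  have hrange : LinearMap.range (ofVectors v) = ⊤ := by
    rcases h.2.2.2 _ _ hc' hrS hWS' ⟨hrs, hWs'⟩ with h0 | h0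
    · exact absurd (LinearMap.range_eq_bot.1 h0) hne
    · rw [h0] at hc'
      exact eq_top_of_isCompl_bot hc'
  rw [hk]
  exact ⟨LinearEquiv.ofBijective (ofVectors v)
    ⟨LinearMap.ker_eq_bot.1 hker, LinearMap.range_eq_top.1 hrange⟩, hfS, hfs⟩

/-- A map that intertwines a listed pair with an indecomposable semisimple pair and preserves the
forms is an equivalence. -/
theorem Listed.pairEquiv_of_anti {n : ℕ} {A B : Matrix (Fin n) (Fin n) ℝ}
    (hF : Listed T ⟨n, B, A⟩) (hk : T.kind = Kind.anti) (h : IsIndecomposablePair T S s)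
    (v : Fin n → X) (hS : ∀ j, S (v j) = ∑ i, A i j • v i)
    (hs : ∀ i j, ⟪v i, s (v j)⟫_ℝ = B i j) :
    ∃ F, Listed T F ∧ PairEquiv T.kind S s.toLinearMap F.SMap F.sMap := by
  refine ⟨_, hF, PairEquiv.symm ?_⟩
  obtain ⟨s₀, hs₀, h₀⟩ := hF.isSimple.isIndecomposablePair
  rw [isIndecomposablePair_iff, hk] at h h₀
  set f := ofVectors v with hf
  have hfS : ∀ x, f (Matrix.toEuclideanLin A x) = S (f x) := ofVectors_toEuclideanLin hS
  have hfs : ∀ x y, ⟪f x, s (f y)⟫_ℝ = ⟪x, Matrix.toEuclideanLin B y⟫_ℝ :=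
    inner_ofVectors (B := s.toLinearMap) hs
  have hs₀' : ∀ x, s₀ x = Matrix.toEuclideanLin B x := LinearMap.congr_fun hs₀
  -- The form of the listed pair is nondegenerate, so ω is nondegenerate on the image: f is
  -- injective and its range is complemented by its ω-orthogonal space.
  have hinj : ∀ x, (∀ y, ⟪f y, s (f x)⟫_ℝ = 0) → x = 0 := fun x hx =>
    eq_zero_of_forall_inner_eq_zero (s := s₀) fun y => by rw [hs₀', ← hfs, hx]
  have hker : LinearMap.ker f = ⊥ := LinearMap.ker_eq_bot'.2 fun x hx =>
    hinj x fun y => by rw [hx, map_zero, inner_zero_right]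
  let W : Submodule ℝ X := LinearMap.ker (formMap s.toLinearMap (LinearMap.range f))
  have hW : ∀ {x}, x ∈ W ↔ ∀ y, ⟪f y, s x⟫_ℝ = 0 := fun {x} => by
    rw [LinearMap.mem_ker, formMap_eq_zero_iff]
    exact ⟨fun h0 y => h0 _ ⟨y, rfl⟩, by rintro h0 _ ⟨y, rfl⟩; exact h0 y⟩
  have hdisj : Disjoint (LinearMap.range f) W := by
    rw [Submodule.disjoint_def]
    rintro _ ⟨x, rfl⟩ hx
    rw [hinj x (hW.1 hx), map_zero]
  have hcodim : Module.finrank ℝ X ≤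
      Module.finrank ℝ (LinearMap.range f) + Module.finrank ℝ W := by
    rw [← LinearMap.finrank_range_add_finrank_ker (formMap s.toLinearMap (LinearMap.range f))]
    exact Nat.add_le_add_right (Submodule.finrank_le _) _
  have hc : IsCompl (LinearMap.range f) W := by
    refine ⟨hdisj, codisjoint_iff.2 (Submodule.eq_top_of_finrank_eq (le_antisymm
      (Submodule.finrank_le _) (hcodim.trans ?_)))⟩
    have h1 := Submodule.finrank_sup_add_finrank_inf_eq (LinearMap.range f) W
    rw [hdisj.eq_bot, finrank_bot, add_zero] at h1
    exact h1.ge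
  have hμ : T.mu ≠ 0 := left_ne_zero_of_mul_eq_one T.mu_mul_mu
  have hrange : LinearMap.range f = ⊤ := by
    rcases h.2.2.2 _ _ hc (by rintro _ ⟨x, rfl⟩; exact ⟨_, hfS x⟩) (fun w hw => hW.2 fun y => by
      have h1 := h.2.1 (f y) w
      rw [← hfS, hW.1 hw] at h1
      exact (mul_eq_zero.1 h1.symm).resolve_left hμ)
      (by rintro _ ⟨y, rfl⟩ w hw; exact hW.1 hw y) with h0 | h0
    · exfalso
      have := h₀.2.2.1
      obtain ⟨x, hx⟩ := exists_ne (0 : EuclideanSpace ℝ (Fin n))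
      have h2 := LinearMap.range_eq_bot.1 h0
      exact hx (hinj x fun y => by rw [h2]; simp)
    · rw [h0] at hc
      exact eq_top_of_isCompl_bot hc
  rw [hk]
  exact ⟨LinearEquiv.ofBijective f
    ⟨LinearMap.ker_eq_bot.1 hker, LinearMap.range_eq_top.1 hrange⟩, hfS,
    fun x y => hfs x y⟩

end Existence

/-! ### Normal forms for automorphisms. -/

section Automorphisms

variable {X : Type*} [NormedAddCommGroup X] [InnerProductSpace ℝ X] [FiniteDimensional ℝ X]
variable {T : MapType} {S : Module.End ℝ X} {s : X ≃ₗ[ℝ] X} {α β ε : ℝ} {x y : X}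

/-- `S y` is determined by `S x` in a complex pair. -/
theorem apply_eq_of_smul_eq {A : X ≃ₗ[ℝ] X} {u v x y : X} (hβ : β ≠ 0) (hx : A x = u)
    (hy : A (α • x + β • y) = v) : A y = β⁻¹ • (v - α • u) := by
  rw [← hy, map_add, map_smul, map_smul, hx, add_sub_cancel_left, smul_smul, inv_mul_cancel₀ hβ,
    one_smul]

/-- For `μ = -1` the eigenvalues of `S` are symmetric with respect to the imaginary axis. -/
theorem exists_nonneg_eigenvector_or_isComplexPair_of_auto [Nontrivial X]
    (hS : ∀ x, s (S x) = (-1 : ℝ) • S (s x)) :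
    (∃ (α : ℝ) (x : X), 0 ≤ α ∧ x ≠ 0 ∧ S x = α • x) ∨
      ∃ (α β : ℝ) (x y : X), 0 ≤ α ∧ 0 < β ∧ IsComplexPair S α β x y := by
  have hS' : ∀ x, S (s x) = - s (S x) := fun x => by rw [hS, neg_one_smul, neg_neg]
  rcases exists_eigenvector_or_isComplexPair S with ⟨α, x, hx, h⟩ | ⟨α, β, x, y, hβ, hx, h, h'⟩
  · left
    rcases le_or_gt 0 α with hα | hα
    · exact ⟨α, x, hα, hx, h⟩
    · exact ⟨-α, s x, by linarith, by simpa using hx, by rw [hS', h, map_smul, neg_smul]⟩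
  · right
    rcases le_or_gt 0 α with hα | hα
    · exact ⟨α, β, x, y, hα, hβ, hx, h, h'⟩
    -- s negates the eigenvalue; the sign on s y conjugates the eigenvector, which brings β back to
    -- a positive value.
    · refine ⟨-α, β, s x, -s y, by linarith, hβ, by simpa using hx, ?_, ?_⟩
      · rw [hS', h, map_add, map_smul, map_smul]; module
      · rw [map_neg, hS', h', map_add, map_smul, map_smul]; module

theorem exists_listed_equivariantR (h : IsIndecomposablePair .equivariantR S s)
    (hss : S.IsSemisimple) :
    ∃ F, Listed .equivariantR F ∧ PairEquiv Kind.auto S s.toLinearMap F.SMap F.sMap := by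
  obtain ⟨hs, hS, hi⟩ := isIndecomposablePair_iff.1 h
  have := hi.1
  have hs1 : ∀ x, s (s x) = x := fun x => (hs x).trans (one_smul ℝ x)
  have hS1 : ∀ x, s (S x) = S (s x) := fun x => (hS x).trans (one_smul ℝ _)
  rcases exists_eigenvector_or_isComplexPair S with ⟨α, x, hx, h1⟩ | ⟨α, β, x, y, hβ, hx, h1, h2⟩
  · obtain ⟨σ, v, hσ, hv, h3, h4⟩ : ∃ (σ : ℝ) (v : X), (σ = 1 ∨ σ = -1) ∧ v ≠ 0 ∧
        S v = α • v ∧ s v = σ • v := by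
      -- Project onto the eigenspace of s for 1; if the projection of x is zero, x itself lies in
      -- the one for -1.
      by_cases h0 : x + s x = 0
      · exact ⟨-1, x, Or.inr rfl, hx, h1, by rw [neg_one_smul, eq_neg_of_add_eq_zero_right h0]⟩
      · exact ⟨1, x + s x, Or.inl rfl, h0, by rw [map_add, ← hS1, h1, map_smul, smul_add],
          by rw [map_add, hs1, one_smul, add_comm]⟩
    exact (Listed.equivariantR_real σ α hσ).pairEquiv_of_auto rfl h hss ![v] ⟨0, hv⟩
      (by simpa using h3) (by simpa using h4)
  · obtain ⟨σ, v, w, hσ, hv, h3, h4, h5, h6⟩ : ∃ (σ : ℝ) (v w : X), (σ = 1 ∨ σ = -1) ∧ v ≠ 0 ∧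
        S v = α • v + β • w ∧ S w = -β • v + α • w ∧ s v = σ • v ∧ s w = σ • w := by
      by_cases h0 : x + s x = 0
      · have h3 : s x = -x := eq_neg_of_add_eq_zero_right h0
        have h4 : s y = -y := by
          have h5 : s (α • x + β • y) = -(α • x + β • y) := by rw [← h1, hS1, h3, map_neg]
          rw [apply_eq_of_smul_eq hβ.ne' h3 h5]
          match_scalars
          · field_simp
            ring
          · field_simp
        exact ⟨-1, x, y, Or.inr rfl, hx, h1, h2, by rw [h3, neg_one_smul], by rw [h4, neg_one_smul]⟩
      · refine ⟨1, x + s x, y + s y, Or.inl rfl, h0, ?_, ?_, ?_, ?_⟩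
        · rw [map_add, ← hS1, h1, map_add, map_smul, map_smul]; module
        · rw [map_add, ← hS1, h2, map_add, map_smul, map_smul]; module
        · rw [map_add, hs1, one_smul, add_comm]
        · rw [map_add, hs1, one_smul, add_comm]
    exact (Listed.equivariantR_complex σ α β hσ hβ).pairEquiv_of_auto rfl h hss ![v, w] ⟨0, hv⟩
      (by simp [Fin.forall_fin_two, h3, h4]) (by simp [Fin.forall_fin_two, h5, h6])

theorem exists_listed_reversibleR (h : IsIndecomposablePair .reversibleR S s)
    (hss : S.IsSemisimple) :
    ∃ F, Listed .reversibleR F ∧ PairEquiv Kind.auto S s.toLinearMap F.SMap F.sMap := by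
  obtain ⟨hs, hS, hi⟩ := isIndecomposablePair_iff.1 h
  have := hi.1
  have hs1 : ∀ x, s (s x) = x := fun x => (hs x).trans (one_smul ℝ x)
  have hS1 : ∀ x, s (S x) = (-1 : ℝ) • S (s x) := hS
  have hS2 : ∀ x, S (s x) = -s (S x) := fun x => by rw [hS1, neg_one_smul, neg_neg]
  rcases exists_nonneg_eigenvector_or_isComplexPair_of_auto hS1 with
    ⟨α, x, hα, hx, h1⟩ | ⟨α, β, x, y, hα, hβ, hx, h1, h2⟩
  · rcases hα.eq_or_lt with rfl | hα
    · rw [zero_smul] at h1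
      obtain ⟨σ, v, hσ, hv, h3, h4⟩ : ∃ (σ : ℝ) (v : X), (σ = 1 ∨ σ = -1) ∧ v ≠ 0 ∧
          S v = 0 ∧ s v = σ • v := by
        by_cases h0 : x + s x = 0
        · exact ⟨-1, x, Or.inr rfl, hx, h1, by rw [neg_one_smul, eq_neg_of_add_eq_zero_right h0]⟩
        · exact ⟨1, x + s x, Or.inl rfl, h0, by rw [map_add, hS2, h1, map_zero, neg_zero, add_zero],
            by rw [map_add, hs1, one_smul, add_comm]⟩
      exact (Listed.reversibleR_zero σ hσ).pairEquiv_of_auto rfl h hss ![v] ⟨0, hv⟩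
        (by simpa using h3) (by simpa using h4)
    · exact (Listed.reversibleR_real α hα).pairEquiv_of_auto rfl h hss ![x, s x] ⟨0, hx⟩
        (by simp [Fin.forall_fin_two, hS2, h1]) (by simp [Fin.forall_fin_two, hs1, matT])
  · rcases hα.eq_or_lt with rfl | hα
    · rw [zero_smul, zero_add] at h1
      rw [zero_smul, add_zero] at h2
      obtain ⟨v, w, hv, h3, h4, h5, h6⟩ : ∃ v w : X, v ≠ 0 ∧
          S v = β • w ∧ S w = -β • v ∧ s v = v ∧ s w = -w := by
        by_cases h0 : x + s x = 0
        · have h3 : s x = -x := eq_neg_of_add_eq_zero_right h0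
          have h4 : s y = y := by
            have h5 : s ((0 : ℝ) • x + β • y) = β • y := by
              rw [zero_smul, zero_add, ← h1, hS1, h3, map_neg, neg_one_smul, neg_neg]
            rw [apply_eq_of_smul_eq hβ.ne' h3 h5, zero_smul, sub_zero,
              smul_smul, inv_mul_cancel₀ hβ.ne', one_smul]
          -- s fixes one vector of the pair and negates the other; if x is the negated one, a
          -- quarter turn exchanges the roles.
          refine ⟨y, -x, fun h5 => ?_, by rw [h2]; module, by rw [map_neg, h1]; module, h4, by
            rw [map_neg, h3]⟩
          rw [h5, map_zero] at h2
          exact (smul_eq_zero.1 h2.symm).elim (by simpa using hβ.ne') hx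
        · refine ⟨x + s x, y - s y, h0, ?_, ?_, ?_, ?_⟩
          · rw [map_add, hS2, h1, map_smul]; module
          · rw [map_sub, hS2, h2, map_smul]; module
          · rw [map_add, hs1, add_comm]
          · rw [map_sub, hs1, neg_sub]
      exact (Listed.reversibleR_imaginary β hβ).pairEquiv_of_auto rfl h hss ![v, w] ⟨0, hv⟩
        (by simp [Fin.forall_fin_two, h3, h4]) (by simp [Fin.forall_fin_two, h5, h6, matR])
    · exact (Listed.reversibleR_complex α β hα hβ).pairEquiv_of_auto rfl h hss
        ![x, y, s x, s y] ⟨0, hx⟩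
        (by simp [forall_fin_four, Fin.sum_univ_four, hS2, h1, h2, add_comm])
        (by simp [forall_fin_four, Fin.sum_univ_four, hs1, matT4])

theorem exists_listed_equivariantC (h : IsIndecomposablePair .equivariantC S s)
    (hss : S.IsSemisimple) :
    ∃ F, Listed .equivariantC F ∧ PairEquiv Kind.auto S s.toLinearMap F.SMap F.sMap := by
  obtain ⟨hs, hS, hi⟩ := isIndecomposablePair_iff.1 h
  have := hi.1
  have hs1 : ∀ x, s (s x) = -x := fun x => (hs x).trans (neg_one_smul ℝ x)
  have hS1 : ∀ x, s (S x) = S (s x) := fun x => (hS x).trans (one_smul ℝ _)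
  rcases exists_eigenvector_or_isComplexPair S with ⟨α, x, hx, h1⟩ | ⟨α, β, x, y, hβ, hx, h1, h2⟩
  · exact (Listed.equivariantC_real α).pairEquiv_of_auto rfl h hss ![x, s x] ⟨0, hx⟩
      (by simp [Fin.forall_fin_two, ← hS1, h1]) (by simp [Fin.forall_fin_two, hs1, matJ])
  · obtain ⟨σ, v, w, hσ, hv, h3, h4, h5, h6⟩ : ∃ (σ : ℝ) (v w : X), (σ = 1 ∨ σ = -1) ∧ v ≠ 0 ∧
        S v = α • v + β • w ∧ S w = -β • v + α • w ∧ s v = σ • w ∧ s w = -(σ • v) := by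
      -- On the pair, K : x ↦ y ↦ -x is a complex structure compatible with s, and both square to
      -- -1. Either s x = K x, or (K - s)x is a nonzero vector on which s = -K.
      by_cases h0 : y - s x = 0
      · have h3 : s x = y := (sub_eq_zero.1 h0).symm
        exact ⟨1, x, y, Or.inl rfl, hx, h1, h2, by rw [h3, one_smul],
          by rw [← h3, hs1, one_smul]⟩
      · refine ⟨-1, y - s x, -x - s y, Or.inr rfl, h0, ?_, ?_, ?_, ?_⟩
        · rw [map_sub, ← hS1, h1, h2, map_add, map_smul, map_smul]; module
        · rw [map_sub, map_neg, ← hS1, h1, h2, map_add, map_smul, map_smul]; module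
        · rw [map_sub, hs1]; module
        · rw [map_sub, map_neg, hs1]; module
    exact (Listed.equivariantC_complex σ α β hσ hβ).pairEquiv_of_auto rfl h hss ![v, w] ⟨0, hv⟩
      (by simp [Fin.forall_fin_two, h3, h4]) (by simp [Fin.forall_fin_two, h5, h6, matJ])

theorem exists_listed_reversibleC (h : IsIndecomposablePair .reversibleC S s)
    (hss : S.IsSemisimple) :
    ∃ F, Listed .reversibleC F ∧ PairEquiv Kind.auto S s.toLinearMap F.SMap F.sMap := by
  obtain ⟨hs, hS, hi⟩ := isIndecomposablePair_iff.1 h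
  have := hi.1
  have hs1 : ∀ x, s (s x) = -x := fun x => (hs x).trans (neg_one_smul ℝ x)
  have hS1 : ∀ x, s (S x) = (-1 : ℝ) • S (s x) := hS
  have hS2 : ∀ x, S (s x) = -s (S x) := fun x => by rw [hS1, neg_one_smul, neg_neg]
  rcases exists_nonneg_eigenvector_or_isComplexPair_of_auto hS1 with
    ⟨α, x, hα, hx, h1⟩ | ⟨α, β, x, y, hα, hβ, hx, h1, h2⟩
  · exact (Listed.reversibleC_real α hα).pairEquiv_of_auto rfl h hss ![x, s x] ⟨0, hx⟩
      (by simp [Fin.forall_fin_two, hS2, h1]) (by simp [Fin.forall_fin_two, hs1, matJ])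
  · exact (Listed.reversibleC_complex α β hα hβ).pairEquiv_of_auto rfl h hss
      ![x, y, s x, s y] ⟨0, hx⟩
      (by simp [forall_fin_four, Fin.sum_univ_four, hS2, h1, h2, add_comm])
      (by simp [forall_fin_four, Fin.sum_univ_four, hs1, matJ4])

end Automorphisms

/-! ### Scalar equations used for normalisation. -/

section Scalars

/-- A binary quadratic form with b ≠ 0 is not zero, so it takes a nonzero value, and rescaling by a
square root makes that value ±1. -/
theorem exists_sq_mul_eq_sign {a b c : ℝ} (hb : b ≠ 0) :
    ∃ p q σ : ℝ, (σ = 1 ∨ σ = -1) ∧ p ^ 2 * a + 2 * p * q * b + q ^ 2 * c = σ := by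
  have key : ∀ {a : ℝ}, a ≠ 0 → ∃ p σ : ℝ, (σ = 1 ∨ σ = -1) ∧ p ^ 2 * a = σ := fun {a} ha => by
    have h1 : (Real.sqrt |a|) ^ 2 = |a| := Real.sq_sqrt (abs_nonneg a)
    have h2 : |a| ≠ 0 := abs_ne_zero.2 ha
    refine ⟨(Real.sqrt |a|)⁻¹, |a|⁻¹ * a, ?_, by rw [inv_pow, h1]⟩
    rcases lt_or_gt_of_ne ha with h | h
    · right; rw [abs_of_neg h]; field_simp
    · left; rw [abs_of_pos h]; field_simp
  by_cases ha : a = 0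
  · by_cases hc : c = 0
    · exact ⟨1, (2 * b)⁻¹, 1, Or.inl rfl, by rw [ha, hc]; field_simp; ring⟩
    · obtain ⟨q, σ, hσ, h⟩ := key hc
      exact ⟨0, q, σ, hσ, by rw [← h]; ring⟩
  · obtain ⟨p, σ, hσ, h⟩ := key ha
    exact ⟨p, 0, σ, hσ, by rw [← h]; ring⟩

/-- Every nonzero complex number `a - b i` is the inverse of a square. -/
theorem exists_complex_sqrt_inv {a b : ℝ} (h : a ≠ 0 ∨ b ≠ 0) :
    ∃ p q : ℝ, a * (p ^ 2 - q ^ 2) + b * (2 * p * q) = 1 ∧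
      a * (2 * p * q) - b * (p ^ 2 - q ^ 2) = 0 := by
  obtain ⟨w, hw⟩ := IsAlgClosed.exists_pow_nat_eq (⟨a, -b⟩ : ℂ)⁻¹ two_pos
  have hc : (⟨a, -b⟩ : ℂ) ≠ 0 := fun h0 => by
    have h1 := congrArg Complex.re h0
    have h2 := congrArg Complex.im h0
    simp at h1 h2
    exact h.elim (fun h => h h1) fun h => h h2
  have h1 : (⟨a, -b⟩ : ℂ) * w ^ 2 = 1 := by rw [hw, mul_inv_cancel₀ hc]
  have h2 := congrArg Complex.re h1
  have h3 := congrArg Complex.im h1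
  simp [pow_two] at h2 h3
  exact ⟨w.re, w.im, by linarith, by linarith⟩

end Scalars

/-! ### Dual eigenvectors for the form ω. -/

section AntiAutomorphisms

variable {X : Type*} [NormedAddCommGroup X] [InnerProductSpace ℝ X] [FiniteDimensional ℝ X]
variable {S : Module.End ℝ X} {s : X ≃ₗ[ℝ] X} {α β ε μ : ℝ} {x y z w : X}

/-- Semisimplicity gives X = ker A' + A'X. A vector of ker A is orthogonal to A'X, so nondegeneracy
must show on ker A'. -/
theorem exists_ker_inner_ne_zero {A A' : Module.End ℝ X} (hA : ∀ u v, ⟪A u, s v⟫_ℝ = ⟪u, s (A' v)⟫_ℝ)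
    (hs : ∀ x y, ⟪y, s x⟫_ℝ = ε * ⟪x, s y⟫_ℝ)
    (hss : A'.IsSemisimple) (hx : x ≠ 0) (h : A x = 0) : ∃ y, A' y = 0 ∧ ⟪x, s y⟫_ℝ ≠ 0 := by
  by_contra! h0
  refine hx (eq_zero_of_forall_inner_eq_zero (s := s) fun y => ?_)
  obtain ⟨u, hu, _, ⟨v, rfl⟩, rfl⟩ :=
    Submodule.mem_sup.1 (ker_sup_range_of_isSemisimple hss ▸ Submodule.mem_top :
      y ∈ LinearMap.ker A' ⊔ LinearMap.range A')
  rw [hs, map_add, inner_add_right, h0 u hu, ← hA, h, inner_zero_left, add_zero, mul_zero]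

theorem exists_dual_eigenvector (hμ : μ * μ = 1) (hs : ∀ x y, ⟪y, s x⟫_ℝ = ε * ⟪x, s y⟫_ℝ)
    (hS : ∀ x y, ⟪S x, s y⟫_ℝ = μ * ⟪x, s (S y)⟫_ℝ) (hss : S.IsSemisimple)
    (hx : x ≠ 0) (h : S x = α • x) :
    ∃ y, S y = (μ * α) • y ∧ ⟪x, s y⟫_ℝ = 1 := by
  have hA' : (μ • S + -α • (1 : Module.End ℝ X)).IsSemisimple := by
    have := hss.aeval (μ • Polynomial.X + Polynomial.C (-α))
    simpa [Algebra.algebraMap_eq_smul_one] using this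
  -- The ω-adjoint of S is μS, so S - α pairs with μS - α, whose kernel is the eigenspace for μα.
  obtain ⟨y, h1, h2⟩ := exists_ker_inner_ne_zero (s := s) (A := S + -α • (1 : Module.End ℝ X))
    (A' := μ • S + -α • (1 : Module.End ℝ X)) (fun u v => by
      simp [inner_add_left, inner_add_right, inner_smul_left, inner_smul_right, hS]) hs hA' hx
    (by simp [h])
  have h3 : S y = (μ * α) • y := by
    have h4 : μ • S y = α • y := by
      rw [← sub_eq_zero, ← h1]; simp [sub_eq_add_neg]
    rw [mul_smul, ← h4, smul_smul, hμ, one_smul]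
  refine ⟨(⟪x, s y⟫_ℝ)⁻¹ • y, by rw [map_smul, h3, smul_comm], ?_⟩
  rw [map_smul, inner_smul_right, inv_mul_cancel₀ h2]

theorem IsComplexPair.inner_right_left (hμ : μ * μ = 1)
    (hS : ∀ x y, ⟪S x, s y⟫_ℝ = μ * ⟪x, s (S y)⟫_ℝ) (hβ : β ≠ 0)
    (h : IsComplexPair S α β x y) (h' : S z = (μ * α) • z + (μ * β) • w)
    (h'' : S w = -(μ * β) • z + (μ * α) • w) :
    ⟪y, s z⟫_ℝ = ⟪x, s w⟫_ℝ ∧ ⟪y, s w⟫_ℝ = -⟪x, s z⟫_ℝ := by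
  have h1 := hS x z
  have h2 := hS x w
  rw [h.2.1, h'] at h1
  rw [h.2.1, h''] at h2
  simp only [map_add, map_smul, inner_add_left, inner_add_right, inner_smul_right,
    real_inner_smul_left] at h1 h2
  constructor
  · refine mul_left_cancel₀ hβ ?_
    linear_combination h1 + (α * ⟪x, s z⟫_ℝ + β * ⟪x, s w⟫_ℝ) * hμ
  · refine mul_left_cancel₀ hβ ?_
    linear_combination h2 + (α * ⟪x, s w⟫_ℝ - β * ⟪x, s z⟫_ℝ) * hμ

theorem exists_dual_isComplexPair (hμ : μ * μ = 1)
    (hs : ∀ x y, ⟪y, s x⟫_ℝ = ε * ⟪x, s y⟫_ℝ)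
    (hS : ∀ x y, ⟪S x, s y⟫_ℝ = μ * ⟪x, s (S y)⟫_ℝ) (hss : S.IsSemisimple) (hβ : β ≠ 0)
    (h : IsComplexPair S α β x y) :
    ∃ z w, S z = (μ * α) • z + (μ * β) • w ∧ S w = -(μ * β) • z + (μ * α) • w ∧
      ⟪x, s z⟫_ℝ = 1 ∧ ⟪x, s w⟫_ℝ = 0 ∧ ⟪y, s z⟫_ℝ = 0 ∧ ⟪y, s w⟫_ℝ = -1 := by
  -- (νS - α)² + β²: for ν = 1 it annihilates x, and its ω-adjoint is the case ν = μ.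
  let A : ℝ → Module.End ℝ X := fun ν =>
    (ν • S + -α • (1 : Module.End ℝ X)) * (ν • S + -α • (1 : Module.End ℝ X)) +
      β ^ 2 • (1 : Module.End ℝ X)
  have hA : ∀ ν x, A ν x = ν • S (ν • S x - α • x) - α • (ν • S x - α • x) + β ^ 2 • x :=
    fun ν x => by simp [A, sub_eq_add_neg]
  have hA' : (A μ).IsSemisimple := by
    have := hss.aeval ((μ • Polynomial.X + Polynomial.C (-α)) *
      (μ • Polynomial.X + Polynomial.C (-α)) + Polynomial.C (β ^ 2))
    simpa only [A, map_add, map_mul, map_smul, Polynomial.aeval_X, Polynomial.aeval_C,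
      Algebra.algebraMap_eq_smul_one] using this
  obtain ⟨u, h1, h2⟩ := exists_ker_inner_ne_zero (s := s) (A := A 1) (A' := A μ) (x := x)
    (fun u v => by
      simp only [hA, one_smul, map_add, map_sub, map_smul, inner_add_left, inner_sub_left,
        inner_add_right, inner_sub_right, inner_smul_right, real_inner_smul_left, hS]
      ring) hs hA' h.1
    (by rw [hA, h.2.1, one_smul, one_smul, add_sub_cancel_left, map_smul, h.2.2]; module)
  rw [hA] at h1
  obtain ⟨v, hv⟩ : ∃ v, v = β⁻¹ • (μ • S u - α • u) := ⟨_, rfl⟩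
  have h3 : μ • S u = α • u + β • v := by
    rw [hv, smul_smul, mul_inv_cancel₀ hβ, one_smul]; abel
  have h4 : μ • S v = -β • u + α • v := by
    have h5 : μ • S u - α • u = β • v := by rw [h3]; abel
    rw [h5, map_smul] at h1
    have h6 : β • (μ • S v) = β • (-β • u + α • v) := by
      rw [← sub_eq_zero, ← h1]; module
    exact smul_right_injective _ hβ h6
  have h5 : ∀ {a b : X}, μ • S a = b → S a = μ • b := fun hab => by
    rw [← hab, smul_smul, hμ, one_smul]
  -- The pairings of x with u and v form a nonzero complex number; multiplying the pair by its
  -- inverse, a rotation and a scaling, normalises them to 1 and 0.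
  set c := ⟪x, s u⟫_ℝ with hc
  set d := ⟪x, s v⟫_ℝ with hd
  have hr : c ^ 2 + d ^ 2 ≠ 0 := by positivity
  have hz := h5 h3
  have hw := h5 h4
  set r := (c ^ 2 + d ^ 2)⁻¹ with hrdef
  have hr1 : r * (c ^ 2 + d ^ 2) = 1 := inv_mul_cancel₀ hr
  have hz' : S ((r * c) • u + (r * d) • v) = (μ * α) • ((r * c) • u + (r * d) • v) +
      (μ * β) • ((r * c) • v - (r * d) • u) := by
    rw [map_add, map_smul, map_smul, hz, hw]; module
  have hw' : S ((r * c) • v - (r * d) • u) = -(μ * β) • ((r * c) • u + (r * d) • v) +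
      (μ * α) • ((r * c) • v - (r * d) • u) := by
    rw [map_sub, map_smul, map_smul, hz, hw]; module
  have h6 : ⟪x, s ((r * c) • u + (r * d) • v)⟫_ℝ = 1 := by
    rw [map_add, map_smul, map_smul, inner_add_right, inner_smul_right, inner_smul_right, ← hc,
      ← hd, ← hr1]
    ring
  have h7 : ⟪x, s ((r * c) • v - (r * d) • u)⟫_ℝ = 0 := by
    rw [map_sub, map_smul, map_smul, inner_sub_right, inner_smul_right, inner_smul_right, ← hc,
      ← hd]
    ring
  obtain ⟨h8, h9⟩ := h.inner_right_left hμ hS hβ hz' hw'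
  exact ⟨_, _, hz', hw', h6, h7, h8.trans h7, by rw [h9, h6]⟩

/-- For `μ = -1` the eigenvalues of `S` are symmetric with respect to the imaginary axis. -/
theorem exists_nonneg_eigenvector_or_isComplexPair_of_anti [Nontrivial X]
    (hs : ∀ x y, ⟪y, s x⟫_ℝ = ε * ⟪x, s y⟫_ℝ)
    (hS : ∀ x y, ⟪S x, s y⟫_ℝ = -1 * ⟪x, s (S y)⟫_ℝ) (hss : S.IsSemisimple) :
    (∃ (α : ℝ) (x : X), 0 ≤ α ∧ x ≠ 0 ∧ S x = α • x) ∨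
      ∃ (α β : ℝ) (x y : X), 0 ≤ α ∧ 0 < β ∧ IsComplexPair S α β x y := by
  have hne : ∀ {x y : X}, ⟪x, s y⟫_ℝ = 1 → y ≠ 0 := by
    rintro x _ h rfl
    simp at h
  rcases exists_eigenvector_or_isComplexPair S with ⟨α, x, hx, h⟩ | ⟨α, β, x, y, hβ, h⟩
  · left
    rcases le_or_gt 0 α with hα | hα
    · exact ⟨α, x, hα, hx, h⟩
    · obtain ⟨y, hy, h1⟩ := exists_dual_eigenvector (by norm_num) hs hS hss hx h
      exact ⟨-1 * α, y, by linarith, hne h1, hy⟩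
  · right
    rcases le_or_gt 0 α with hα | hα
    · exact ⟨α, β, x, y, hα, hβ, h⟩
    · obtain ⟨z, w, hz, hw, h1, -⟩ := exists_dual_isComplexPair (by norm_num) hs hS hss hβ.ne' h
      exact ⟨-1 * α, β, z, -w, by linarith, hβ, hne h1, by rw [hz]; module,
        by rw [map_neg, hw]; module⟩

/-- The eigenspaces of `S` away from the imaginary axis are isotropic if `μ = -1`. -/
theorem inner_eq_zero_of_re_ne_zero (hS : ∀ x y, ⟪S x, s y⟫_ℝ = -1 * ⟪x, s (S y)⟫_ℝ) (hα : α ≠ 0)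
    (h : S x = α • x + β • y) (h' : S y = -β • x + α • y) :
    ⟪x, s x⟫_ℝ = 0 ∧ ⟪x, s y⟫_ℝ = 0 ∧ ⟪y, s x⟫_ℝ = 0 ∧ ⟪y, s y⟫_ℝ = 0 := by
  have h1 := hS x x
  have h2 := hS x y
  have h3 := hS y x
  have h4 := hS y y
  simp only [h, h', map_add, map_smul, inner_add_left, inner_add_right, inner_smul_right,
    real_inner_smul_left] at h1 h2 h3 h4
  -- The four equations form a linear system for the Gram matrix. Its eigenvalues are sums of two of
  -- the numbers α ± iβ, all nonzero when α ≠ 0.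
  have hr : 2 * α * (α ^ 2 + β ^ 2) ≠ 0 := by positivity
  have hb : ⟪x, s y⟫_ℝ = 0 := by
    refine (mul_eq_zero.1 (?_ : 2 * α * (α ^ 2 + β ^ 2) * ⟪x, s y⟫_ℝ = 0)).resolve_left hr
    linear_combination α ^ 2 * h2 + α * β / 2 * (h1 - h4) + β ^ 2 / 2 * (h2 - h3)
  have hc : ⟪y, s x⟫_ℝ = 0 := by
    refine mul_left_cancel₀ hα ?_
    linear_combination (h3 - h2) / 2 + α * hb
  rw [hb, hc] at h1 h4
  refine ⟨?_, hb, hc, ?_⟩ <;> refine mul_left_cancel₀ hα ?_ <;> linarith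

/-- The eigenspaces of `S` are isotropic if `S` is anti-symplectic. -/
theorem inner_eq_zero_of_antiSymplectic (hs : ∀ x y, ⟪y, s x⟫_ℝ = -1 * ⟪x, s y⟫_ℝ)
    (hS : ∀ x y, ⟪S x, s y⟫_ℝ = 1 * ⟪x, s (S y)⟫_ℝ) (hβ : β ≠ 0)
    (h : S x = α • x + β • y) : ⟪x, s y⟫_ℝ = 0 := by
  have h1 := hS x x
  have h2 := hs x y
  simp only [h, map_add, map_smul, inner_add_left, inner_add_right, inner_smul_right,
    real_inner_smul_left] at h1
  rw [h2] at h1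
  refine mul_left_cancel₀ hβ ?_
  linarith

theorem inner_self_eq_zero_of_skew (hs : ∀ x y, ⟪y, s x⟫_ℝ = -1 * ⟪x, s y⟫_ℝ) (x : X) :
    ⟪x, s x⟫_ℝ = 0 := by
  linarith [hs x x]

end AntiAutomorphisms

/-! ### Normal forms for anti-automorphisms. -/

section AntiAutomorphisms

variable {X : Type*} [NormedAddCommGroup X] [InnerProductSpace ℝ X] [FiniteDimensional ℝ X]
variable {S : Module.End ℝ X} {s : X ≃ₗ[ℝ] X}

/-- An eigenvector for an eigenvalue with `μ α = α` can be normalised if the form is symmetric. -/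
theorem exists_unit_eigenvector {α μ : ℝ} {x : X} (hμ : μ * μ = 1) (hα : μ * α = α)
    (hs : ∀ x y, ⟪y, s x⟫_ℝ = 1 * ⟪x, s y⟫_ℝ)
    (hS : ∀ x y, ⟪S x, s y⟫_ℝ = μ * ⟪x, s (S y)⟫_ℝ) (hss : S.IsSemisimple)
    (hx : x ≠ 0) (h : S x = α • x) :
    ∃ (σ : ℝ) (u : X), (σ = 1 ∨ σ = -1) ∧ S u = α • u ∧ ⟪u, s u⟫_ℝ = σ := by
  obtain ⟨y, hy, h1⟩ := exists_dual_eigenvector hμ hs hS hss hx h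
  rw [hα] at hy
  obtain ⟨p, q, σ, hσ, h2⟩ := exists_sq_mul_eq_sign (a := ⟪x, s x⟫_ℝ) (c := ⟪y, s y⟫_ℝ)
    (one_ne_zero (α := ℝ))
  refine ⟨σ, p • x + q • y, hσ, by rw [map_add, map_smul, map_smul, h, hy]; module, ?_⟩
  rw [← h2]
  simp only [map_add, map_smul, inner_add_left, inner_add_right, inner_smul_right,
    real_inner_smul_left, hs x y, h1]
  ring

theorem exists_listed_symmetric (h : IsIndecomposablePair .symmetric S s)
    (hss : S.IsSemisimple) :
    ∃ F, Listed .symmetric F ∧ PairEquiv Kind.anti S s.toLinearMap F.SMap F.sMap := by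
  obtain ⟨hs, hS, hi⟩ := isIndecomposablePair_iff.1 h
  have := hi.1
  have hs1 : ∀ x y, ⟪y, s x⟫_ℝ = 1 * ⟪x, s y⟫_ℝ := hs
  have hS1 : ∀ x y, ⟪S x, s y⟫_ℝ = 1 * ⟪x, s (S y)⟫_ℝ := hS
  rcases exists_eigenvector_or_isComplexPair S with ⟨α, x, hx, h1⟩ | ⟨α, β, x, y, hβ, h1⟩
  · obtain ⟨σ, u, hσ, h2, h3⟩ :=
      exists_unit_eigenvector (by norm_num) (one_mul α) hs1 hS1 hss hx h1
    exact (Listed.symmetric_real σ α hσ).pairEquiv_of_anti rfl h ![u]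
      (by simpa using h2) (by simpa using h3)
  · obtain ⟨z, w, hz, hw, h2, h3, h4, h5⟩ :=
      exists_dual_isComplexPair (by norm_num) hs1 hS1 hss hβ.ne' h1
    rw [one_mul, one_mul] at hz hw
    have hadd : S (x + z) = α • (x + z) + β • (y + w) := by rw [map_add, h1.2.1, hz]; module
    have hadd' : S (y + w) = -β • (x + z) + α • (y + w) := by rw [map_add, h1.2.2, hw]; module
    -- If x and its dual z are both isotropic, then ω(x + z, x + z) = 2 since ω is symmetric.
    obtain ⟨u, v, h6, h7, h8⟩ : ∃ u v, S u = α • u + β • v ∧ S v = -β • u + α • v ∧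
        (⟪u, s u⟫_ℝ ≠ 0 ∨ ⟪u, s v⟫_ℝ ≠ 0) := by
      by_cases hx : ⟪x, s x⟫_ℝ = 0
      · by_cases hz' : ⟪z, s z⟫_ℝ = 0
        · refine ⟨x + z, y + w, hadd, hadd', Or.inl ?_⟩
          simp [inner_add_left, inner_add_right, hx, hz', hs1 x z, h2]
        · exact ⟨z, w, hz, hw, Or.inl hz'⟩
      · exact ⟨x, y, h1.2.1, h1.2.2, Or.inl hx⟩
    have h9 : ⟪v, s v⟫_ℝ = -⟪u, s u⟫_ℝ := by
      have h10 := hS1 u v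
      simp only [h6, h7, map_add, map_smul, inner_add_left, inner_add_right, inner_smul_right,
        real_inner_smul_left] at h10
      refine mul_left_cancel₀ hβ.ne' ?_
      linarith
    -- ω(u, u) - iω(u, v) behaves like a complex quadratic form, so multiplying the pair by a
    -- complex number scales it by a square; over ℂ it can be made 1 and no sign survives.
    obtain ⟨p, q, h10, h11⟩ := exists_complex_sqrt_inv h8
    have h12 : ⟪p • u + q • v, s (p • u + q • v)⟫_ℝ = 1 := by
      simp only [map_add, map_smul, inner_add_left, inner_add_right, inner_smul_right,
        real_inner_smul_left, hs1 u v, h9]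
      linarith
    have h13 : ⟪p • u + q • v, s (p • v - q • u)⟫_ℝ = 0 := by
      simp only [map_sub, map_smul, inner_add_left, inner_sub_right, inner_smul_right,
        real_inner_smul_left, hs1 u v, h9]
      linarith
    have h14 : ⟪p • v - q • u, s (p • v - q • u)⟫_ℝ = -1 := by
      simp only [map_sub, map_smul, inner_sub_left, inner_sub_right, inner_smul_right,
        real_inner_smul_left, hs1 u v, h9]
      linarith
    have h15 : ⟪p • v - q • u, s (p • u + q • v)⟫_ℝ = 0 := by rw [hs1, h13, mul_zero]
    refine (Listed.symmetric_complex α β hβ).pairEquiv_of_anti rfl h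
      ![p • u + q • v, p • v - q • u] ?_ ?_
    · simp only [Fin.forall_fin_two, Fin.sum_univ_two, Matrix.cons_val_zero, Matrix.cons_val_one,
        Matrix.of_apply, Matrix.cons_val_fin_one, map_add, map_sub, map_smul, h6, h7]
      constructor <;> module
    · simp only [Fin.forall_fin_two, Matrix.cons_val_zero, Matrix.cons_val_one,
        Matrix.of_apply, Matrix.cons_val_fin_one, h12, h13, h14, h15, matR]
      simp

theorem exists_listed_antiSymmetric (h : IsIndecomposablePair .antiSymmetric S s)
    (hss : S.IsSemisimple) :
    ∃ F, Listed .antiSymmetric F ∧ PairEquiv Kind.anti S s.toLinearMap F.SMap F.sMap := by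
  obtain ⟨hs, hS, hi⟩ := isIndecomposablePair_iff.1 h
  have := hi.1
  have hs1 : ∀ x y, ⟪y, s x⟫_ℝ = 1 * ⟪x, s y⟫_ℝ := hs
  have hS1 : ∀ x y, ⟪S x, s y⟫_ℝ = -1 * ⟪x, s (S y)⟫_ℝ := hS
  rcases exists_nonneg_eigenvector_or_isComplexPair_of_anti hs1 hS1 hss with
    ⟨α, x, hα, hx, h1⟩ | ⟨α, β, x, y, hα, hβ, h1⟩
  · rcases hα.eq_or_lt with rfl | hα
    · obtain ⟨σ, u, hσ, h2, h3⟩ :=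
        exists_unit_eigenvector (by norm_num) (mul_zero (-1)) hs1 hS1 hss hx h1
      exact (Listed.antiSymmetric_zero σ hσ).pairEquiv_of_anti rfl h ![u]
        (by simpa using h2) (by simpa using h3)
    · obtain ⟨y, hy, h2⟩ := exists_dual_eigenvector (by norm_num) hs1 hS1 hss hx h1
      have h3 := (inner_eq_zero_of_re_ne_zero (β := 0) (y := (0 : X)) (x := x) hS1 hα.ne'
        (by simp [h1]) (by simp)).1
      have h4 := (inner_eq_zero_of_re_ne_zero (α := -1 * α) (β := 0) (y := (0 : X)) (x := y) hS1
        (by linarith) (by simp [hy]) (by simp)).1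
      have h5 : ⟪y, s x⟫_ℝ = 1 := by rw [hs1, h2, mul_one]
      exact (Listed.antiSymmetric_real α hα).pairEquiv_of_anti rfl h ![x, y]
        (by simp [Fin.forall_fin_two, h1, hy]) (by simp [Fin.forall_fin_two, matT, h2, h3, h4, h5])
  · obtain ⟨z, w, hz, hw, h2, h3, h4, h5⟩ :=
      exists_dual_isComplexPair (by norm_num) hs1 hS1 hss hβ.ne' h1
    rcases hα.eq_or_lt with rfl | hα
    · obtain ⟨p, q, σ, hσ, h6⟩ := exists_sq_mul_eq_sign (a := ⟪x, s x⟫_ℝ) (c := ⟪z, s z⟫_ℝ)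
        (one_ne_zero (α := ℝ))
      obtain ⟨u, v, h7, h8, h9⟩ : ∃ u v, S u = β • v ∧ S v = -β • u ∧ ⟪u, s u⟫_ℝ = σ := by
        -- For μ = -1 and α = 0 the pair (z, -w) has the same eigenvalue as (x, y), so the two may
        -- be combined; over this combination ω(u, u) is a quadratic form with mixed coefficient 1.
        refine ⟨p • x + q • z, p • y - q • w, ?_, ?_, ?_⟩
        · rw [map_add, map_smul, map_smul, h1.2.1, hz]; module
        · rw [map_sub, map_smul, map_smul, h1.2.2, hw]; module
        · rw [← h6]
          simp only [map_add, map_smul, inner_add_left, inner_add_right, inner_smul_right,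
            real_inner_smul_left, hs1 x z, h2]
          ring
      have h10 : ⟪u, s v⟫_ℝ = 0 := by
        have h11 := hS1 u u
        simp only [h7, map_smul, inner_smul_right, real_inner_smul_left, hs1 u v] at h11
        refine mul_left_cancel₀ hβ.ne' ?_
        linarith
      have h12 : ⟪v, s u⟫_ℝ = 0 := by rw [hs1, h10, mul_zero]
      have h13 : ⟪v, s v⟫_ℝ = σ := by
        have h11 := hS1 u v
        simp only [h7, h8, map_smul, inner_smul_right, real_inner_smul_left, h9] at h11
        refine mul_left_cancel₀ hβ.ne' ?_
        linarith
      exact (Listed.antiSymmetric_imaginary σ β hσ hβ).pairEquiv_of_anti rfl h ![u, v]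
        (by simp [Fin.forall_fin_two, h7, h8]) (by simp [Fin.forall_fin_two, h9, h10, h12, h13])
    · obtain ⟨h6, h7, h8, h9⟩ := inner_eq_zero_of_re_ne_zero hS1 hα.ne' h1.2.1 h1.2.2
      obtain ⟨h10, h11, h12, h13⟩ := inner_eq_zero_of_re_ne_zero hS1 (by linarith) hz hw
      have h14 : ⟪z, s x⟫_ℝ = 1 := by rw [hs1, h2, mul_one]
      have h15 : ⟪w, s x⟫_ℝ = 0 := by rw [hs1, h3, mul_zero]
      have h16 : ⟪z, s y⟫_ℝ = 0 := by rw [hs1, h4, mul_zero]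
      have h17 : ⟪w, s y⟫_ℝ = -1 := by rw [hs1, h5, one_mul]
      exact (Listed.antiSymmetric_complex α β hα hβ).pairEquiv_of_anti rfl h ![x, y, z, -w]
        (by simp [forall_fin_four, Fin.sum_univ_four, h1.2.1, h1.2.2, hz, hw, add_comm])
        (by simp [forall_fin_four, matT4, h2, h3, h4, h5, h6, h7, h8, h9, h10, h11, h12, h13, h14,
          h15, h16, h17])

theorem exists_listed_antiSymplectic (h : IsIndecomposablePair .antiSymplectic S s)
    (hss : S.IsSemisimple) :
    ∃ F, Listed .antiSymplectic F ∧ PairEquiv Kind.anti S s.toLinearMap F.SMap F.sMap := by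
  obtain ⟨hs, hS, hi⟩ := isIndecomposablePair_iff.1 h
  have := hi.1
  have hs1 : ∀ x y, ⟪y, s x⟫_ℝ = -1 * ⟪x, s y⟫_ℝ := hs
  have hS1 : ∀ x y, ⟪S x, s y⟫_ℝ = 1 * ⟪x, s (S y)⟫_ℝ := hS
  have h0 := inner_self_eq_zero_of_skew hs1
  rcases exists_eigenvector_or_isComplexPair S with ⟨α, x, hx, h1⟩ | ⟨α, β, x, y, hβ, h1⟩
  · obtain ⟨y, hy, h2⟩ := exists_dual_eigenvector (by norm_num) hs1 hS1 hss hx h1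
    have h3 : ⟪y, s x⟫_ℝ = -1 := by rw [hs1, h2, mul_one]
    exact (Listed.antiSymplectic_real α).pairEquiv_of_anti rfl h ![x, -y]
      (by simp [Fin.forall_fin_two, h1, hy]) (by simp [Fin.forall_fin_two, matJ, h2, h3, h0])
  · obtain ⟨z, w, hz, hw, h2, h3, h4, h5⟩ :=
      exists_dual_isComplexPair (by norm_num) hs1 hS1 hss hβ.ne' h1
    rw [one_mul, one_mul] at hz hw
    have h6 := inner_eq_zero_of_antiSymplectic hs1 hS1 hβ.ne' h1.2.1
    have h7 := inner_eq_zero_of_antiSymplectic hs1 hS1 hβ.ne' hz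
    have h8 : ⟪y, s x⟫_ℝ = 0 := by rw [hs1, h6, mul_zero]
    have h9 : ⟪w, s z⟫_ℝ = 0 := by rw [hs1, h7, mul_zero]
    have h14 : ⟪z, s x⟫_ℝ = -1 := by rw [hs1, h2, mul_one]
    have h15 : ⟪w, s x⟫_ℝ = 0 := by rw [hs1, h3, mul_zero]
    have h16 : ⟪z, s y⟫_ℝ = 0 := by rw [hs1, h4, mul_zero]
    have h17 : ⟪w, s y⟫_ℝ = 1 := by rw [hs1, h5]; norm_num
    exact (Listed.antiSymplectic_complex α β hβ).pairEquiv_of_anti rfl h ![x, y, -z, w]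
      (by simp [forall_fin_four, Fin.sum_univ_four, h1.2.1, h1.2.2, hz, hw, add_comm])
      (by simp [forall_fin_four, matJ4, h0, h2, h3, h4, h5, h6, h7, h8, h9, h14, h15, h16, h17])

theorem exists_listed_symplectic (h : IsIndecomposablePair .symplectic S s)
    (hss : S.IsSemisimple) :
    ∃ F, Listed .symplectic F ∧ PairEquiv Kind.anti S s.toLinearMap F.SMap F.sMap := by
  obtain ⟨hs, hS, hi⟩ := isIndecomposablePair_iff.1 h
  have := hi.1
  have hs1 : ∀ x y, ⟪y, s x⟫_ℝ = -1 * ⟪x, s y⟫_ℝ := hs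
  have hS1 : ∀ x y, ⟪S x, s y⟫_ℝ = -1 * ⟪x, s (S y)⟫_ℝ := hS
  have h0 := inner_self_eq_zero_of_skew hs1
  rcases exists_nonneg_eigenvector_or_isComplexPair_of_anti hs1 hS1 hss with
    ⟨α, x, hα, hx, h1⟩ | ⟨α, β, x, y, hα, hβ, h1⟩
  · obtain ⟨y, hy, h2⟩ := exists_dual_eigenvector (by norm_num) hs1 hS1 hss hx h1
    have h3 : ⟪y, s x⟫_ℝ = -1 := by rw [hs1, h2, mul_one]
    exact (Listed.symplectic_real α hα).pairEquiv_of_anti rfl h ![x, -y]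
      (by simp [Fin.forall_fin_two, h1, hy]) (by simp [Fin.forall_fin_two, matJ, h2, h3, h0])
  · obtain ⟨z, w, hz, hw, h2, h3, h4, h5⟩ :=
      exists_dual_isComplexPair (by norm_num) hs1 hS1 hss hβ.ne' h1
    rcases hα.eq_or_lt with rfl | hα
    · obtain ⟨p, q, σ, hσ, h6⟩ := exists_sq_mul_eq_sign (a := ⟪x, s y⟫_ℝ) (b := -1)
        (c := ⟪w, s z⟫_ℝ) (by norm_num)
      obtain ⟨u, v, h7, h8, h9⟩ : ∃ u v, S u = β • v ∧ S v = -β • u ∧ ⟪u, s v⟫_ℝ = σ := by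
        refine ⟨p • x - q • w, p • y - q • z, ?_, ?_, ?_⟩
        · rw [map_sub, map_smul, map_smul, h1.2.1, hw]; module
        · rw [map_sub, map_smul, map_smul, h1.2.2, hz]; module
        · rw [← h6]
          simp only [map_sub, map_smul, inner_sub_left, inner_sub_right, inner_smul_right,
            real_inner_smul_left, hs1 y w, h2, h5]
          ring
      have h10 : ⟪v, s u⟫_ℝ = -σ := by rw [hs1, h9, neg_one_mul]
      -- The upper right entry of J is -1, so ω(u, v) = σ belongs to the table sign -σ.
      exact (Listed.symplectic_imaginary (-σ) β (by rcases hσ with rfl | rfl <;> norm_num)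
        hβ).pairEquiv_of_anti rfl h ![u, v]
        (by simp [Fin.forall_fin_two, h7, h8]) (by simp [Fin.forall_fin_two, h9, h10, h0, matJ])
    · obtain ⟨h6, h7, h8, h9⟩ := inner_eq_zero_of_re_ne_zero hS1 hα.ne' h1.2.1 h1.2.2
      obtain ⟨h10, h11, h12, h13⟩ := inner_eq_zero_of_re_ne_zero hS1 (by linarith) hz hw
      have h14 : ⟪z, s x⟫_ℝ = -1 := by rw [hs1, h2, mul_one]
      have h15 : ⟪w, s x⟫_ℝ = 0 := by rw [hs1, h3, mul_zero]
      have h16 : ⟪z, s y⟫_ℝ = 0 := by rw [hs1, h4, mul_zero]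
      have h17 : ⟪w, s y⟫_ℝ = 1 := by rw [hs1, h5]; norm_num
      exact (Listed.symplectic_complex α β hα hβ).pairEquiv_of_anti rfl h ![x, y, -z, w]
        (by simp [forall_fin_four, Fin.sum_univ_four, h1.2.1, h1.2.2, hz, hw, add_comm])
        (by simp [forall_fin_four, matJ4, h2, h3, h4, h5, h6, h7, h8, h9, h10, h11, h12, h13, h14,
          h15, h16, h17])

/-- Every semisimple indecomposable pair is equivalent to a listed pair. -/
theorem IsIndecomposablePair.exists_listed {T : MapType} (h : IsIndecomposablePair T S s)
    (hss : S.IsSemisimple) :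
    ∃ F, Listed T F ∧ PairEquiv T.kind S s.toLinearMap F.SMap F.sMap := by
  cases T
  · exact exists_listed_equivariantR h hss
  · exact exists_listed_reversibleR h hss
  · exact exists_listed_equivariantC h hss
  · exact exists_listed_reversibleC h hss
  · exact exists_listed_symmetric h hss
  · exact exists_listed_antiSymmetric h hss
  · exact exists_listed_antiSymplectic h hss
  · exact exists_listed_symplectic h hss

end AntiAutomorphisms

theorem IsIndecomposablePair.existsUnique_listed {T : MapType} {X : Type*}
    [NormedAddCommGroup X] [InnerProductSpace ℝ X] [FiniteDimensional ℝ X] {S : Module.End ℝ X}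
    {s : X ≃ₗ[ℝ] X} (h : IsIndecomposablePair T S s) (hss : S.IsSemisimple) :
    ∃! F : MatrixPair, Listed T F ∧ PairEquiv T.kind S s.toLinearMap F.SMap F.sMap := by
  obtain ⟨F, hF, he⟩ := h.exists_listed hss
  exact ⟨F, ⟨hF, he⟩, fun F' h' => h'.1.eq_of_pairEquiv hF (h'.2.symm.trans he)⟩

end AntiAut

theorem mainTheorem4 (T : AntiAut.MapType)
    {X : Type*} [NormedAddCommGroup X] [InnerProductSpace ℝ X] [FiniteDimensional ℝ X]
    (s : X ≃ₗ[ℝ] X) (L S N : Module.End ℝ X)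
    (hL : AntiAut.IsIndecomposablePair T L s) (hSN : AntiAut.IsJordanChevalley L S N) :
    -- Reduced spaces exist.
    (∃ Y : Submodule ℝ X, AntiAut.IsReducedSpace T.kind s S N Y) ∧
    -- On every reduced space `S` has exactly one of the listed normal forms.
    (∀ (Y : Submodule ℝ X) (hY : AntiAut.IsReducedSpace T.kind s S N Y),
      DirectSum.IsInternal (fun j : Fin (nilpotencyClass N) => Y.map (N ^ (j : ℕ))) ∧
      (∀ j : Fin (nilpotencyClass N),
        Module.finrank ℝ (Y.map (N ^ (j : ℕ))) = Module.finrank ℝ Y) ∧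
      ∃ t : Y ≃ₗ[ℝ] Y, AntiAut.IsReducedStructureMap T.kind s N Y t ∧
        Module.End.IsSemisimple (S.restrict hY.invariant) ∧
        AntiAut.IsIndecomposablePair (T.reduced (nilpotencyClass N))
          (S.restrict hY.invariant) t ∧
        ∃! F : AntiAut.MatrixPair, AntiAut.Listed (T.reduced (nilpotencyClass N)) F ∧
          AntiAut.PairEquiv T.kind (S.restrict hY.invariant) t.toLinearMap F.SMap F.sMap) ∧
    -- The normal form of `L` is determined by that of `S` on a reduced space, and the height.
    (∀ {X' : Type*} [NormedAddCommGroup X'] [InnerProductSpace ℝ X'] [FiniteDimensional ℝ X']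
      (s' : X' ≃ₗ[ℝ] X') (L' S' N' : Module.End ℝ X'),
      AntiAut.IsIndecomposablePair T L' s' → AntiAut.IsJordanChevalley L' S' N' →
      ∀ (Y : Submodule ℝ X) (hY : AntiAut.IsReducedSpace T.kind s S N Y)
        (t : Y ≃ₗ[ℝ] Y) (Y' : Submodule ℝ X')
        (hY' : AntiAut.IsReducedSpace T.kind s' S' N' Y') (t' : Y' ≃ₗ[ℝ] Y'),
        AntiAut.IsReducedStructureMap T.kind s N Y t →
        AntiAut.IsReducedStructureMap T.kind s' N' Y' t' →
        (AntiAut.PairEquiv T.kind L s.toLinearMap L' s'.toLinearMap ↔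
          nilpotencyClass N = nilpotencyClass N' ∧
          AntiAut.PairEquiv T.kind (S.restrict hY.invariant) t.toLinearMap
            (S'.restrict hY'.invariant) t'.toLinearMap)) ∧
    -- Every listed pair is a semisimple indecomposable pair of its type.
    (∀ F : AntiAut.MatrixPair, AntiAut.Listed T F → F.SMap.IsSemisimple ∧
      ∃ s₀ : EuclideanSpace ℝ (Fin F.dim) ≃ₗ[ℝ] EuclideanSpace ℝ (Fin F.dim),
        s₀.toLinearMap = F.sMap ∧ AntiAut.IsIndecomposablePair T F.SMap s₀) ∧
    -- Different listed pairs, in particular those that differ in the sign, are inequivalent.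
    (∀ F F' : AntiAut.MatrixPair, AntiAut.Listed T F → AntiAut.Listed T F' →
      AntiAut.PairEquiv T.kind F.SMap F.sMap F'.SMap F'.sMap → F = F') := by
  have h := hL.isJCSystem hSN
  refine ⟨h.exists_isReducedSpace, fun Y hY => ?_, ?_, fun F hF => ⟨hF.isSimple.semisimple,
    hF.isSimple.isIndecomposablePair⟩, fun F F' hF hF' he => hF.eq_of_pairEquiv hF' he⟩
  · have hinj := h.eq_zero_of_pow_eq_zero hY
    obtain ⟨t, ht⟩ := h.exists_isReducedStructureMap hY
    have hr := hL.reduced hSN hY ht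
    have hss : Module.End.IsSemisimple (S.restrict hY.invariant) :=
      hSN.semisimple.restrict hY.invariant
    refine ⟨AntiAut.isInternal_map_pow h.pow_class hinj (h.tower_eq_top hY),
      fun j => AntiAut.finrank_map_pow hinj j.2, t, ht, hss, hr, ?_⟩
    have hu := hr.existsUnique_listed hss
    rwa [AntiAut.MapType.reduced_kind] at hu
  · intro X' _ _ _ s' L' S' N' hL' hSN' Y hY t Y' hY' t' ht ht'
    have h' := hL'.isJCSystem hSN'
    exact ⟨fun he => h.pairEquiv_reduced h' he hY ht hY' ht',
      fun he => h.pairEquiv_of_reduced h' he.1 hY ht hY' ht' he.2⟩
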